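/- Let $L\ge 0$ be an integer and let $B\in\mathbb R$. There are constants $0<\lambda,\Lambda,C,J^*<\infty$, depending only on $L$ and $B$, such that the following holds. Let $\psi(z)=\tfrac12 z^2+az+\delta\psi(z)$ with $a\in\mathbb R$ and $\delta\psi\in C^2(\mathbb R)$, $|\delta\psi|\le B$, $|\delta\psi''|\le B$, and set $\psi^*(\sigma)=\ln\int_{\mathbb R}e^{\sigma z-\psi(z)}\,dz$. Let $Y_1^{DG}\cong\mathbb R^{L+1}$ be the space of polynomials of degree $\le L$ on $[0,1)$ with the inner product of $L^2(0,1)$. For an integer $J\ge 1$, identify $x\in\mathbb R^J$ with the step function equal to $x_j$ on $[\frac{j-1}{J},\frac jJ)$, let $Q_1:\mathbb R^J\to Y_1^{DG}$ be the restriction to these step functions of the $L^2$-orthogonal projection onto $Y_1^{DG}$, and let $Q_1^t$ be its adjoint with respect to the Euclidean inner product on $\mathbb R^J$. With $H_J(x)=\sum_{j=1}^J\psi(x_j)$, define for $\beta,\hat\beta\in Y_1^{DG}$ $$\psi_J(\beta)=-\frac1J\ln\int_{\{x\in\mathbb R^J:\,Q_1x=\beta\}}e^{-H_J(x)}\,dx,\qquad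 \bar\psi_J^*(\hat\beta)=\frac1J\sum_{j=1}^J\psi^*\big((JQ_1^t\hat\beta)_j\big),\qquad \bar\psi_J(\beta)=\sup_{\hat\beta\in Y_1^{DG}}\big(\langle\beta,\hat\beta\rangle-\bar\psi_J^*(\hat\beta)\big),$$ where $dx$ is the Hausdorff measure on the fibre, of the dimension of the fibre and normalized as Lebesgue measure for the Euclidean structure of $\mathbb R^J$. Then for every integer $J\ge J^*$: (i) the integral defining $\psi_J(\beta)$ is finite and positive and the supremum defining $\bar\psi_J(\beta)$ is finite for every $\beta$, and $\psi_J$ and $\bar\psi_J$ are twice continuously differentiable on $Y_1^{DG}$; (ii) for all $\beta\in Y_1^{DG}$, $2\lambda\,\mathrm{Id}\le\operatorname{Hess}_{Y_1^{DG}}\psi_J(\beta)\le2\Lambda\,\mathrm{Id}$ in the sense of quadratic forms; (iii) for all $\beta\in Y_1^{DG}$, $|\psi_J(\beta)-\bar\psi_J(\beta)|\le\frac CJ$, $\|\nabla\psi_J(\beta)-\nabla\bar\psi_J(\beta)\|\le\frac CJ$ and $\|\operatorname{Hess}\psi_J(\beta)-\operatorname{Hess}\bar\psi_J(\beta)\|\le\frac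 CJ$. -/

import Mathlib

open MeasureTheory Set Polynomial
open scoped RealInnerProductSpace

noncomputable section

namespace SingleBlock

/-- The function `ψ` is of the form `ψ(z) = z ^ 2 / 2 + a z + δψ(z)` with a perturbation `δψ` of
class `C²` such that `δψ` and its second derivative are bounded by `B`. -/
def IsPerturbedQuadratic (B : ℝ) (ψ : ℝ → ℝ) : Prop :=
  ∃ (a : ℝ) (δψ : ℝ → ℝ), ContDiff ℝ 2 δψ ∧ (∀ z, |δψ z| ≤ B) ∧
    (∀ z, |iteratedDeriv 2 δψ z| ≤ B) ∧ ∀ z, ψ z = z ^ 2 / 2 + a * z + δψ z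

/-- The Hamiltonian `H_J(x) = ∑ⱼ ψ(xⱼ)` on `ℝ^J`. -/
def hamiltonian (ψ : ℝ → ℝ) {J : ℕ} (x : EuclideanSpace ℝ (Fin J)) : ℝ := ∑ j, ψ (x j)

/-- The log moment generating function `ψ*(σ) = ln ∫ exp (σ z - ψ(z)) dz`. -/
def logMGF (ψ : ℝ → ℝ) (σ : ℝ) : ℝ := Real.log (∫ z : ℝ, Real.exp (σ * z - ψ z))

/-- Lebesgue measure on the torus `𝕋 = [0, 1)`. -/
abbrev torusMeasure : Measure ℝ := volume.restrict (Ico (0 : ℝ) 1)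

/-- The Hilbert space `L²(𝕋)`. -/
abbrev L2Torus : Type := Lp ℝ 2 torusMeasure

/-- The space `Y_1^{DG}` of (classes of) functions in `L²(𝕋)` that are polynomial of degree at most
`L` on `(0, 1)`, with the inner product inherited from `L²(𝕋)`. -/
def dgSpace (L : ℕ) : Submodule ℝ L2Torus where
  carrier := {y | ∃ p : ℝ[X], p.degree ≤ L ∧ y =ᵐ[torusMeasure] fun θ => p.eval θ}
  add_mem' := by
    rintro y z ⟨p, hp, hy⟩ ⟨q, hq, hz⟩
    refine ⟨p + q, (degree_add_le p q).trans (max_le hp hq), ?_⟩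
    filter_upwards [hy, hz, Lp.coeFn_add y z] with θ h1 h2 h3
    rw [h3, Pi.add_apply, h1, h2, eval_add]
  zero_mem' := ⟨0, by simp, by
    filter_upwards [Lp.coeFn_zero ℝ 2 torusMeasure] with θ h
    rw [h, Pi.zero_apply, eval_zero]⟩
  smul_mem' := by
    rintro c y ⟨p, hp, hy⟩
    refine ⟨c • p, (degree_smul_le c p).trans hp, ?_⟩
    filter_upwards [hy, Lp.coeFn_smul c y] with θ h1 h2
    rw [h2, Pi.smul_apply, h1, eval_smul]

theorem memLp_polynomial (p : ℝ[X]) : MemLp (fun θ => p.eval θ) 2 torusMeasure := by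
  obtain ⟨C, hC⟩ := isCompact_Icc.exists_bound_of_continuousOn
    (s := Icc (0 : ℝ) 1) (f := fun θ => p.eval θ) p.continuous.continuousOn
  refine MemLp.of_bound p.continuous.aestronglyMeasurable C ?_
  filter_upwards [ae_restrict_mem measurableSet_Ico] with θ hθ
  exact hC θ (Ico_subset_Icc_self hθ)

/-- The class in `L²(𝕋)` of a polynomial. -/
def polynomialToL2 : ℝ[X] →ₗ[ℝ] L2Torus where
  toFun p := (memLp_polynomial p).toLp
  map_add' p q := by
    rw [← MemLp.toLp_add]
    exact MemLp.toLp_congr _ _ (Filter.Eventually.of_forall fun θ => by simp)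
  map_smul' c p := by
    rw [RingHom.id_apply, ← MemLp.toLp_const_smul]
    exact MemLp.toLp_congr _ _ (Filter.Eventually.of_forall fun θ => by simp)

instance finiteDimensional_dgSpace (L : ℕ) : FiniteDimensional ℝ (dgSpace L) := by
  have h : dgSpace L ≤ (degreeLT ℝ (L + 1)).map polynomialToL2 := by
    rintro y ⟨p, hp, hy⟩
    refine ⟨p, ?_, ?_⟩
    · rw [SetLike.mem_coe, mem_degreeLT]
      exact lt_of_le_of_lt hp (by exact_mod_cast Nat.lt_succ_self L)
    · refine Lp.ext ?_
      filter_upwards [hy, (memLp_polynomial p).coeFn_toLp] with θ h1 h2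
      rw [h1]
      exact h2
  exact Submodule.finiteDimensional_of_le h

/-- The step function on `[0, 1)` with value `x j` on the `j`-th of the `J` subintervals of equal
length; `j : Fin J` is counted from `0`. -/
def stepFun {J : ℕ} (x : EuclideanSpace ℝ (Fin J)) (θ : ℝ) : ℝ :=
  ∑ j : Fin J, (Ico ((j : ℝ) / J) (((j : ℝ) + 1) / J)).indicator (fun _ => x j) θ

theorem memLp_stepFun {J : ℕ} (x : EuclideanSpace ℝ (Fin J)) :
    MemLp (stepFun x) 2 torusMeasure := by
  unfold stepFun
  exact memLp_finsetSum _ fun j _ => (memLp_const (x j)).indicator measurableSet_Ico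

/-- The embedding of `ℝ^J` into `L²(𝕋)` by step functions. -/
def stepEmbedding (J : ℕ) : EuclideanSpace ℝ (Fin J) →ₗ[ℝ] L2Torus where
  toFun x := (memLp_stepFun x).toLp
  map_add' x y := by
    rw [← MemLp.toLp_add]
    refine MemLp.toLp_congr _ _ (Filter.Eventually.of_forall fun θ => ?_)
    simp [stepFun, ← Finset.sum_add_distrib, indicator_apply, ite_add_ite]
  map_smul' c x := by
    rw [RingHom.id_apply, ← MemLp.toLp_const_smul]
    refine MemLp.toLp_congr _ _ (Filter.Eventually.of_forall fun θ => ?_)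
    simp [stepFun, Finset.mul_sum, indicator_apply]

/-- The operator `Q_1 : ℝ^J → Y_1^{DG}`: the `L²(𝕋)`-orthogonal projection onto `Y_1^{DG}`,
restricted to step functions. -/
def Q (L J : ℕ) : EuclideanSpace ℝ (Fin J) →L[ℝ] dgSpace L :=
  LinearMap.toContinuousLinearMap
    ((dgSpace L).orthogonalProjectionOnto.toLinearMap ∘ₗ stepEmbedding J)

/-- The fibre `{x ∈ ℝ^J | Q_1 x = β}`. -/
def fibre (L J : ℕ) (β : dgSpace L) : Set (EuclideanSpace ℝ (Fin J)) := {x | Q L J x = β}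

/-- The Hausdorff measure on the fibres of `Q_1`. Its dimension is that of the fibres, and it is
normalized to agree with Lebesgue measure with respect to the Euclidean structure of `ℝ^J`. -/
def fibreMeasure (L J : ℕ) (β : dgSpace L) : Measure (EuclideanSpace ℝ (Fin J)) :=
  (Measure.euclideanHausdorffMeasure
    (Module.finrank ℝ (LinearMap.ker (Q L J).toLinearMap))).restrict (fibre L J β)

/-- The single-block free energy `ψ_J(β) = -(1/J) ln ∫_{Q_1 x = β} exp (-H_J(x)) dx`. -/
def blockFreeEnergy (ψ : ℝ → ℝ) (L J : ℕ) (β : dgSpace L) : ℝ :=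
  -(1 / (J : ℝ)) * Real.log (∫ x, Real.exp (-hamiltonian ψ x) ∂(fibreMeasure L J β))

/-- The specific free energy `ψ̄*_J(η) = (1/J) ∑ⱼ ψ*((J Q_1ᵗ η)ⱼ)`, where `Q_1ᵗ` is the adjoint of
`Q_1` for the Euclidean inner product on `ℝ^J`. -/
def grandFreeEnergy (ψ : ℝ → ℝ) (L J : ℕ) (η : dgSpace L) : ℝ :=
  (1 / (J : ℝ)) * ∑ j : Fin J,
    logMGF ψ ((J : ℝ) * (ContinuousLinearMap.adjoint (Q L J) η) j)

/-- The Legendre transform `ψ̄_J(β) = sup_η (⟨β, η⟩ - ψ̄*_J(η))`. -/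
def legendreFreeEnergy (ψ : ℝ → ℝ) (L J : ℕ) (β : dgSpace L) : ℝ :=
  ⨆ η : dgSpace L, (⟪β, η⟫ - grandFreeEnergy ψ L J η)

section Calculus

variable {E : Type*} [NormedAddCommGroup E] [NormedSpace ℝ E]

/-- `m |v| ^ 2 ≤ ⟨v, Hess F(x) v⟩ ≤ M |v| ^ 2` for all `x` and `v`. -/
def HessianBetween (m M : ℝ) (F : E → ℝ) : Prop :=
  ∀ x v : E, m * ‖v‖ ^ 2 ≤ fderiv ℝ (fderiv ℝ F) x v v ∧
    fderiv ℝ (fderiv ℝ F) x v v ≤ M * ‖v‖ ^ 2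

/-- `F` and `G` and their derivatives of first and second order differ by at most `ε`, uniformly. -/
def UniformlyC2Close (ε : ℝ) (F G : E → ℝ) : Prop :=
  ∀ x : E, |F x - G x| ≤ ε ∧ ‖fderiv ℝ F x - fderiv ℝ G x‖ ≤ ε ∧
    ‖fderiv ℝ (fderiv ℝ F) x - fderiv ℝ (fderiv ℝ G) x‖ ≤ ε

end Calculus

end SingleBlock

end

/-!
# Free energies of large blocks

A local central limit theorem gives the estimates. Write `ψ_J` for `blockFreeEnergy` and tilt the
measure `exp (-H_J(x)) dx` by a field `η` in the space of polynomials, so that the sites become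
independent with densities proportional to `exp (⟪a j, η⟫ z - ψ z)`, where `a j = J Q e_j`. On the
fibre `Q x = β` the tilt is constant. Choosing `η` such that `β` is the mean of `Q x` under the
tilted measure, one obtains Cramér's representation

`∫_{Q x = β} exp (-H_J(x)) dx = exp (-J ψ̄_J(β)) * θ * R(η)`

(`exists_integral_slice_eq`), in which `R(η)` is, up to a constant, the density at the origin of
the normalized sum `(1 / √J) ∑ (X j - E X j) • a j`, and `θ` lies between constants and does not
depend on `β`. Therefore `ψ_J - ψ̄_J = -(1 / J) (log θ + log R(η(β)))`, and everything follows from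
bounds on `R` and on the inverse `η(β)` of the gradient of `ψ̄*_J` that are uniform in the field
and in `J` (`exists_block_estimates`).

* By Fourier inversion `R(η) = ∫ ∏ j, h(⟪a j, η⟫, t j) dζ`, where `h(σ, ·)` is the characteristic
  function of the centred one-site measure with field `σ` (`siteChar`) and `t j` is proportional to
  `⟪a j, ζ⟫ / √J`. The one-site measure is comparable with a Gaussian of variance one, and the
  derivative of its density is integrable; this gives `|h| ^ 4 ≤ 1 / (1 + c t ^ 2)`. As the measure
  is centred for every field, `∂_σ h` and `∂_σ² h` are `O(t ^ 2)`, so that each derivative of the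
  product in `η` costs a bounded power of the frequency. Both facts dominate the product and its
  derivatives by an integrable function (`exists_norm_iteratedFDeriv_blockChar_le`), and comparison
  with a Gaussian bounds `R` from below (`exists_blockDensity_bounds`).
* The gradient of `ψ̄*_J` is a strongly monotone map whose first two derivatives are bounded,
  because the second cumulants of the one-site measures lie between positive constants and the
  third ones are bounded. It is thus a diffeomorphism; its inverse is the gradient of the Legendre
  transform `ψ̄_J`, with corresponding bounds (`IsMonotoneField`).
* What is used of the space of polynomials is that the vectors `a j` are bounded and that `(1 / J)
  ∑ ⟪a j, η⟫ ^ 2 ≥ ‖η‖ ^ 2 / 2` once `J` is large: the number `⟪a j, η⟫` is the average of `η` over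
  the `j`-th subinterval, and the step function of these averages is close to `η`
  (`exists_isBlockFrame_Q`).
-/

namespace SingleBlock

open ProbabilityTheory Real
open scoped ContDiff

variable {B : ℝ} {ψ : ℝ → ℝ}

/-! ### Tilted one-site measures -/

/-- The density, with respect to Lebesgue measure, of the probability measure proportional to
`exp (σ z - ψ z) dz`. -/
noncomputable def tiltDensity (ψ : ℝ → ℝ) (σ z : ℝ) : ℝ := exp (σ * z - ψ z - logMGF ψ σ)

/-- The one-site measure with external field `σ`: the probability measure proportional to
`exp (σ z - ψ z) dz`. -/
noncomputable def tilt (ψ : ℝ → ℝ) (σ : ℝ) : Measure ℝ :=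
  volume.withDensity fun z => ENNReal.ofReal (tiltDensity ψ σ z)

theorem IsPerturbedQuadratic.nonneg (h : IsPerturbedQuadratic B ψ) : 0 ≤ B := by
  obtain ⟨a, δ, -, h1, -⟩ := h
  exact (abs_nonneg _).trans (h1 0)

theorem IsPerturbedQuadratic.contDiff (h : IsPerturbedQuadratic B ψ) : ContDiff ℝ 2 ψ := by
  obtain ⟨a, δ, hδ, -, -, hψ⟩ := h
  have : ψ = fun z => z ^ 2 / 2 + a * z + δ z := funext hψ
  rw [this]
  fun_prop

theorem IsPerturbedQuadratic.continuous (h : IsPerturbedQuadratic B ψ) : Continuous ψ :=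
  h.contDiff.continuous

theorem exp_weight_bounds {a : ℝ} {δ : ℝ → ℝ} (hδ : ∀ z, |δ z| ≤ B)
    (hψ : ∀ z, ψ z = z ^ 2 / 2 + a * z + δ z) (σ z : ℝ) :
    exp (-B) * (exp ((σ - a) ^ 2 / 2) * √(2 * π)) * gaussianPDFReal (σ - a) 1 z
        ≤ exp (σ * z - ψ z) ∧
      exp (σ * z - ψ z) ≤
        exp B * (exp ((σ - a) ^ 2 / 2) * √(2 * π)) * gaussianPDFReal (σ - a) 1 z := by
  have hs : √(2 * π) ≠ 0 := by positivity
  have key : ∀ b : ℝ, exp b * (exp ((σ - a) ^ 2 / 2) * √(2 * π)) * gaussianPDFReal (σ - a) 1 z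
      = exp (b + ((σ - a) * z - z ^ 2 / 2)) := by
    intro b
    rw [gaussianPDFReal_def]
    simp only [NNReal.coe_one, mul_one]
    have : exp b * (exp ((σ - a) ^ 2 / 2) * √(2 * π)) *
        ((√(2 * π))⁻¹ * exp (-(z - (σ - a)) ^ 2 / 2)) =
        exp b * exp ((σ - a) ^ 2 / 2) * exp (-(z - (σ - a)) ^ 2 / 2) := by
      field_simp
    rw [this, ← exp_add, ← exp_add]
    congr 1
    ring
  have := abs_le.1 (hδ z)
  rw [key, key, hψ]
  constructor <;> apply exp_le_exp.2 <;> linarith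

theorem IsPerturbedQuadratic.integrable_exp (h : IsPerturbedQuadratic B ψ) (σ : ℝ) :
    Integrable fun z => exp (σ * z - ψ z) := by
  have hc := h.continuous
  obtain ⟨a, δ, -, hδ, -, hψ⟩ := h
  refine ((integrable_gaussianPDFReal (σ - a) 1).const_mul
    (exp B * (exp ((σ - a) ^ 2 / 2) * √(2 * π)))).mono'
    (by fun_prop) (ae_of_all _ fun z => ?_)
  rw [norm_of_nonneg (exp_pos _).le]
  exact (exp_weight_bounds hδ hψ σ z).2

theorem IsPerturbedQuadratic.exp_logMGF (h : IsPerturbedQuadratic B ψ) (σ : ℝ) :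
    exp (logMGF ψ σ) = ∫ z, exp (σ * z - ψ z) := by
  rw [logMGF, exp_log]
  exact integral_exp_pos (h.integrable_exp σ)

theorem tiltDensity_pos (σ z : ℝ) : 0 < tiltDensity ψ σ z := exp_pos _

theorem tiltDensity_eq (σ z : ℝ) :
    tiltDensity ψ σ z = (exp (logMGF ψ σ))⁻¹ * exp (σ * z - ψ z) := by
  rw [tiltDensity, exp_sub, div_eq_inv_mul]

theorem IsPerturbedQuadratic.continuous_tiltDensity (h : IsPerturbedQuadratic B ψ) (σ : ℝ) :
    Continuous (tiltDensity ψ σ) := by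
  have := h.continuous
  unfold tiltDensity
  fun_prop

theorem IsPerturbedQuadratic.integrable_tiltDensity (h : IsPerturbedQuadratic B ψ) (σ : ℝ) :
    Integrable (tiltDensity ψ σ) := by
  have : tiltDensity ψ σ = fun z => (exp (logMGF ψ σ))⁻¹ * exp (σ * z - ψ z) :=
    funext fun z => tiltDensity_eq σ z
  rw [this]
  exact (h.integrable_exp σ).const_mul _

theorem IsPerturbedQuadratic.integral_tiltDensity (h : IsPerturbedQuadratic B ψ) (σ : ℝ) :
    ∫ z, tiltDensity ψ σ z = 1 := by
  simp_rw [tiltDensity_eq]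
  rw [integral_const_mul, ← h.exp_logMGF, inv_mul_cancel₀ (exp_pos _).ne']

theorem IsPerturbedQuadratic.isProbabilityMeasure_tilt (h : IsPerturbedQuadratic B ψ) (σ : ℝ) :
    IsProbabilityMeasure (tilt ψ σ) := by
  refine ⟨?_⟩
  rw [tilt, withDensity_apply _ MeasurableSet.univ, Measure.restrict_univ,
    ← ofReal_integral_eq_lintegral_ofReal (h.integrable_tiltDensity σ)
      (ae_of_all _ fun z => (tiltDensity_pos σ z).le), h.integral_tiltDensity, ENNReal.ofReal_one]

theorem integral_tilt {F : Type*} [NormedAddCommGroup F] [NormedSpace ℝ F]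
    (h : IsPerturbedQuadratic B ψ) (σ : ℝ) (f : ℝ → F) :
    ∫ z, f z ∂(tilt ψ σ) = ∫ z, tiltDensity ψ σ z • f z := by
  rw [tilt, integral_withDensity_eq_integral_toReal_smul₀]
  · simp_rw [ENNReal.toReal_ofReal (tiltDensity_pos σ _).le]
  · exact (h.continuous_tiltDensity σ).measurable.ennreal_ofReal.aemeasurable
  · exact ae_of_all _ fun z => ENNReal.ofReal_lt_top

/-- The first derivative of a function that is bounded together with its second derivative is
bounded: somewhere in `(z, z + 1)` it equals a difference quotient. -/
theorem abs_deriv_le_of_bounds {δ : ℝ → ℝ} (hδ2 : ContDiff ℝ 2 δ) (hδ : ∀ z, |δ z| ≤ B)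
    (hδ'' : ∀ z, |iteratedDeriv 2 δ z| ≤ B) (z : ℝ) : |deriv δ z| ≤ 3 * B := by
  have hd : Differentiable ℝ δ := hδ2.differentiable (by simp)
  have hd' : Differentiable ℝ (deriv δ) :=
    ((contDiff_succ_iff_deriv (n := 1)).1 hδ2).2.2.differentiable (by simp)
  obtain ⟨x, hx, hx'⟩ := exists_deriv_eq_slope δ (lt_add_one z) hd.continuous.continuousOn
    hd.differentiableOn
  rw [add_sub_cancel_left, div_one] at hx'
  have h1 := Convex.norm_image_sub_le_of_norm_deriv_le (𝕜 := ℝ) (s := univ) (f := deriv δ) (C := B)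
    (x := x) (y := z) (fun y _ => hd' y)
    (fun y _ => by
      have := hδ'' y
      rwa [iteratedDeriv_succ, iteratedDeriv_one] at this) convex_univ (mem_univ _) (mem_univ _)
  rw [norm_eq_abs, norm_eq_abs] at h1
  have hB : 0 ≤ B := (abs_nonneg _).trans (hδ 0)
  have h2 : |z - x| ≤ 1 := by rw [abs_le]; constructor <;> linarith [hx.1, hx.2]
  have h3 : B * |z - x| ≤ B := mul_le_of_le_one_right hB h2
  have h4 := abs_le.1 (hδ z)
  have h5 := abs_le.1 (hδ (z + 1))
  have h6 := abs_le.1 (h1.trans h3)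
  rw [abs_le]
  constructor <;> linarith

/-- The density of the tilted measure lies between two multiples of a Gaussian density of variance
one, uniformly in the field. -/
theorem IsPerturbedQuadratic.tiltDensity_bounds (h : IsPerturbedQuadratic B ψ) :
    ∃ a : ℝ, (∀ z, |deriv ψ z - z - a| ≤ 3 * B) ∧
      ∀ σ z, exp (-(2 * B)) * gaussianPDFReal (σ - a) 1 z ≤ tiltDensity ψ σ z ∧
      tiltDensity ψ σ z ≤ exp (2 * B) * gaussianPDFReal (σ - a) 1 z := by
  have hexp := h.exp_logMGF
  have hint := h.integrable_exp
  obtain ⟨a, δ, hδ2, hδ, hδ'', hψ⟩ := h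
  refine ⟨a, fun z => ?_, fun σ z => ?_⟩
  · have hd : Differentiable ℝ δ := hδ2.differentiable (by simp)
    have h1 : HasDerivAt ψ (z + a + deriv δ z) z := by
      rw [funext hψ]
      exact ((((hasDerivAt_id z).pow 2).div_const 2).add ((hasDerivAt_id z).const_mul a)).add
        (hd z).hasDerivAt |>.congr_deriv (by simp)
    rw [h1.deriv, show z + a + deriv δ z - z - a = deriv δ z by ring]
    exact abs_deriv_le_of_bounds hδ2 hδ hδ'' z
  set N := exp ((σ - a) ^ 2 / 2) * √(2 * π) with hN
  have hNpos : 0 < N := by positivity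
  have hg := integrable_gaussianPDFReal (σ - a) 1
  have hg1 := integral_gaussianPDFReal_eq_one (σ - a) (v := 1) one_ne_zero
  have hlow : exp (-B) * N ≤ exp (logMGF ψ σ) := by
    have := integral_mono (hg.const_mul (exp (-B) * N)) (hint σ)
      (fun z => (exp_weight_bounds hδ hψ σ z).1)
    rwa [integral_const_mul, hg1, mul_one, ← hexp] at this
  have hup : exp (logMGF ψ σ) ≤ exp B * N := by
    have := integral_mono (hint σ) (hg.const_mul (exp B * N))
      (fun z => (exp_weight_bounds hδ hψ σ z).2)
    rwa [integral_const_mul, hg1, mul_one, ← hexp] at this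
  have hgn := gaussianPDFReal_nonneg (σ - a) 1 z
  have e1 : exp (-(2 * B)) * exp B = exp (-B) := by rw [← exp_add]; congr 1; ring
  have e2 : exp (2 * B) * exp (-B) = exp B := by rw [← exp_add]; congr 1; ring
  rw [tiltDensity, exp_sub]
  constructor
  · rw [le_div_iff₀ (exp_pos _)]
    calc exp (-(2 * B)) * gaussianPDFReal (σ - a) 1 z * exp (logMGF ψ σ)
        ≤ exp (-(2 * B)) * gaussianPDFReal (σ - a) 1 z * (exp B * N) := by gcongr
      _ = exp (-(2 * B)) * exp B * N * gaussianPDFReal (σ - a) 1 z := by ring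
      _ ≤ _ := by rw [e1]; exact (exp_weight_bounds hδ hψ σ z).1
  · rw [div_le_iff₀ (exp_pos _)]
    calc exp (σ * z - ψ z) ≤ exp B * N * gaussianPDFReal (σ - a) 1 z :=
          (exp_weight_bounds hδ hψ σ z).2
      _ = exp (2 * B) * gaussianPDFReal (σ - a) 1 z * (exp (-B) * N) := by rw [← e2]; ring
      _ ≤ _ := by gcongr

theorem IsPerturbedQuadratic.tilt_bounds (h : IsPerturbedQuadratic B ψ) :
    ∃ a : ℝ, ∀ σ, ENNReal.ofReal (exp (-(2 * B))) • gaussianReal (σ - a) 1 ≤ tilt ψ σ ∧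
      tilt ψ σ ≤ ENNReal.ofReal (exp (2 * B)) • gaussianReal (σ - a) 1 := by
  obtain ⟨a, -, ha⟩ := h.tiltDensity_bounds
  refine ⟨a, fun σ => ?_⟩
  have key : ∀ b : ℝ, ENNReal.ofReal (exp b) • gaussianReal (σ - a) 1 =
      volume.withDensity fun z => ENNReal.ofReal (exp b * gaussianPDFReal (σ - a) 1 z) := by
    intro b
    rw [gaussianReal_of_var_ne_zero _ one_ne_zero,
      ← withDensity_smul _ (measurable_gaussianPDF _ _)]
    congr 1
    ext z
    rw [ENNReal.ofReal_mul (exp_pos _).le]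
    rfl
  rw [key, key, tilt]
  exact ⟨withDensity_mono (ae_of_all _ fun z => ENNReal.ofReal_le_ofReal (ha σ z).1),
    withDensity_mono (ae_of_all _ fun z => ENNReal.ofReal_le_ofReal (ha σ z).2)⟩

theorem integrable_pow_gaussianReal (c : ℝ) (n : ℕ) :
    Integrable (fun z : ℝ => z ^ n) (gaussianReal c 1) := by
  have := (memLp_id_gaussianReal (μ := c) (v := 1) n).integrable_norm_pow'
  refine (integrable_norm_iff (by fun_prop)).1 ?_
  simpa using this

theorem IsPerturbedQuadratic.integrable_pow_tilt (h : IsPerturbedQuadratic B ψ) (σ : ℝ) (n : ℕ) :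
    Integrable (fun z : ℝ => z ^ n) (tilt ψ σ) := by
  obtain ⟨a, ha⟩ := h.tilt_bounds
  exact ((integrable_pow_gaussianReal _ n).smul_measure ENNReal.ofReal_ne_top).mono_measure (ha σ).2

theorem IsPerturbedQuadratic.integrable_eval_tilt (h : IsPerturbedQuadratic B ψ) (σ : ℝ)
    (p : ℝ[X]) : Integrable (fun z : ℝ => p.eval z) (tilt ψ σ) := by
  simp_rw [eval_eq_sum_range]
  exact integrable_finsetSum _ fun i _ => (h.integrable_pow_tilt σ i).const_mul _

theorem IsPerturbedQuadratic.integrable_sub_pow_tilt (h : IsPerturbedQuadratic B ψ) (σ m : ℝ)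
    (n : ℕ) : Integrable (fun z : ℝ => (z - m) ^ n) (tilt ψ σ) := by
  have e : (fun z : ℝ => (z - m) ^ n) = fun z => ((X - C m : ℝ[X]) ^ n).eval z := by
    funext z
    simp
  rw [e]
  exact h.integrable_eval_tilt σ _

/-- The mean of the one-site measure with field `σ`. -/
noncomputable def tiltMean (ψ : ℝ → ℝ) (σ : ℝ) : ℝ := ∫ z, z ∂(tilt ψ σ)

/-- The `n`-th centred moment of the one-site measure with field `σ`. -/
noncomputable def tiltMoment (ψ : ℝ → ℝ) (n : ℕ) (σ : ℝ) : ℝ :=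
  ∫ z, (z - tiltMean ψ σ) ^ n ∂(tilt ψ σ)

theorem IsPerturbedQuadratic.integral_tilt_le (h : IsPerturbedQuadratic B ψ) :
    ∃ a : ℝ, ∀ σ, ∀ f : ℝ → ℝ, (∀ z, 0 ≤ f z) → Integrable f (gaussianReal (σ - a) 1) →
      exp (-(2 * B)) * ∫ z, f z ∂(gaussianReal (σ - a) 1) ≤ ∫ z, f z ∂(tilt ψ σ) ∧
      ∫ z, f z ∂(tilt ψ σ) ≤ exp (2 * B) * ∫ z, f z ∂(gaussianReal (σ - a) 1) := by
  obtain ⟨a, ha⟩ := h.tilt_bounds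
  refine ⟨a, fun σ f hf hi => ?_⟩
  have hup := hi.smul_measure (c := ENNReal.ofReal (exp (2 * B))) ENNReal.ofReal_ne_top
  have h1 := integral_mono_measure (ha σ).1 (ae_of_all _ hf) (hup.mono_measure (ha σ).2)
  have h2 := integral_mono_measure (ha σ).2 (ae_of_all _ hf) hup
  rw [integral_smul_measure, ENNReal.toReal_ofReal (exp_pos _).le, smul_eq_mul] at h1 h2
  exact ⟨h1, h2⟩

theorem integral_sub_pow_gaussianReal (c : ℝ) (n : ℕ) :
    ∫ z, (z - c) ^ n ∂(gaussianReal c 1) = ∫ z, z ^ n ∂(gaussianReal 0 1) := by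
  have : (gaussianReal 0 1).map (· + c) = gaussianReal c 1 := by
    rw [gaussianReal_map_add_const, zero_add]
  rw [← this, integral_map (by fun_prop) (by fun_prop)]
  simp

theorem integrable_sub_pow_gaussianReal (c m : ℝ) (n : ℕ) :
    Integrable (fun z : ℝ => (z - m) ^ n) (gaussianReal c 1) := by
  have : ∀ p : ℝ[X], Integrable (fun z : ℝ => p.eval z) (gaussianReal c 1) := by
    intro p
    simp_rw [eval_eq_sum_range]
    exact integrable_finsetSum _ fun i _ => (integrable_pow_gaussianReal c i).const_mul _
  have e : (fun z : ℝ => (z - m) ^ n) = fun z => ((X - C m : ℝ[X]) ^ n).eval z := by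
    funext z
    simp
  rw [e]
  exact this _

theorem IsPerturbedQuadratic.tiltMoment_one (h : IsPerturbedQuadratic B ψ) (σ : ℝ) :
    tiltMoment ψ 1 σ = 0 := by
  have := h.isProbabilityMeasure_tilt σ
  have hi : Integrable (fun z : ℝ => z) (tilt ψ σ) := by simpa using h.integrable_pow_tilt σ 1
  simp [tiltMoment, tiltMean, integral_sub hi (integrable_const _)]

theorem IsPerturbedQuadratic.exp_le_tiltMoment_two (h : IsPerturbedQuadratic B ψ) (σ : ℝ) :
    exp (-(2 * B)) ≤ tiltMoment ψ 2 σ := by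
  obtain ⟨a, ha⟩ := h.integral_tilt_le
  have h1 := (ha σ (fun z => (z - tiltMean ψ σ) ^ 2) (fun z => sq_nonneg _)
    (integrable_sub_pow_gaussianReal _ _ 2)).1
  refine le_trans ?_ h1
  have h2 : (1 : ℝ) ≤ ∫ z, (z - tiltMean ψ σ) ^ 2 ∂(gaussianReal (σ - a) 1) := by
    have hv : Var[fun z : ℝ => z - tiltMean ψ σ; gaussianReal (σ - a) 1] = 1 := by
      rw [variance_sub_const (by fun_prop)]
      exact variance_fun_id_gaussianReal
    have := variance_le_expectation_sq (μ := gaussianReal (σ - a) 1)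
      (X := fun z : ℝ => z - tiltMean ψ σ) (by fun_prop)
    rw [hv] at this
    exact this
  exact le_mul_of_one_le_right (exp_pos _).le h2

/-- The fourth centred moments of the one-site measures are bounded uniformly in the field. -/
theorem exists_tiltMoment_four_le (B : ℝ) : ∃ M : ℝ, 1 ≤ M ∧ ∀ ψ, IsPerturbedQuadratic B ψ →
    ∀ σ, tiltMoment ψ 4 σ ≤ M := by
  set G : ℕ → ℝ := fun n => ∫ z, z ^ n ∂(gaussianReal 0 1)
  set E := exp (2 * B)
  refine ⟨max 1 (8 * (E * G 4) + 8 * (E * G 2) ^ 2), le_max_left _ _,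
    fun ψ h σ => le_trans ?_ (le_max_right _ _)⟩
  have := h.isProbabilityMeasure_tilt σ
  obtain ⟨a, ha⟩ := h.integral_tilt_le
  set c := σ - a
  set m := tiltMean ψ σ with hm
  have h4 := (ha σ (fun z => (z - c) ^ 4) (fun z => by positivity)
    (integrable_sub_pow_gaussianReal _ _ 4)).2
  have h2 := (ha σ (fun z => (z - c) ^ 2) (fun z => by positivity)
    (integrable_sub_pow_gaussianReal _ _ 2)).2
  rw [integral_sub_pow_gaussianReal] at h4 h2
  have hi : Integrable (fun z : ℝ => z) (tilt ψ σ) := by simpa using h.integrable_pow_tilt σ 1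
  have hmc : (m - c) ^ 2 ≤ E * G 2 := by
    refine le_trans ?_ h2
    have h3 := h.integrable_sub_pow_tilt σ c 2
    have h5 : ∫ z, ((z - c) ^ 2 - 2 * (m - c) * (z - c) + (m - c) ^ 2) ∂(tilt ψ σ) =
        (∫ z, (z - c) ^ 2 ∂(tilt ψ σ)) - (m - c) ^ 2 := by
      rw [integral_add, integral_sub h3, integral_const_mul, integral_sub hi (integrable_const _),
        integral_const, integral_const]
      · simp only [probReal_univ, smul_eq_mul, one_mul]
        rw [show ∫ z, z ∂(tilt ψ σ) = m from rfl]
        ring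
      · exact (hi.sub (integrable_const _)).const_mul _
      · exact h3.sub ((hi.sub (integrable_const _)).const_mul _)
      · exact integrable_const _
    have h6 : 0 ≤ ∫ z, ((z - c) ^ 2 - 2 * (m - c) * (z - c) + (m - c) ^ 2) ∂(tilt ψ σ) :=
      integral_nonneg fun z => by
        have : (z - c) ^ 2 - 2 * (m - c) * (z - c) + (m - c) ^ 2 = (z - m) ^ 2 := by ring
        simp only [this]
        positivity
    linarith
  calc tiltMoment ψ 4 σ ≤ ∫ z, (8 * (z - c) ^ 4 + 8 * (m - c) ^ 4) ∂(tilt ψ σ) := by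
        refine integral_mono (h.integrable_sub_pow_tilt σ m 4)
          (((h.integrable_sub_pow_tilt σ c 4).const_mul 8).add (integrable_const _)) fun z => ?_
        change (z - m) ^ 4 ≤ 8 * (z - c) ^ 4 + 8 * (m - c) ^ 4
        have e : z - m = (z - c) - (m - c) := by ring
        rw [e]
        generalize z - c = x
        generalize m - c = y
        have h1 : (x - y) ^ 2 ≤ 2 * (x ^ 2 + y ^ 2) := by nlinarith [sq_nonneg (x + y)]
        have h2 : ((x - y) ^ 2) ^ 2 ≤ (2 * (x ^ 2 + y ^ 2)) ^ 2 := by gcongr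
        nlinarith [sq_nonneg (x ^ 2 - y ^ 2)]
    _ = 8 * ∫ z, (z - c) ^ 4 ∂(tilt ψ σ) + 8 * ((m - c) ^ 2) ^ 2 := by
        rw [integral_add ((h.integrable_sub_pow_tilt σ c 4).const_mul 8) (integrable_const _),
          integral_const_mul, integral_const]
        simp
        ring
    _ ≤ _ := by gcongr

/-! ### Cumulants of the one-site measures -/

/-- The measure `exp (-ψ(z)) dz`, whose cumulant generating function is `logMGF ψ`. -/
noncomputable def gibbs (ψ : ℝ → ℝ) : Measure ℝ :=
  volume.withDensity fun z => ENNReal.ofReal (exp (-ψ z))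

theorem IsPerturbedQuadratic.integral_gibbs {F : Type*} [NormedAddCommGroup F] [NormedSpace ℝ F]
    (h : IsPerturbedQuadratic B ψ) (f : ℝ → F) :
    ∫ z, f z ∂(gibbs ψ) = ∫ z, exp (-ψ z) • f z := by
  have := h.continuous
  rw [gibbs, integral_withDensity_eq_integral_toReal_smul₀]
  · simp_rw [ENNReal.toReal_ofReal (exp_pos _).le]
  · exact (by fun_prop : Measurable fun z => exp (-ψ z)).ennreal_ofReal.aemeasurable
  · exact ae_of_all _ fun z => ENNReal.ofReal_lt_top

theorem IsPerturbedQuadratic.integrableExpSet_gibbs (h : IsPerturbedQuadratic B ψ) :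
    integrableExpSet id (gibbs ψ) = univ := by
  have hc := h.continuous
  refine eq_univ_of_forall fun σ => ?_
  change Integrable (fun z => exp (σ * id z)) (gibbs ψ)
  rw [gibbs, integrable_withDensity_iff_integrable_smul₀']
  · refine (h.integrable_exp σ).congr (ae_of_all _ fun z => ?_)
    simp only [ENNReal.toReal_ofReal (exp_pos _).le, smul_eq_mul, id]
    rw [← exp_add]
    congr 1
    ring
  · exact (by fun_prop : Measurable fun z => exp (-ψ z)).ennreal_ofReal.aemeasurable
  · exact ae_of_all _ fun z => ENNReal.ofReal_lt_top

theorem IsPerturbedQuadratic.logMGF_eq_cgf (h : IsPerturbedQuadratic B ψ) :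
    logMGF ψ = cgf id (gibbs ψ) := by
  ext σ
  rw [cgf, mgf, h.integral_gibbs, logMGF]
  congr 2
  ext z
  rw [smul_eq_mul, ← exp_add]
  congr 1
  simp only [id]
  ring

theorem IsPerturbedQuadratic.mem_interior (h : IsPerturbedQuadratic B ψ) (σ : ℝ) :
    σ ∈ interior (integrableExpSet id (gibbs ψ)) := by
  simp [h.integrableExpSet_gibbs]

theorem IsPerturbedQuadratic.contDiff_logMGF (h : IsPerturbedQuadratic B ψ) :
    ContDiff ℝ ∞ (logMGF ψ) := by
  rw [h.logMGF_eq_cgf, contDiff_iff_contDiffAt]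
  exact fun σ => (analyticAt_cgf (h.mem_interior σ)).contDiffAt

open Complex in
/-- The moments of the tilted measures are, up to the normalization, derivatives of the complex
moment generating function. -/
theorem IsPerturbedQuadratic.integral_pow_mul_cexp_tilt (h : IsPerturbedQuadratic B ψ) (σ t : ℝ)
    (n : ℕ) : ∫ z : ℝ, (z : ℂ) ^ n * cexp (t * z * I) ∂(tilt ψ σ) =
      cexp (-(logMGF ψ σ : ℝ)) *
        ∫ z : ℝ, ((id z : ℝ) : ℂ) ^ n * cexp ((σ + t * I) * (id z : ℝ)) ∂(gibbs ψ) := by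
  rw [integral_tilt h, h.integral_gibbs, ← integral_const_mul]
  congr 1
  ext z
  rw [tiltDensity, real_smul, real_smul, id]
  push_cast
  have : cexp (σ * z - ψ z - logMGF ψ σ) * (z ^ n * cexp (t * z * I)) =
      z ^ n * cexp ((σ * z - ψ z - logMGF ψ σ) + t * z * I) := by
    rw [Complex.exp_add]; ring
  rw [this]
  have : cexp (-(logMGF ψ σ)) * (cexp (-ψ z) * (z ^ n * cexp ((σ + t * I) * z))) =
      z ^ n * cexp (-(logMGF ψ σ) + (-ψ z) + (σ + t * I) * z) := by
    rw [Complex.exp_add, Complex.exp_add]; ring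
  rw [this]
  congr 2
  ring

open Complex in
theorem IsPerturbedQuadratic.deriv_logMGF (h : IsPerturbedQuadratic B ψ) (σ : ℝ) :
    deriv (logMGF ψ) σ = tiltMean ψ σ := by
  rw [h.logMGF_eq_cgf, deriv_cgf (h.mem_interior σ), tiltMean, integral_tilt h]
  have hm : mgf id (gibbs ψ) σ = rexp (logMGF ψ σ) := by
    rw [mgf, h.integral_gibbs, h.exp_logMGF]
    congr 1
    ext z
    rw [smul_eq_mul, ← Real.exp_add]
    congr 1
    simp only [id]
    ring
  rw [hm, h.integral_gibbs, div_eq_inv_mul, ← integral_const_mul]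
  congr 1
  ext z
  rw [tiltDensity_eq]
  simp only [smul_eq_mul, id]
  rw [sub_eq_add_neg, Real.exp_add]
  ring

theorem IsPerturbedQuadratic.hasDerivAt_logMGF (h : IsPerturbedQuadratic B ψ) (σ : ℝ) :
    HasDerivAt (logMGF ψ) (tiltMean ψ σ) σ := by
  rw [← h.deriv_logMGF]
  exact (h.contDiff_logMGF.differentiable (by simp)).differentiableAt.hasDerivAt

open Complex in
theorem IsPerturbedQuadratic.hasDerivAt_integral_pow_mul_cexp_tilt (h : IsPerturbedQuadratic B ψ)
    (σ t : ℝ) (n : ℕ) :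
    HasDerivAt (fun σ : ℝ => ∫ z : ℝ, (z : ℂ) ^ n * cexp (t * z * I) ∂(tilt ψ σ))
      ((∫ z : ℝ, (z : ℂ) ^ (n + 1) * cexp (t * z * I) ∂(tilt ψ σ)) -
        tiltMean ψ σ * ∫ z : ℝ, (z : ℂ) ^ n * cexp (t * z * I) ∂(tilt ψ σ)) σ := by
  simp_rw [h.integral_pow_mul_cexp_tilt]
  have h1 : HasDerivAt (fun σ : ℝ => cexp (-(logMGF ψ σ : ℝ)))
      (cexp (-(logMGF ψ σ : ℝ)) * (-(tiltMean ψ σ : ℝ))) σ :=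
    (h.hasDerivAt_logMGF σ).ofReal_comp.neg.cexp
  have h2 : HasDerivAt (fun σ : ℝ => ((σ : ℂ) + t * I)) 1 σ :=
    (hasDerivAt_id σ).ofReal_comp.add_const _
  have h3 := hasDerivAt_integral_pow_mul_exp (X := id) (μ := gibbs ψ) (z := (σ : ℂ) + t * I)
    (by simpa using h.mem_interior σ) n
  have h4 := h1.mul (h3.comp σ h2)
  refine h4.congr_deriv ?_
  simp only [Function.comp]
  ring

/-- The raw moments of the one-site measures, as functions of the field. -/
noncomputable def rawMoment (ψ : ℝ → ℝ) (n : ℕ) (σ : ℝ) : ℝ := ∫ z, z ^ n ∂(tilt ψ σ)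

theorem rawMoment_one (σ : ℝ) : rawMoment ψ 1 σ = tiltMean ψ σ := by simp [rawMoment, tiltMean]

theorem IsPerturbedQuadratic.hasDerivAt_rawMoment (h : IsPerturbedQuadratic B ψ)
    (σ : ℝ) (n : ℕ) :
    HasDerivAt (rawMoment ψ n) (rawMoment ψ (n + 1) σ - tiltMean ψ σ * rawMoment ψ n σ) σ := by
  have key : ∀ n σ, ∫ z : ℝ, (z : ℂ) ^ n * Complex.exp ((0 : ℝ) * z * Complex.I) ∂(tilt ψ σ) =
      (rawMoment ψ n σ : ℂ) := by
    intro n σ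
    rw [rawMoment, ← integral_complex_ofReal]
    simp
  have h1 := h.hasDerivAt_integral_pow_mul_cexp_tilt σ 0 n
  simp_rw [key] at h1
  simpa [Function.comp_def] using
    (Complex.reCLM.hasFDerivAt.comp_hasDerivAt σ h1).congr_deriv (by simp)

theorem IsPerturbedQuadratic.tiltMoment_two_eq (h : IsPerturbedQuadratic B ψ) (σ : ℝ) :
    tiltMoment ψ 2 σ = rawMoment ψ 2 σ - tiltMean ψ σ ^ 2 := by
  have := h.isProbabilityMeasure_tilt σ
  have h1 : Integrable (fun z : ℝ => z) (tilt ψ σ) := by simpa using h.integrable_pow_tilt σ 1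
  have h2 := h.integrable_pow_tilt σ 2
  set m := tiltMean ψ σ with hm
  have e : ∀ z : ℝ, (z - m) ^ 2 = z ^ 2 - 2 * m * z + m ^ 2 := fun z => by ring
  rw [tiltMoment, ← hm]
  simp_rw [e]
  have i12 : Integrable (fun z : ℝ => z ^ 2 - 2 * m * z) (tilt ψ σ) := h2.sub (h1.const_mul _)
  rw [integral_add i12 (integrable_const _), integral_sub h2 (h1.const_mul _),
    integral_const_mul, integral_const]
  simp only [probReal_univ, smul_eq_mul, one_mul]
  rw [show ∫ z, z ∂(tilt ψ σ) = m from rfl, rawMoment]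
  ring

theorem IsPerturbedQuadratic.tiltMoment_three_eq (h : IsPerturbedQuadratic B ψ) (σ : ℝ) :
    tiltMoment ψ 3 σ =
      rawMoment ψ 3 σ - 3 * tiltMean ψ σ * rawMoment ψ 2 σ + 2 * tiltMean ψ σ ^ 3 := by
  have := h.isProbabilityMeasure_tilt σ
  have h1 : Integrable (fun z : ℝ => z) (tilt ψ σ) := by simpa using h.integrable_pow_tilt σ 1
  have h2 := h.integrable_pow_tilt σ 2
  have h3 := h.integrable_pow_tilt σ 3
  set m := tiltMean ψ σ with hm
  have e : ∀ z : ℝ, (z - m) ^ 3 = z ^ 3 - 3 * m * z ^ 2 + 3 * m ^ 2 * z - m ^ 3 :=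
    fun z => by ring
  rw [tiltMoment, ← hm]
  simp_rw [e]
  have i32 : Integrable (fun z : ℝ => z ^ 3 - 3 * m * z ^ 2) (tilt ψ σ) := h3.sub (h2.const_mul _)
  have i321 : Integrable (fun z : ℝ => z ^ 3 - 3 * m * z ^ 2 + 3 * m ^ 2 * z) (tilt ψ σ) :=
    i32.add (h1.const_mul _)
  rw [integral_sub i321 (integrable_const _), integral_add i32 (h1.const_mul _),
    integral_sub h3 (h2.const_mul _), integral_const_mul, integral_const_mul, integral_const]
  simp only [probReal_univ, smul_eq_mul, one_mul]
  rw [show ∫ z, z ∂(tilt ψ σ) = m from rfl, rawMoment, rawMoment]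
  ring

theorem IsPerturbedQuadratic.hasDerivAt_tiltMean (h : IsPerturbedQuadratic B ψ) (σ : ℝ) :
    HasDerivAt (tiltMean ψ) (tiltMoment ψ 2 σ) σ := by
  have h1 := h.hasDerivAt_rawMoment σ 1
  have e : rawMoment ψ 1 = tiltMean ψ := funext rawMoment_one
  rw [e] at h1
  rw [h.tiltMoment_two_eq]
  exact h1.congr_deriv (by ring)

theorem IsPerturbedQuadratic.hasDerivAt_tiltMoment_two (h : IsPerturbedQuadratic B ψ) (σ : ℝ) :
    HasDerivAt (tiltMoment ψ 2) (tiltMoment ψ 3 σ) σ := by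
  have e : tiltMoment ψ 2 = fun σ => rawMoment ψ 2 σ - tiltMean ψ σ ^ 2 :=
    funext h.tiltMoment_two_eq
  rw [e]
  refine ((h.hasDerivAt_rawMoment σ 2).sub ((h.hasDerivAt_tiltMean σ).pow 2)).congr_deriv ?_
  rw [h.tiltMoment_three_eq, h.tiltMoment_two_eq]
  push_cast
  ring

theorem IsPerturbedQuadratic.contDiff_tiltMean (h : IsPerturbedQuadratic B ψ) :
    ContDiff ℝ ∞ (tiltMean ψ) := by
  have e : tiltMean ψ = deriv (logMGF ψ) := funext fun σ => (h.deriv_logMGF σ).symm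
  rw [e]
  exact ((contDiff_infty_iff_deriv).1 h.contDiff_logMGF).2

theorem abs_pow_le_one_add_pow_four (y : ℝ) {n : ℕ} (hn : n ≤ 4) : |y| ^ n ≤ 1 + y ^ 4 := by
  have h4 : |y| ^ 4 = y ^ 4 := by
    rw [show (4 : ℕ) = 2 * 2 from rfl, pow_mul, pow_mul, sq_abs]
  rcases le_total |y| 1 with h | h
  · have : |y| ^ n ≤ 1 := pow_le_one₀ (abs_nonneg y) h
    have : 0 ≤ y ^ 4 := by positivity
    linarith
  · have : |y| ^ n ≤ |y| ^ 4 := pow_le_pow_right₀ h hn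
    linarith

theorem IsPerturbedQuadratic.abs_tiltMoment_le (h : IsPerturbedQuadratic B ψ) (σ : ℝ) {n : ℕ}
    (hn : n ≤ 4) : |tiltMoment ψ n σ| ≤ 1 + tiltMoment ψ 4 σ := by
  have := h.isProbabilityMeasure_tilt σ
  refine (abs_integral_le_integral_abs).trans ?_
  have e : 1 + tiltMoment ψ 4 σ = ∫ z, (1 + (z - tiltMean ψ σ) ^ 4) ∂(tilt ψ σ) := by
    rw [integral_add (integrable_const _) (h.integrable_sub_pow_tilt _ _ 4)]
    simp [tiltMoment]
  rw [e]
  refine integral_mono (h.integrable_sub_pow_tilt _ _ n).abs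
    ((integrable_const _).add (h.integrable_sub_pow_tilt _ _ 4)) fun z => ?_
  change |(z - tiltMean ψ σ) ^ n| ≤ 1 + (z - tiltMean ψ σ) ^ 4
  rw [abs_pow]
  exact abs_pow_le_one_add_pow_four _ hn

/-! ### Characteristic functions of the centred one-site measures -/

/-- The characteristic function of the centred one-site measure with field `σ`. -/
noncomputable def siteChar (ψ : ℝ → ℝ) (σ t : ℝ) : ℂ :=
  ∫ z : ℝ, Complex.exp (t * (z - tiltMean ψ σ : ℝ) * Complex.I) ∂(tilt ψ σ)

theorem _root_.MeasureTheory.Integrable.fun_sub {α F : Type*} [MeasurableSpace α]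
    [NormedAddCommGroup F] {μ : Measure α} {f g : α → F} (hf : Integrable f μ)
    (hg : Integrable g μ) : Integrable (fun x => f x - g x) μ :=
  hf.sub hg

theorem norm_cexp_mul_I_sub_one_le (y : ℝ) : ‖Complex.exp (y * Complex.I) - 1‖ ≤ |y| := by
  rw [mul_comm]
  exact Real.norm_exp_I_mul_ofReal_sub_one_le

theorem norm_sub_le_of_hasDerivAt_cexp {f f' : ℝ → ℂ} (hf : ∀ x, HasDerivAt f (f' x) x)
    {n : ℕ} (hb : ∀ x, ‖f' x‖ ≤ |x| ^ n) (h0 : f 0 = 0) (y : ℝ) : ‖f y‖ ≤ |y| ^ (n + 1) := by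
  have h := Convex.norm_image_sub_le_of_norm_hasDerivWithin_le (s := Icc (-|y|) |y|) (f := f)
    (f' := f') (C := |y| ^ n) (x := 0) (y := y) (fun x _ => (hf x).hasDerivWithinAt)
    (fun x hx => (hb x).trans (pow_le_pow_left₀ (abs_nonneg _) (abs_le.2 hx) n))
    (convex_Icc _ _) ⟨by simp, by simp⟩ ⟨neg_abs_le y, le_abs_self y⟩
  rwa [h0, sub_zero, sub_zero, norm_eq_abs, ← pow_succ] at h

theorem hasDerivAt_cexp_mul_I (x : ℝ) :
    HasDerivAt (fun x : ℝ => Complex.exp (x * Complex.I))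
      (Complex.exp (x * Complex.I) * Complex.I) x := by
  have h1 : HasDerivAt (fun x : ℝ => (x : ℂ) * Complex.I) (1 * Complex.I) x :=
    (hasDerivAt_id x).ofReal_comp.mul_const _
  rw [one_mul] at h1
  exact h1.cexp

theorem norm_cexp_mul_I_sub_le_sq (y : ℝ) :
    ‖Complex.exp (y * Complex.I) - 1 - y * Complex.I‖ ≤ |y| ^ 2 := by
  refine norm_sub_le_of_hasDerivAt_cexp (n := 1)
    (f := fun y : ℝ => Complex.exp (y * Complex.I) - 1 - y * Complex.I)
    (f' := fun y : ℝ => (Complex.exp (y * Complex.I) - 1) * Complex.I) (fun x => ?_) (fun x => ?_)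
    (by simp) y
  · have h1 : HasDerivAt (fun x : ℝ => (x : ℂ) * Complex.I) (1 * Complex.I) x :=
      (hasDerivAt_id x).ofReal_comp.mul_const _
    exact (((hasDerivAt_cexp_mul_I x).sub_const 1).sub h1).congr_deriv (by ring)
  · simpa using norm_cexp_mul_I_sub_one_le x

theorem norm_cexp_mul_I_sub_le_cube (y : ℝ) :
    ‖Complex.exp (y * Complex.I) - 1 - y * Complex.I + y ^ 2 / 2‖ ≤ |y| ^ 3 := by
  refine norm_sub_le_of_hasDerivAt_cexp (n := 2)
    (f := fun y : ℝ => Complex.exp (y * Complex.I) - 1 - y * Complex.I + y ^ 2 / 2)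
    (f' := fun y : ℝ => (Complex.exp (y * Complex.I) - 1 - y * Complex.I) * Complex.I)
    (fun x => ?_) (fun x => ?_) (by simp) y
  · have h1 : HasDerivAt (fun x : ℝ => (x : ℂ) * Complex.I) (1 * Complex.I) x :=
      (hasDerivAt_id x).ofReal_comp.mul_const _
    have h2 : HasDerivAt (fun x : ℝ => (x : ℂ) ^ 2 / 2) (x : ℂ) x :=
      (((hasDerivAt_id x).ofReal_comp.pow 2).div_const 2).congr_deriv (by simp)
    refine ((((hasDerivAt_cexp_mul_I x).sub_const 1).sub h1).add h2).congr_deriv ?_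
    linear_combination (x : ℂ) * Complex.I_sq
  · simpa using norm_cexp_mul_I_sub_le_sq x

theorem siteChar_eq (σ t : ℝ) :
    siteChar ψ σ t = Complex.exp (-(t * tiltMean ψ σ * Complex.I)) *
      ∫ z : ℝ, (z : ℂ) ^ 0 * Complex.exp (t * z * Complex.I) ∂(tilt ψ σ) := by
  rw [siteChar, ← integral_const_mul]
  congr 1
  ext z
  rw [pow_zero, one_mul, ← Complex.exp_add]
  congr 1
  push_cast
  ring

theorem IsPerturbedQuadratic.contDiff_siteChar (h : IsPerturbedQuadratic B ψ) :
    ContDiff ℝ ∞ (fun p : ℝ × ℝ => siteChar ψ p.1 p.2) := by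
  have h1 : ContDiff ℂ ∞ (complexMGF id (gibbs ψ)) := by
    rw [contDiff_iff_contDiffAt]
    intro w
    exact (analyticAt_complexMGF (h.mem_interior w.re)).contDiffAt
  have h1' : ContDiff ℝ ∞ (complexMGF id (gibbs ψ)) := h1.restrict_scalars ℝ
  have e : (fun p : ℝ × ℝ => siteChar ψ p.1 p.2) = fun p : ℝ × ℝ =>
      Complex.exp (-(p.2 * tiltMean ψ p.1 * Complex.I)) *
        (Complex.exp (-(logMGF ψ p.1 : ℝ)) *
          complexMGF id (gibbs ψ) (p.1 + p.2 * Complex.I)) := by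
    ext p
    rw [siteChar_eq, h.integral_pow_mul_cexp_tilt]
    simp [complexMGF]
  rw [e]
  have h2 := h.contDiff_tiltMean
  have h3 := h.contDiff_logMGF
  have o1 : ContDiff ℝ ∞ (fun p : ℝ × ℝ => (p.1 : ℂ)) :=
    Complex.ofRealCLM.contDiff.comp contDiff_fst
  have o2 : ContDiff ℝ ∞ (fun p : ℝ × ℝ => (p.2 : ℂ)) :=
    Complex.ofRealCLM.contDiff.comp contDiff_snd
  have o3 : ContDiff ℝ ∞ (fun p : ℝ × ℝ => (tiltMean ψ p.1 : ℂ)) :=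
    Complex.ofRealCLM.contDiff.comp (h2.comp contDiff_fst)
  have o4 : ContDiff ℝ ∞ (fun p : ℝ × ℝ => (logMGF ψ p.1 : ℂ)) :=
    Complex.ofRealCLM.contDiff.comp (h3.comp contDiff_fst)
  exact ((o2.mul o3).mul contDiff_const).neg.cexp.mul
    (o4.neg.cexp.mul (h1'.comp (o1.add (o2.mul contDiff_const))))

theorem integral_moment_complex (σ : ℝ) (n : ℕ) :
    ∫ z : ℝ, ((z - tiltMean ψ σ : ℝ) : ℂ) ^ n ∂(tilt ψ σ) = (tiltMoment ψ n σ : ℂ) := by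
  rw [tiltMoment, ← integral_complex_ofReal]
  simp

/-- The integrals `E (Y ^ n exp (i t Y))`, where `Y` is the centred one-site variable with
field `σ`. -/
noncomputable def centredChar (ψ : ℝ → ℝ) (n : ℕ) (t σ : ℝ) : ℂ :=
  ∫ z : ℝ, ((z - tiltMean ψ σ : ℝ) : ℂ) ^ n *
    Complex.exp (t * (z - tiltMean ψ σ : ℝ) * Complex.I) ∂(tilt ψ σ)

theorem centredChar_zero (σ t : ℝ) : centredChar ψ 0 t σ = siteChar ψ σ t := by
  simp [centredChar, siteChar]

theorem IsPerturbedQuadratic.integrable_pow_mul_cexp (h : IsPerturbedQuadratic B ψ) (σ t : ℝ)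
    (n : ℕ) : Integrable (fun z : ℝ => ((z - tiltMean ψ σ : ℝ) : ℂ) ^ n *
      Complex.exp (t * (z - tiltMean ψ σ : ℝ) * Complex.I)) (tilt ψ σ) := by
  have h1 : Integrable (fun z : ℝ => ((z - tiltMean ψ σ : ℝ) : ℂ) ^ n) (tilt ψ σ) := by
    have := (h.integrable_sub_pow_tilt σ (tiltMean ψ σ) n).ofReal (𝕜 := ℂ)
    simpa using this
  refine h1.mul_bdd (c := 1) (by fun_prop) (ae_of_all _ fun z => ?_)
  rw [← Complex.ofReal_mul, Complex.norm_exp_ofReal_mul_I]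

theorem IsPerturbedQuadratic.integrable_pow_complex (h : IsPerturbedQuadratic B ψ) (σ : ℝ)
    (n : ℕ) : Integrable (fun z : ℝ => ((z - tiltMean ψ σ : ℝ) : ℂ) ^ n) (tilt ψ σ) := by
  simpa using h.integrable_pow_mul_cexp σ 0 n

theorem IsPerturbedQuadratic.hasDerivAt_cexp_mean (h : IsPerturbedQuadratic B ψ) (σ t : ℝ) :
    HasDerivAt (fun σ : ℝ => Complex.exp (-(t * tiltMean ψ σ * Complex.I)))
      (Complex.exp (-(t * tiltMean ψ σ * Complex.I)) *
        (-(t * tiltMoment ψ 2 σ * Complex.I))) σ := by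
  have h1 : HasDerivAt (fun σ : ℝ => (tiltMean ψ σ : ℂ)) (tiltMoment ψ 2 σ : ℂ) σ :=
    (h.hasDerivAt_tiltMean σ).ofReal_comp
  exact ((h1.const_mul (t : ℂ)).mul_const Complex.I).neg.cexp

theorem IsPerturbedQuadratic.integrable_rawPow_mul_cexp (h : IsPerturbedQuadratic B ψ) (σ t : ℝ)
    (n : ℕ) : Integrable (fun z : ℝ => (z : ℂ) ^ n * Complex.exp (t * z * Complex.I))
      (tilt ψ σ) := by
  have h1 : Integrable (fun z : ℝ => (z : ℂ) ^ n) (tilt ψ σ) := by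
    have := (h.integrable_pow_tilt σ n).ofReal (𝕜 := ℂ)
    simpa using this
  refine h1.mul_bdd (c := 1) (by fun_prop) (ae_of_all _ fun z => ?_)
  rw [← Complex.ofReal_mul, Complex.norm_exp_ofReal_mul_I]

theorem cexp_centred (σ t z : ℝ) : Complex.exp (t * (z - tiltMean ψ σ : ℝ) * Complex.I) =
    Complex.exp (-(t * tiltMean ψ σ * Complex.I)) * Complex.exp (t * z * Complex.I) := by
  rw [← Complex.exp_add]
  congr 1
  push_cast
  ring

theorem IsPerturbedQuadratic.centredChar_one_eq (h : IsPerturbedQuadratic B ψ) (σ t : ℝ) :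
    centredChar ψ 1 t σ = Complex.exp (-(t * tiltMean ψ σ * Complex.I)) *
      ((∫ z : ℝ, (z : ℂ) ^ 1 * Complex.exp (t * z * Complex.I) ∂(tilt ψ σ)) -
        tiltMean ψ σ * ∫ z : ℝ, (z : ℂ) ^ 0 * Complex.exp (t * z * Complex.I) ∂(tilt ψ σ)) := by
  rw [← integral_const_mul, ← integral_sub (h.integrable_rawPow_mul_cexp σ t 1)
    ((h.integrable_rawPow_mul_cexp σ t 0).const_mul _), ← integral_const_mul, centredChar]
  congr 1
  ext z
  rw [cexp_centred]
  push_cast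
  ring

theorem IsPerturbedQuadratic.centredChar_two_eq (h : IsPerturbedQuadratic B ψ) (σ t : ℝ) :
    centredChar ψ 2 t σ = Complex.exp (-(t * tiltMean ψ σ * Complex.I)) *
      (((∫ z : ℝ, (z : ℂ) ^ 2 * Complex.exp (t * z * Complex.I) ∂(tilt ψ σ)) -
        2 * tiltMean ψ σ * ∫ z : ℝ, (z : ℂ) ^ 1 * Complex.exp (t * z * Complex.I) ∂(tilt ψ σ)) +
        tiltMean ψ σ ^ 2 * ∫ z : ℝ, (z : ℂ) ^ 0 * Complex.exp (t * z * Complex.I) ∂(tilt ψ σ)) := by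
  have i0 := (h.integrable_rawPow_mul_cexp σ t 0).const_mul ((tiltMean ψ σ : ℂ) ^ 2)
  have i1 := (h.integrable_rawPow_mul_cexp σ t 1).const_mul (2 * tiltMean ψ σ : ℂ)
  have i2 := h.integrable_rawPow_mul_cexp σ t 2
  rw [← integral_const_mul, ← integral_const_mul, ← integral_sub i2 i1,
    ← integral_add (i2.fun_sub i1) i0, ← integral_const_mul, centredChar]
  congr 1
  ext z
  rw [cexp_centred]
  push_cast
  ring

/-- Differentiation in the field of `centredChar ψ 0`; the second term comes from the
recentring. -/
theorem IsPerturbedQuadratic.hasDerivAt_centredChar_zero (h : IsPerturbedQuadratic B ψ)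
    (σ t : ℝ) : HasDerivAt (centredChar ψ 0 t)
      (centredChar ψ 1 t σ - t * tiltMoment ψ 2 σ * Complex.I * centredChar ψ 0 t σ) σ := by
  have e0 : centredChar ψ 0 t = fun σ => Complex.exp (-(t * tiltMean ψ σ * Complex.I)) *
      ∫ z : ℝ, (z : ℂ) ^ 0 * Complex.exp (t * z * Complex.I) ∂(tilt ψ σ) := by
    ext σ
    rw [centredChar_zero, siteChar_eq]
  rw [h.centredChar_one_eq, e0]
  refine ((h.hasDerivAt_cexp_mean σ t).mul
    (h.hasDerivAt_integral_pow_mul_cexp_tilt σ t 0)).congr_deriv ?_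
  simp only [zero_add]
  ring

theorem IsPerturbedQuadratic.hasDerivAt_centredChar_one (h : IsPerturbedQuadratic B ψ)
    (σ t : ℝ) : HasDerivAt (centredChar ψ 1 t)
      (centredChar ψ 2 t σ - tiltMoment ψ 2 σ * centredChar ψ 0 t σ
        - t * tiltMoment ψ 2 σ * Complex.I * centredChar ψ 1 t σ) σ := by
  have h1 : HasDerivAt (fun σ : ℝ => (tiltMean ψ σ : ℂ)) (tiltMoment ψ 2 σ : ℂ) σ :=
    (h.hasDerivAt_tiltMean σ).ofReal_comp
  rw [h.centredChar_two_eq, h.centredChar_one_eq, centredChar_zero, siteChar_eq,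
    funext fun σ => h.centredChar_one_eq σ t]
  refine ((h.hasDerivAt_cexp_mean σ t).mul
    ((h.hasDerivAt_integral_pow_mul_cexp_tilt σ t 1).sub
      (h1.mul (h.hasDerivAt_integral_pow_mul_cexp_tilt σ t 0)))).congr_deriv ?_
  simp only [zero_add, Nat.reduceAdd, Pi.mul_apply, Pi.sub_apply]
  ring

theorem IsPerturbedQuadratic.deriv_siteChar (h : IsPerturbedQuadratic B ψ) (t : ℝ) :
    deriv (fun σ => siteChar ψ σ t) = fun σ =>
      centredChar ψ 1 t σ - t * tiltMoment ψ 2 σ * Complex.I * centredChar ψ 0 t σ := by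
  ext σ
  rw [← (h.hasDerivAt_centredChar_zero σ t).deriv]
  congr 1
  ext σ
  rw [centredChar_zero]

theorem IsPerturbedQuadratic.deriv_deriv_siteChar (h : IsPerturbedQuadratic B ψ) (t : ℝ) :
    deriv (deriv (fun σ => siteChar ψ σ t)) = fun σ =>
      centredChar ψ 2 t σ - 2 * (t * tiltMoment ψ 2 σ * Complex.I) * centredChar ψ 1 t σ
        - (tiltMoment ψ 2 σ + t * tiltMoment ψ 3 σ * Complex.I + t ^ 2 * tiltMoment ψ 2 σ ^ 2)
          * centredChar ψ 0 t σ := by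
  ext σ
  rw [h.deriv_siteChar]
  have h1 : HasDerivAt (fun σ : ℝ => (tiltMoment ψ 2 σ : ℂ)) (tiltMoment ψ 3 σ : ℂ) σ :=
    (h.hasDerivAt_tiltMoment_two σ).ofReal_comp
  refine HasDerivAt.deriv (((h.hasDerivAt_centredChar_one σ t).sub
    (((h1.const_mul (t : ℂ)).mul_const Complex.I).mul
      (h.hasDerivAt_centredChar_zero σ t))).congr_deriv ?_)
  linear_combination (t : ℂ) ^ 2 * tiltMoment ψ 2 σ ^ 2 * centredChar ψ 0 t σ * Complex.I_sq

theorem IsPerturbedQuadratic.norm_integral_le_of_le (h : IsPerturbedQuadratic B ψ) {σ K : ℝ}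
    {f : ℝ → ℂ} (hf : ∀ z, ‖f z‖ ≤ K * (1 + (z - tiltMean ψ σ) ^ 4)) :
    ‖∫ z, f z ∂(tilt ψ σ)‖ ≤ K * (1 + tiltMoment ψ 4 σ) := by
  have := h.isProbabilityMeasure_tilt σ
  have hi : Integrable (fun z => 1 + (z - tiltMean ψ σ) ^ 4) (tilt ψ σ) :=
    (integrable_const _).add (h.integrable_sub_pow_tilt _ _ 4)
  refine (norm_integral_le_of_norm_le (hi.const_mul K) (ae_of_all _ hf)).trans (le_of_eq ?_)
  rw [integral_const_mul, integral_add (integrable_const _) (h.integrable_sub_pow_tilt _ _ 4)]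
  simp [tiltMoment]

/-- `∂_σ` of the characteristic function vanishes to second order at `t = 0`, because the measure is
centred for every field. -/
theorem IsPerturbedQuadratic.norm_deriv_siteChar_le (h : IsPerturbedQuadratic B ψ) {M : ℝ}
    (hM : ∀ σ, 1 + tiltMoment ψ 4 σ ≤ M) (σ t : ℝ) :
    ‖deriv (fun σ => siteChar ψ σ t) σ‖ ≤ (1 + M) * M * t ^ 2 := by
  have := h.isProbabilityMeasure_tilt σ
  simp only [h.deriv_siteChar]
  set k := tiltMoment ψ 2 σ with hk
  have hkM : |k| ≤ M := (h.abs_tiltMoment_le σ (by norm_num)).trans (hM σ)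
  have hM0 : 0 ≤ M := (abs_nonneg _).trans hkM
  set m := tiltMean ψ σ
  have i1 := h.integrable_pow_mul_cexp σ t 1
  have i0 := (h.integrable_pow_mul_cexp σ t 0).const_mul (t * k * Complex.I)
  have j1 := h.integrable_pow_complex σ 1
  have j2 := (h.integrable_pow_complex σ 2).const_mul (t * Complex.I)
  have e : centredChar ψ 1 t σ - t * k * Complex.I * centredChar ψ 0 t σ =
      ∫ z : ℝ, (((z - m : ℝ) : ℂ) * (Complex.exp (t * (z - m : ℝ) * Complex.I) - 1
          - (t * (z - m : ℝ)) * Complex.I) - t * k * Complex.I *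
          (Complex.exp (t * (z - m : ℝ) * Complex.I) - 1)) ∂(tilt ψ σ) := by
    have e1 : ∫ z : ℝ, (((z - m : ℝ) : ℂ) ^ 1 + t * Complex.I * ((z - m : ℝ) : ℂ) ^ 2
        - t * k * Complex.I) ∂(tilt ψ σ) = 0 := by
      rw [integral_sub (j1.fun_add j2) (integrable_const _), integral_add j1 j2, integral_const_mul,
        integral_moment_complex, integral_moment_complex, h.tiltMoment_one, integral_const]
      simp [← hk]
      ring
    rw [centredChar, centredChar, ← integral_const_mul, ← integral_sub i1 i0,
      ← sub_zero (∫ _, _ ∂_),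
      ← e1, ← integral_sub (i1.fun_sub i0) ((j1.fun_add j2).fun_sub (integrable_const _))]
    congr 1
    ext z
    ring
  rw [e]
  have hb : ∀ z : ℝ, ‖(((z - m : ℝ) : ℂ) * (Complex.exp (t * (z - m : ℝ) * Complex.I) - 1
          - (t * (z - m : ℝ)) * Complex.I) - t * k * Complex.I *
          (Complex.exp (t * (z - m : ℝ) * Complex.I) - 1))‖ ≤
      ((1 + M) * t ^ 2) * (1 + (z - m) ^ 4) := by
    intro z
    set y := z - m
    have b2 := norm_cexp_mul_I_sub_le_sq (t * y)
    have b1 := norm_cexp_mul_I_sub_one_le (t * y)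
    push_cast at b1 b2
    refine (norm_sub_le _ _).trans ?_
    simp only [norm_mul, Complex.norm_real, Complex.norm_I, mul_one, norm_eq_abs]
    calc _ ≤ |y| * |t * y| ^ 2 + |t| * |k| * |t * y| := by gcongr
      _ = t ^ 2 * (|y| ^ 3 + |k| * |y| ^ 1) := by rw [abs_mul, ← sq_abs t]; ring
      _ ≤ t ^ 2 * ((1 + y ^ 4) + M * (1 + y ^ 4)) := by
        gcongr
        · exact abs_pow_le_one_add_pow_four y (by norm_num)
        · exact abs_pow_le_one_add_pow_four y (by norm_num)
      _ = _ := by ring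
  refine (h.norm_integral_le_of_le hb).trans ?_
  calc (1 + M) * t ^ 2 * (1 + tiltMoment ψ 4 σ) ≤ (1 + M) * t ^ 2 * M := by gcongr; exact hM σ
    _ = _ := by ring

theorem IsPerturbedQuadratic.norm_deriv_deriv_siteChar_le (h : IsPerturbedQuadratic B ψ) {M : ℝ}
    (hM : ∀ σ, 1 + tiltMoment ψ 4 σ ≤ M) (σ t : ℝ) :
    ‖deriv (deriv (fun σ => siteChar ψ σ t)) σ‖ ≤ (1 + 4 * M + M ^ 2) * M * t ^ 2 := by
  have := h.isProbabilityMeasure_tilt σ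
  simp only [h.deriv_deriv_siteChar]
  set k := tiltMoment ψ 2 σ with hk
  set q := tiltMoment ψ 3 σ with hq
  have hkM : |k| ≤ M := (h.abs_tiltMoment_le σ (by norm_num)).trans (hM σ)
  have hqM : |q| ≤ M := (h.abs_tiltMoment_le σ (by norm_num)).trans (hM σ)
  have hM0 : 0 ≤ M := (abs_nonneg _).trans hkM
  set m := tiltMean ψ σ
  have i2 := h.integrable_pow_mul_cexp σ t 2
  have i1 := (h.integrable_pow_mul_cexp σ t 1).const_mul (2 * (t * k * Complex.I))
  have i0 := (h.integrable_pow_mul_cexp σ t 0).const_mul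
    (k + t * q * Complex.I + t ^ 2 * k ^ 2)
  have j1 := (h.integrable_pow_complex σ 1).const_mul (3 * (t * k * Complex.I))
  have j2 := h.integrable_pow_complex σ 2
  have j3 := (h.integrable_pow_complex σ 3).const_mul (t * Complex.I)
  have e : centredChar ψ 2 t σ - 2 * (t * k * Complex.I) * centredChar ψ 1 t σ
        - (k + t * q * Complex.I + t ^ 2 * k ^ 2) * centredChar ψ 0 t σ =
      ∫ z : ℝ, (((z - m : ℝ) : ℂ) ^ 2 * (Complex.exp (t * (z - m : ℝ) * Complex.I) - 1
          - (t * (z - m : ℝ)) * Complex.I) - 2 * (t * k * Complex.I) * (z - m : ℝ) *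
          (Complex.exp (t * (z - m : ℝ) * Complex.I) - 1) -
          t ^ 2 * k ^ 2 * Complex.exp (t * (z - m : ℝ) * Complex.I) -
          k * (Complex.exp (t * (z - m : ℝ) * Complex.I) - 1 - (t * (z - m : ℝ)) * Complex.I) -
          t * q * Complex.I * (Complex.exp (t * (z - m : ℝ) * Complex.I) - 1)) ∂(tilt ψ σ) := by
    have e1 : ∫ z : ℝ, (((z - m : ℝ) : ℂ) ^ 2 + t * Complex.I * ((z - m : ℝ) : ℂ) ^ 3
        - 3 * (t * k * Complex.I) * ((z - m : ℝ) : ℂ) ^ 1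
        - (k + t * q * Complex.I)) ∂(tilt ψ σ) = 0 := by
      rw [integral_sub ((j2.fun_add j3).fun_sub j1) (integrable_const _),
        integral_sub (j2.fun_add j3) j1,
        integral_add j2 j3, integral_const_mul, integral_const_mul,
        integral_moment_complex, integral_moment_complex, integral_moment_complex,
        h.tiltMoment_one, integral_const]
      simp [← hk, ← hq]
      ring
    rw [centredChar, centredChar, centredChar, ← integral_const_mul, ← integral_const_mul,
      ← integral_sub i2 i1, ← integral_sub (i2.fun_sub i1) i0, ← sub_zero (∫ _, _ ∂_),
      ← e1, ← integral_sub ((i2.fun_sub i1).fun_sub i0)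
        (((j2.fun_add j3).fun_sub j1).fun_sub (integrable_const _))]
    congr 1
    ext z
    ring
  rw [e]
  have hb : ∀ z : ℝ, ‖(((z - m : ℝ) : ℂ) ^ 2 * (Complex.exp (t * (z - m : ℝ) * Complex.I) - 1
          - (t * (z - m : ℝ)) * Complex.I) - 2 * (t * k * Complex.I) * (z - m : ℝ) *
          (Complex.exp (t * (z - m : ℝ) * Complex.I) - 1) -
          t ^ 2 * k ^ 2 * Complex.exp (t * (z - m : ℝ) * Complex.I) -
          k * (Complex.exp (t * (z - m : ℝ) * Complex.I) - 1 - (t * (z - m : ℝ)) * Complex.I) -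
          t * q * Complex.I * (Complex.exp (t * (z - m : ℝ) * Complex.I) - 1))‖ ≤
      ((1 + 4 * M + M ^ 2) * t ^ 2) * (1 + (z - m) ^ 4) := by
    intro z
    set y := z - m
    have b2 := norm_cexp_mul_I_sub_le_sq (t * y)
    have b1 := norm_cexp_mul_I_sub_one_le (t * y)
    have b0 := Complex.norm_exp_ofReal_mul_I (t * y)
    push_cast at b1 b2 b0
    refine (norm_sub_le_of_le (norm_sub_le_of_le (norm_sub_le_of_le (norm_sub_le _ _) le_rfl)
      le_rfl)
      le_rfl).trans ?_
    simp only [norm_mul, norm_pow, Complex.norm_real, Complex.norm_I, mul_one, norm_eq_abs,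
      Complex.norm_ofNat, b0]
    calc _ ≤ |y| ^ 2 * |t * y| ^ 2 + 2 * (|t| * |k|) * |y| * |t * y| + |t| ^ 2 * |k| ^ 2 +
          |k| * |t * y| ^ 2 + |t| * |q| * |t * y| := by gcongr
      _ = t ^ 2 * (|y| ^ 4 + 2 * |k| * |y| ^ 2 + |k| ^ 2 + |k| * |y| ^ 2 + |q| * |y| ^ 1) := by
        rw [abs_mul, ← sq_abs t]; ring
      _ ≤ t ^ 2 * ((1 + y ^ 4) + 2 * M * (1 + y ^ 4) + M ^ 2 * (1 + y ^ 4) + M * (1 + y ^ 4)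
          + M * (1 + y ^ 4)) := by
        have hk2 : |k| ^ 2 ≤ M ^ 2 * (1 + y ^ 4) := by
          have : |k| ^ 2 ≤ M ^ 2 := by gcongr
          exact this.trans (le_mul_of_one_le_right (by positivity)
            (by have : 0 ≤ y ^ 4 := by positivity
                linarith))
        gcongr
        · exact abs_pow_le_one_add_pow_four y (by norm_num)
        · exact abs_pow_le_one_add_pow_four y (by norm_num)
        · exact abs_pow_le_one_add_pow_four y (by norm_num)
        · exact abs_pow_le_one_add_pow_four y (by norm_num)
      _ = _ := by ring
  refine (h.norm_integral_le_of_le hb).trans ?_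
  calc (1 + 4 * M + M ^ 2) * t ^ 2 * (1 + tiltMoment ψ 4 σ)
      ≤ (1 + 4 * M + M ^ 2) * t ^ 2 * M := by gcongr; exact hM σ
    _ = _ := by ring

/-- Comparison of the characteristic function with that of the Gaussian of the same variance. -/
theorem IsPerturbedQuadratic.norm_siteChar_sub_le (h : IsPerturbedQuadratic B ψ) {M : ℝ}
    (hM : ∀ σ, 1 + tiltMoment ψ 4 σ ≤ M) (σ t : ℝ) :
    ‖siteChar ψ σ t - Real.exp (-(tiltMoment ψ 2 σ * t ^ 2 / 2))‖ ≤
      M * |t| ^ 3 + M ^ 2 * t ^ 4 := by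
  have := h.isProbabilityMeasure_tilt σ
  set k := tiltMoment ψ 2 σ with hk
  have hkM : |k| ≤ M := (h.abs_tiltMoment_le σ (by norm_num)).trans (hM σ)
  have hk0 : 0 ≤ k := (exp_pos _).le.trans (h.exp_le_tiltMoment_two σ)
  have hM0 : 0 ≤ M := (abs_nonneg _).trans hkM
  set m := tiltMean ψ σ
  have i0 := h.integrable_pow_mul_cexp σ t 0
  have j1 := (h.integrable_pow_complex σ 1).const_mul (t * Complex.I)
  have j2 := (h.integrable_pow_complex σ 2).const_mul ((t : ℂ) ^ 2 / 2)
  have e : siteChar ψ σ t - ((1 : ℂ) - (k * t ^ 2 / 2 : ℝ)) =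
      ∫ z : ℝ, (Complex.exp (t * (z - m : ℝ) * Complex.I) - 1 - t * (z - m : ℝ) * Complex.I
        + (t * (z - m : ℝ)) ^ 2 / 2) ∂(tilt ψ σ) := by
    have e1 : ∫ z : ℝ, ((1 : ℂ) + t * Complex.I * ((z - m : ℝ) : ℂ) ^ 1
        - (t : ℂ) ^ 2 / 2 * ((z - m : ℝ) : ℂ) ^ 2) ∂(tilt ψ σ) = (1 : ℂ) - (k * t ^ 2 / 2 : ℝ) := by
      rw [integral_sub ((integrable_const _).fun_add j1) j2, integral_add (integrable_const _) j1,
        integral_const_mul, integral_const_mul,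
        integral_moment_complex, integral_moment_complex, h.tiltMoment_one, integral_const]
      simp [← hk]
      ring
    rw [← e1, ← centredChar_zero, centredChar,
      ← integral_sub i0 (((integrable_const _).fun_add j1).fun_sub j2)]
    congr 1
    ext z
    ring
  have hb : ∀ z : ℝ, ‖(Complex.exp (t * (z - m : ℝ) * Complex.I) - 1 - t * (z - m : ℝ) * Complex.I
        + (t * (z - m : ℝ)) ^ 2 / 2)‖ ≤ |t| ^ 3 * (1 + (z - m) ^ 4) := by
    intro z
    have b3 := norm_cexp_mul_I_sub_le_cube (t * (z - m))
    push_cast at b3 ⊢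
    refine b3.trans ?_
    rw [abs_mul, mul_pow]
    gcongr
    exact abs_pow_le_one_add_pow_four _ (by norm_num)
  have h1 := h.norm_integral_le_of_le hb
  rw [← e] at h1
  have h2 : ‖((1 : ℂ) - (k * t ^ 2 / 2 : ℝ)) - Real.exp (-(k * t ^ 2 / 2))‖ ≤ M ^ 2 * t ^ 4 := by
    have hx : 0 ≤ k * t ^ 2 / 2 := by positivity
    have hxM : (k * t ^ 2 / 2) ^ 2 ≤ M ^ 2 * t ^ 4 := by
      have h3 : k ^ 2 ≤ M ^ 2 := by rw [← sq_abs k]; gcongr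
      have h4 : k ^ 2 * t ^ 4 ≤ M ^ 2 * t ^ 4 := by gcongr
      have h5 : 0 ≤ k ^ 2 * t ^ 4 := by positivity
      nlinarith
    refine le_trans ?_ hxM
    generalize k * t ^ 2 / 2 = x at hx ⊢
    rw [← Complex.ofReal_one, ← Complex.ofReal_sub, ← Complex.ofReal_sub, Complex.norm_real,
      norm_eq_abs, abs_le]
    have h3 := Real.add_one_le_exp (-x)
    have hsq : 0 ≤ x ^ 2 := sq_nonneg x
    refine ⟨?_, by linarith⟩
    rcases le_total x 1 with hx1 | hx1
    · have := Real.norm_exp_sub_one_sub_id_le (x := -x)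
        (by rw [norm_eq_abs, abs_neg, abs_of_nonneg hx]; exact hx1)
      rw [norm_eq_abs, norm_eq_abs, sq_abs] at this
      have := (abs_le.1 this).2
      nlinarith
    · have : Real.exp (-x) ≤ 1 := Real.exp_le_one_iff.2 (by linarith)
      nlinarith
  have h3 := norm_add_le (siteChar ψ σ t - ((1 : ℂ) - (k * t ^ 2 / 2 : ℝ)))
    (((1 : ℂ) - (k * t ^ 2 / 2 : ℝ)) - Real.exp (-(k * t ^ 2 / 2)))
  rw [sub_add_sub_cancel] at h3
  refine h3.trans (add_le_add (h1.trans ?_) h2)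
  rw [mul_comm]
  gcongr
  exact hM σ

/-! ### Decay of the characteristic functions -/

theorem IsPerturbedQuadratic.norm_siteChar_eq (h : IsPerturbedQuadratic B ψ) (σ t : ℝ) :
    ‖siteChar ψ σ t‖ = ‖∫ z : ℝ, (tiltDensity ψ σ z : ℂ) * Complex.exp (t * z * Complex.I)‖ := by
  rw [siteChar_eq, norm_mul, integral_tilt h]
  have : ‖Complex.exp (-(t * tiltMean ψ σ * Complex.I))‖ = 1 := by
    rw [← neg_mul, ← neg_mul, ← Complex.ofReal_neg, ← Complex.ofReal_mul,
      Complex.norm_exp_ofReal_mul_I]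
  rw [this, one_mul]
  simp

theorem IsPerturbedQuadratic.integrable_tiltDensity_mul (h : IsPerturbedQuadratic B ψ) (σ t : ℝ) :
    Integrable fun z : ℝ => (tiltDensity ψ σ z : ℂ) * Complex.exp (t * z * Complex.I) := by
  refine (h.integrable_tiltDensity σ).ofReal.mul_bdd (c := 1) (by fun_prop)
    (ae_of_all _ fun z => ?_)
  rw [← Complex.ofReal_mul, Complex.norm_exp_ofReal_mul_I]

/-- The one-site measure contains a multiple of a Gaussian, so that its characteristic function is
bounded away from one. -/
theorem IsPerturbedQuadratic.norm_siteChar_le (h : IsPerturbedQuadratic B ψ) (σ t : ℝ) :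
    ‖siteChar ψ σ t‖ ≤ 1 - exp (-(2 * B)) * (1 - exp (-(t ^ 2 / 2))) := by
  obtain ⟨a, -, ha⟩ := h.tiltDensity_bounds
  set c := σ - a
  set ε := exp (-(2 * B))
  have hg := integrable_gaussianPDFReal c 1
  have hg1 := integral_gaussianPDFReal_eq_one c (v := 1) one_ne_zero
  have hgi : Integrable fun z : ℝ =>
      (gaussianPDFReal c 1 z : ℂ) * Complex.exp (t * z * Complex.I) := by
    refine hg.ofReal.mul_bdd (c := 1) (by fun_prop) (ae_of_all _ fun z => ?_)
    rw [← Complex.ofReal_mul, Complex.norm_exp_ofReal_mul_I]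
  have hgc : ‖∫ z : ℝ, (gaussianPDFReal c 1 z : ℂ) * Complex.exp (t * z * Complex.I)‖ =
      exp (-(t ^ 2 / 2)) := by
    have h1 := charFun_gaussianReal (μ := c) (v := 1) t
    rw [charFun_apply_real, integral_gaussianReal_eq_integral_smul one_ne_zero] at h1
    simp_rw [Complex.real_smul] at h1
    rw [h1, Complex.norm_exp]
    congr 1
    simp [← Complex.ofReal_pow]
  rw [h.norm_siteChar_eq]
  have e : ∫ z : ℝ, (tiltDensity ψ σ z : ℂ) * Complex.exp (t * z * Complex.I) =
      (∫ z : ℝ, ((tiltDensity ψ σ z - ε * gaussianPDFReal c 1 z : ℝ) : ℂ) *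
        Complex.exp (t * z * Complex.I)) +
      ε * ∫ z : ℝ, (gaussianPDFReal c 1 z : ℂ) * Complex.exp (t * z * Complex.I) := by
    have e1 : ∫ z : ℝ, ((tiltDensity ψ σ z - ε * gaussianPDFReal c 1 z : ℝ) : ℂ) *
        Complex.exp (t * z * Complex.I) =
        (∫ z : ℝ, (tiltDensity ψ σ z : ℂ) * Complex.exp (t * z * Complex.I)) -
        ∫ z : ℝ, (ε : ℂ) * ((gaussianPDFReal c 1 z : ℂ) * Complex.exp (t * z * Complex.I)) := by
      rw [← integral_sub (h.integrable_tiltDensity_mul σ t) (hgi.const_mul _)]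
      congr 1
      ext z
      push_cast
      ring
    rw [e1, integral_const_mul]
    ring
  have hdiff : Integrable fun z => tiltDensity ψ σ z - ε * gaussianPDFReal c 1 z :=
    (h.integrable_tiltDensity σ).fun_sub (hg.const_mul ε)
  have h1 : ‖∫ z : ℝ, ((tiltDensity ψ σ z - ε * gaussianPDFReal c 1 z : ℝ) : ℂ) *
        Complex.exp (t * z * Complex.I)‖ ≤ 1 - ε := by
    refine (norm_integral_le_of_norm_le hdiff (ae_of_all _ fun z => ?_)).trans (le_of_eq ?_)
    · rw [norm_mul, ← Complex.ofReal_mul, Complex.norm_exp_ofReal_mul_I, mul_one,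
        Complex.norm_real, norm_of_nonneg]
      exact sub_nonneg.2 (ha σ z).1
    · rw [integral_sub (h.integrable_tiltDensity σ) (hg.const_mul ε), integral_const_mul, hg1,
        h.integral_tiltDensity, mul_one]
  rw [e]
  refine (norm_add_le _ _).trans ?_
  rw [norm_mul, hgc, Complex.norm_real, norm_of_nonneg (exp_pos _).le]
  linarith

theorem integrable_sub_sq_mul_gaussianPDFReal (c : ℝ) :
    Integrable fun z => (1 + (z - c) ^ 2) * gaussianPDFReal c 1 z := by
  have h1 := (integrable_const (1 : ℝ)).add (integrable_sub_pow_gaussianReal c c 2)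
  rw [gaussianReal_of_var_ne_zero _ one_ne_zero, integrable_withDensity_iff_integrable_smul₀'
    (measurable_gaussianPDF _ _).aemeasurable (ae_of_all _ fun _ => ENNReal.ofReal_lt_top)] at h1
  refine h1.congr (ae_of_all _ fun z => ?_)
  simp only [gaussianPDF, Pi.add_apply, smul_eq_mul]
  rw [ENNReal.toReal_ofReal (gaussianPDFReal_nonneg _ _ _), mul_comm]

theorem integral_sub_sq_mul_gaussianPDFReal (c : ℝ) :
    ∫ z, (1 + (z - c) ^ 2) * gaussianPDFReal c 1 z = 1 + ∫ z, z ^ 2 ∂(gaussianReal 0 1) := by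
  rw [← integral_sub_pow_gaussianReal c 2]
  have h1 : ∫ z, (1 + (z - c) ^ 2) ∂(gaussianReal c 1) =
      1 + ∫ z, (z - c) ^ 2 ∂(gaussianReal c 1) := by
    rw [integral_add (integrable_const _) (integrable_sub_pow_gaussianReal c c 2)]
    simp
  rw [← h1, integral_gaussianReal_eq_integral_smul one_ne_zero]
  congr 1
  ext z
  rw [smul_eq_mul, mul_comm]

/-- The bound `O(1 / |t|)` for the characteristic function, by an integration by parts. -/
theorem exists_abs_mul_norm_siteChar_le (B : ℝ) : ∃ D : ℝ, 1 ≤ D ∧ ∀ ψ, IsPerturbedQuadratic B ψ →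
    ∀ σ t, |t| * ‖siteChar ψ σ t‖ ≤ D := by
  set G := 1 + ∫ z, z ^ 2 ∂(gaussianReal 0 1) with hG
  refine ⟨max 1 ((1 + 3 * B) * exp (2 * B) * G), le_max_left _ _,
    fun ψ h σ t => le_trans ?_ (le_max_right _ _)⟩
  have hB := h.nonneg
  obtain ⟨a, ha', ha⟩ := h.tiltDensity_bounds
  set c := σ - a with hc
  have hψd : ∀ z, HasDerivAt ψ (deriv ψ z) z := fun z =>
    ((h.contDiff.differentiable (by simp)) z).hasDerivAt
  have hρ : ∀ z, HasDerivAt (tiltDensity ψ σ) (tiltDensity ψ σ z * (σ - deriv ψ z)) z := by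
    intro z
    have := ((((hasDerivAt_id z).const_mul σ).sub (hψd z)).sub_const (logMGF ψ σ)).exp
    rw [mul_one] at this
    exact this
  have hcont : Continuous (deriv ψ) := h.contDiff.continuous_deriv (by simp)
  have hρc := h.continuous_tiltDensity σ
  have hbound : ∀ z, |tiltDensity ψ σ z * (σ - deriv ψ z)| ≤
      (1 + 3 * B) * exp (2 * B) * ((1 + (z - c) ^ 2) * gaussianPDFReal c 1 z) := by
    intro z
    rw [abs_mul, abs_of_pos (tiltDensity_pos σ z)]
    have h1 : |σ - deriv ψ z| ≤ (1 + 3 * B) * (1 + (z - c) ^ 2) := by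
      have h2 : |σ - deriv ψ z| ≤ |z - c| + 3 * B := by
        rw [show σ - deriv ψ z = -(z - c) - (deriv ψ z - z - a) by rw [hc]; ring]
        refine (abs_sub _ _).trans ?_
        rw [abs_neg]
        gcongr
        exact ha' z
      have h3 : |z - c| ≤ 1 + (z - c) ^ 2 := by
        rw [← sq_abs]
        nlinarith [sq_nonneg (|z - c| - 1)]
      nlinarith [sq_nonneg (z - c)]
    have h2 := (ha σ z).2
    have h3 := gaussianPDFReal_nonneg c 1 z
    calc _ ≤ (exp (2 * B) * gaussianPDFReal c 1 z) * ((1 + 3 * B) * (1 + (z - c) ^ 2)) := by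
          gcongr
      _ = _ := by ring
  have hdom := (integrable_sub_sq_mul_gaussianPDFReal c).const_mul ((1 + 3 * B) * exp (2 * B))
  have hρ'i : Integrable fun z => tiltDensity ψ σ z * (σ - deriv ψ z) :=
    hdom.mono' (by fun_prop) (ae_of_all _ hbound)
  have hui : ∀ u : ℝ → ℝ, Integrable u →
      Integrable fun z : ℝ => (u z : ℂ) * Complex.exp (t * z * Complex.I) := fun u hu => by
    refine hu.ofReal.mul_bdd (c := 1) (by fun_prop) (ae_of_all _ fun z => ?_)
    rw [← Complex.ofReal_mul, Complex.norm_exp_ofReal_mul_I]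
  have hv : ∀ z : ℝ, HasDerivAt (fun z : ℝ => Complex.exp (t * z * Complex.I))
      (Complex.exp (t * z * Complex.I) * (t * Complex.I)) z := by
    intro z
    have h1 : HasDerivAt (fun z : ℝ => (t : ℂ) * z * Complex.I) (t * 1 * Complex.I) z :=
      ((hasDerivAt_id z).ofReal_comp.const_mul (t : ℂ)).mul_const _
    rw [mul_one] at h1
    exact h1.cexp
  have parts := integral_mul_deriv_eq_deriv_mul_of_integrable
    (u := fun z : ℝ => (tiltDensity ψ σ z : ℂ))
    (u' := fun z : ℝ => ((tiltDensity ψ σ z * (σ - deriv ψ z) : ℝ) : ℂ))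
    (v := fun z : ℝ => Complex.exp (t * z * Complex.I))
    (v' := fun z : ℝ => Complex.exp (t * z * Complex.I) * (t * Complex.I))
    (fun z _ => (hρ z).ofReal_comp) (fun z _ => hv z)
    (by
      refine ((hui _ (h.integrable_tiltDensity σ)).mul_const (t * Complex.I)).congr
        (ae_of_all _ fun z => ?_)
      simp only [Pi.mul_apply]
      ring)
    (hui _ hρ'i) (hui _ (h.integrable_tiltDensity σ))
  have e : |t| * ‖siteChar ψ σ t‖ = ‖∫ z : ℝ, (tiltDensity ψ σ z : ℂ) *
      (Complex.exp (t * z * Complex.I) * (t * Complex.I))‖ := by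
    simp_rw [← mul_assoc]
    rw [integral_mul_const, integral_mul_const, norm_mul, norm_mul, h.norm_siteChar_eq,
      Complex.norm_I, Complex.norm_real, norm_eq_abs]
    ring
  rw [e, parts, norm_neg]
  refine (norm_integral_le_of_norm_le hdom (ae_of_all _ fun z => ?_)).trans (le_of_eq ?_)
  · rw [norm_mul, ← Complex.ofReal_mul t, Complex.norm_exp_ofReal_mul_I, mul_one,
      Complex.norm_real]
    exact hbound z
  · rw [integral_const_mul, integral_sub_sq_mul_gaussianPDFReal, hG]

/-- A bound on the characteristic function, uniform in the field, which captures both the behaviour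
`1 - c t ^ 2` at the origin and a decay at infinity. -/
theorem exists_norm_siteChar_pow_four_le (B : ℝ) : ∃ c : ℝ, 0 < c ∧
    ∀ ψ, IsPerturbedQuadratic B ψ → ∀ σ t, ‖siteChar ψ σ t‖ ^ 4 * (1 + c * t ^ 2) ≤ 1 := by
  obtain ⟨D, hD1, hD⟩ := exists_abs_mul_norm_siteChar_le B
  by_cases hB : 0 ≤ B
  swap
  · exact ⟨1, one_pos, fun ψ h => absurd h.nonneg hB⟩
  have hε1 : exp (-(2 * B)) ≤ 1 := exp_le_one_iff.2 (by linarith)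
  set ε := exp (-(2 * B)) with hε
  have hε0 : 0 < ε := exp_pos _
  have hD4 : exp (-D ^ 4) ≤ 1 := exp_le_one_iff.2 (by have : 0 ≤ D ^ 4 := by positivity
                                                      linarith)
  have hD40 : 0 < exp (-D ^ 4) := exp_pos _
  set c := ε * exp (-D ^ 4) / 2 with hcdef
  have hc0 : 0 < c := by positivity
  have hc1 : c ≤ 1 := by
    have : ε * exp (-D ^ 4) ≤ 1 := mul_le_one₀ hε1 hD40.le hD4
    rw [hcdef]; linarith
  refine ⟨c, hc0, fun ψ h σ t => ?_⟩
  set f := ‖siteChar ψ σ t‖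
  have hf0 : 0 ≤ f := norm_nonneg _
  rcases le_total (t ^ 2) (2 * D ^ 4) with ht | ht
  · -- small `t`: the overlap with a Gaussian gives `f ≤ 1 - c t ^ 2`
    have h1 := h.norm_siteChar_le σ t
    have h2 : t ^ 2 / 2 * exp (-D ^ 4) ≤ 1 - exp (-(t ^ 2 / 2)) := by
      set x := t ^ 2 / 2 with hx
      have hx0 : 0 ≤ x := by positivity
      have h3 : exp (-D ^ 4) ≤ exp (-x) := exp_le_exp.2 (by rw [hx]; linarith)
      have h4 := add_one_le_exp x
      have h5 : exp x * exp (-x) = 1 := by rw [← exp_add]; simp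
      have h6 : (x + 1) * exp (-x) ≤ exp x * exp (-x) := by gcongr
      have h7 : x * exp (-D ^ 4) ≤ x * exp (-x) := by gcongr
      nlinarith
    have h3 : f ≤ 1 - c * t ^ 2 := by
      have h4 : ε * (t ^ 2 / 2 * exp (-D ^ 4)) ≤ ε * (1 - exp (-(t ^ 2 / 2))) := by gcongr
      have h5 : c * t ^ 2 = ε * (t ^ 2 / 2 * exp (-D ^ 4)) := by rw [hcdef]; ring
      rw [h5]
      linarith
    have hy0 : 0 ≤ c * t ^ 2 := by positivity
    have hf1 : f ≤ 1 := by linarith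
    have h4 : f ^ 4 ≤ f := by
      calc f ^ 4 ≤ f ^ 1 := pow_le_pow_of_le_one hf0 hf1 (by norm_num)
        _ = f := pow_one f
    calc f ^ 4 * (1 + c * t ^ 2) ≤ (1 - c * t ^ 2) * (1 + c * t ^ 2) := by
          gcongr
          exact h4.trans h3
      _ ≤ 1 := by nlinarith
  · -- large `t`: the decay `f ≤ D / |t|` suffices
    have h1 := hD ψ h σ t
    have hD4' : 1 ≤ D ^ 4 := one_le_pow₀ hD1
    have h2 : t ^ 4 * f ^ 4 ≤ D ^ 4 := by
      have h3 : (|t| * f) ^ 4 ≤ D ^ 4 := by gcongr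
      have h4 : |t| ^ 4 = t ^ 4 := by
        rw [show (4 : ℕ) = 2 * 2 from rfl, pow_mul, pow_mul, sq_abs]
      rwa [mul_pow, h4] at h3
    have ht2 : 1 ≤ t ^ 2 := by linarith
    have h3 : 1 + c * t ^ 2 ≤ 2 * t ^ 2 := by
      have : c * t ^ 2 ≤ 1 * t ^ 2 := by gcongr
      linarith
    have h4 : f ^ 4 * (1 + c * t ^ 2) ≤ f ^ 4 * (2 * t ^ 2) := by gcongr
    refine h4.trans ?_
    have ht0 : 0 < t ^ 2 := by linarith
    have h5 : t ^ 2 * (f ^ 4 * (2 * t ^ 2)) ≤ t ^ 2 * 1 := by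
      calc t ^ 2 * (f ^ 4 * (2 * t ^ 2)) = 2 * (t ^ 4 * f ^ 4) := by ring
        _ ≤ 2 * D ^ 4 := by gcongr
        _ ≤ t ^ 2 * 1 := by linarith
    exact le_of_mul_le_mul_left h5 ht0

/-- The bounds on the one-site characteristic functions and cumulants, with constants that depend
on `B` only. -/
theorem exists_siteChar_bounds (B : ℝ) : ∃ c M : ℝ, 0 < c ∧ 1 ≤ M ∧
    ∀ ψ, IsPerturbedQuadratic B ψ → ∀ σ,
      (∀ t, ‖siteChar ψ σ t‖ ^ 4 * (1 + c * t ^ 2) ≤ 1) ∧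
      (∀ t, ‖deriv (fun σ => siteChar ψ σ t) σ‖ ≤ M * t ^ 2) ∧
      (∀ t, ‖deriv (deriv (fun σ => siteChar ψ σ t)) σ‖ ≤ M * t ^ 2) ∧
      (∀ t, ‖siteChar ψ σ t - Real.exp (-(tiltMoment ψ 2 σ * t ^ 2 / 2))‖ ≤
        M * (|t| ^ 3 + t ^ 4)) ∧
      tiltMoment ψ 2 σ ≤ M ∧ |tiltMoment ψ 3 σ| ≤ M := by
  obtain ⟨c, hc0, hc⟩ := exists_norm_siteChar_pow_four_le B
  obtain ⟨M₀, hM1, hM₀⟩ := exists_tiltMoment_four_le B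
  set M := 1 + M₀ with hM
  have hM2 : 2 ≤ M := by rw [hM]; linarith
  refine ⟨c, (1 + 4 * M + M ^ 2) * M, hc0, by nlinarith, fun ψ h σ => ?_⟩
  have hψM : ∀ σ, 1 + tiltMoment ψ 4 σ ≤ M := fun σ => by
    rw [hM]
    linarith [hM₀ ψ h σ]
  have hle : ∀ n ≤ 4, |tiltMoment ψ n σ| ≤ M := fun n hn =>
    (h.abs_tiltMoment_le σ hn).trans (hψM σ)
  have hMM : M ≤ (1 + 4 * M + M ^ 2) * M := by nlinarith
  refine ⟨hc ψ h σ, fun t => (h.norm_deriv_siteChar_le hψM σ t).trans ?_,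
    h.norm_deriv_deriv_siteChar_le hψM σ,
    fun t => (h.norm_siteChar_sub_le hψM σ t).trans ?_,
    ((le_abs_self _).trans (hle 2 (by norm_num))).trans hMM,
    (hle 3 (by norm_num)).trans hMM⟩
  · have h1 : 1 + M ≤ 1 + 4 * M + M ^ 2 := by nlinarith
    gcongr
  · have h1 : M ^ 2 ≤ (1 + 4 * M + M ^ 2) * M := by nlinarith [sq_nonneg M]
    rw [mul_add]
    gcongr

/-! ### Derivatives of products -/

section Products

variable {E : Type*} [NormedAddCommGroup E] [NormedSpace ℝ E]

theorem norm_iteratedFDeriv_one {F : Type*} [NormedAddCommGroup F] [NormedSpace ℝ F] (f : E → F)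
    (x : E) : ‖iteratedFDeriv ℝ 1 f x‖ = ‖fderiv ℝ f x‖ := by
  rw [← norm_iteratedFDeriv_fderiv, norm_iteratedFDeriv_zero]

theorem norm_iteratedFDeriv_two {F : Type*} [NormedAddCommGroup F] [NormedSpace ℝ F] (f : E → F)
    (x : E) : ‖iteratedFDeriv ℝ 2 f x‖ = ‖fderiv ℝ (fderiv ℝ f) x‖ := by
  rw [← norm_iteratedFDeriv_fderiv, norm_iteratedFDeriv_one]

/-- Bounds for the derivatives of a product: if every factor is bounded by `u i`, its derivatives by
`b i`, and `R` bounds the inverses of the `u i`, then each differentiation of the product costs a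
factor `R ∑ b i`. -/
theorem norm_iteratedFDeriv_prod_le_of_bounds {ι : Type*} (s : Finset ι) {f : ι → E → ℂ}
    (hf : ∀ i, ContDiff ℝ 2 (f i)) {u b : ι → ℝ} {R : ℝ} {x : E} (hb : ∀ i, 0 ≤ b i)
    (hu : ∀ i, 0 < u i) (hR : ∀ i, 1 ≤ R * u i)
    (h0 : ∀ i, ‖f i x‖ ≤ u i) (h1 : ∀ i, ‖iteratedFDeriv ℝ 1 (f i) x‖ ≤ b i)
    (h2 : ∀ i, ‖iteratedFDeriv ℝ 2 (f i) x‖ ≤ b i) :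
    ‖∏ i ∈ s, f i x‖ ≤ ∏ i ∈ s, u i ∧
    ‖iteratedFDeriv ℝ 1 (fun x => ∏ i ∈ s, f i x) x‖ ≤ (R * ∑ i ∈ s, b i) * ∏ i ∈ s, u i ∧
    ‖iteratedFDeriv ℝ 2 (fun x => ∏ i ∈ s, f i x) x‖ ≤
      (R * ∑ i ∈ s, b i + (R * ∑ i ∈ s, b i) ^ 2) * ∏ i ∈ s, u i := by
  classical
  induction s using Finset.induction_on with
  | empty =>
    simp only [Finset.prod_empty, Finset.sum_empty,
      iteratedFDeriv_const_of_ne (𝕜 := ℝ) one_ne_zero (1 : ℂ),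
      iteratedFDeriv_const_of_ne (𝕜 := ℝ) two_ne_zero (1 : ℂ)]
    simp
  | insert i s hi ih =>
    obtain ⟨i0, i1, i2⟩ := ih
    have hR0 : 0 ≤ R := by
      have := hR i
      have h3 := hu i
      by_contra hneg
      nlinarith
    set U := ∏ i ∈ s, u i with hU
    have hU0 : 0 ≤ U := Finset.prod_nonneg fun i _ => (hu i).le
    set T := ∑ i ∈ s, b i with hT
    have hT0 : 0 ≤ T := Finset.sum_nonneg fun i _ => hb i
    have hs : ContDiff ℝ 2 (fun x => ∏ i ∈ s, f i x) := contDiff_prod fun i _ => hf i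
    have hbR : b i ≤ R * b i * u i := by nlinarith [hb i, hR i]
    have m1 : ‖iteratedFDeriv ℝ 1 (fun y => f i y * ∏ i ∈ s, f i y) x‖ ≤
        ‖f i x‖ * ‖iteratedFDeriv ℝ 1 (fun x => ∏ i ∈ s, f i x) x‖ +
          ‖iteratedFDeriv ℝ 1 (f i) x‖ * ‖∏ i ∈ s, f i x‖ := by
      refine (norm_iteratedFDeriv_mul_le (hf i) hs x (n := 1) (by norm_cast)).trans (le_of_eq ?_)
      rw [Finset.sum_range_succ, Finset.sum_range_one, Nat.sub_zero, Nat.sub_self,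
        norm_iteratedFDeriv_zero, norm_iteratedFDeriv_zero, Nat.choose_zero_right, Nat.choose_self]
      push_cast
      ring
    have m2 : ‖iteratedFDeriv ℝ 2 (fun y => f i y * ∏ i ∈ s, f i y) x‖ ≤
        ‖f i x‖ * ‖iteratedFDeriv ℝ 2 (fun x => ∏ i ∈ s, f i x) x‖ +
          2 * ‖iteratedFDeriv ℝ 1 (f i) x‖ * ‖iteratedFDeriv ℝ 1 (fun x => ∏ i ∈ s, f i x) x‖ +
          ‖iteratedFDeriv ℝ 2 (f i) x‖ * ‖∏ i ∈ s, f i x‖ := by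
      refine (norm_iteratedFDeriv_mul_le (hf i) hs x (n := 2) (by norm_cast)).trans (le_of_eq ?_)
      rw [Finset.sum_range_succ, Finset.sum_range_succ, Finset.sum_range_one, Nat.sub_zero,
        Nat.sub_self, norm_iteratedFDeriv_zero, norm_iteratedFDeriv_zero, Nat.choose_zero_right,
        Nat.choose_self, Nat.choose_one_right]
      push_cast
      ring
    simp_rw [Finset.prod_insert hi, Finset.sum_insert hi]
    have hbi := hb i
    have hui := (hu i).le
    refine ⟨?_, ?_, ?_⟩
    · rw [norm_mul]
      gcongr
      exact h0 i
    · calc _ ≤ _ := m1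
        _ ≤ u i * (R * T * U) + b i * U := by
            gcongr
            · exact h0 i
            · exact h1 i
        _ ≤ u i * (R * T * U) + (R * b i * u i) * U := by gcongr
        _ = _ := by ring
    · calc _ ≤ _ := m2
        _ ≤ u i * ((R * T + (R * T) ^ 2) * U) + 2 * b i * (R * T * U) + b i * U := by
            gcongr
            · exact h0 i
            · exact h1 i
            · exact h2 i
        _ ≤ u i * ((R * T + (R * T) ^ 2) * U) + 2 * (R * b i * u i) * (R * T * U) +
            (R * b i * u i) * U := by gcongr
        _ ≤ u i * ((R * T + (R * T) ^ 2) * U) + 2 * (R * b i * u i) * (R * T * U) +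
            (R * b i * u i) * U + (R * b i) ^ 2 * (u i * U) := by
            have : 0 ≤ (R * b i) ^ 2 * (u i * U) := by positivity
            linarith
        _ = _ := by ring

theorem norm_iteratedFDeriv_comp_clm_le (g : E →L[ℝ] ℝ) {f : ℝ → ℂ} (hf : ContDiff ℝ 2 f) (x : E)
    {i : ℕ} (hi : i ≤ 2) :
    ‖iteratedFDeriv ℝ i (fun x => f (g x)) x‖ ≤ ‖iteratedDeriv i f (g x)‖ * ‖g‖ ^ i := by
  have := g.iteratedFDeriv_comp_right hf x (i := i) (by exact_mod_cast hi)
  rw [show (fun x => f (g x)) = f ∘ g from rfl, this]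
  refine (ContinuousMultilinearMap.norm_compContinuousLinearMap_le _ _).trans ?_
  rw [norm_iteratedFDeriv_eq_norm_iteratedDeriv]
  simp

/-- A lower bound for a product `∏ (1 + x i)` in terms of the sum of the `x i`, by concavity of the
logarithm. -/
theorem rpow_le_prod_one_add {ι : Type*} [Fintype ι] {x : ι → ℝ} {q p : ℝ} (hx : ∀ i, 0 ≤ x i)
    (hxq : ∀ i, x i ≤ q) (hp : q * p ≤ ∑ i, x i) (hq : 0 ≤ q) :
    (1 + q) ^ p ≤ ∏ i, (1 + x i) := by
  rcases hq.eq_or_lt with rfl | hq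
  · rw [add_zero, one_rpow]
    calc (1 : ℝ) = ∏ _i : ι, (1 : ℝ) := by simp
      _ ≤ _ := Finset.prod_le_prod (fun i _ => zero_le_one) fun i _ => by linarith [hx i]
  calc (1 + q) ^ p ≤ (1 + q) ^ (∑ i, x i / q) := by
        refine rpow_le_rpow_of_exponent_le (by linarith) ?_
        rw [← Finset.sum_div, le_div_iff₀ hq, mul_comm]
        exact hp
    _ = ∏ i, (1 + q) ^ (x i / q) := rpow_sum_of_pos (by linarith) _ _
    _ ≤ ∏ i, (1 + x i) := by
        refine Finset.prod_le_prod (fun i _ => by positivity) fun i _ => ?_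
        refine (rpow_one_add_le_one_add_mul_self (by linarith) (div_nonneg (hx i) hq.le)
          ((div_le_one hq).2 (hxq i))).trans (le_of_eq ?_)
        field_simp

end Products

/-! ### The characteristic function of a block -/

section Block

variable {E : Type*} [NormedAddCommGroup E] [InnerProductSpace ℝ E]

/-- The vectors `a j` are bounded by `K`, and the quadratic form `(1 / J) ∑ ⟪a j, ζ⟫ ^ 2` is bounded
below by `c ‖ζ‖ ^ 2`. -/
def IsBlockFrame (K c : ℝ) {J : ℕ} (a : Fin J → E) : Prop :=
  (∀ j, ‖a j‖ ≤ K) ∧ ∀ ζ, c * ‖ζ‖ ^ 2 ≤ (1 / (J : ℝ)) * ∑ j, ⟪a j, ζ⟫ ^ 2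

/-- The frequency felt by the `j`-th site; it is normalized according to the central limit scaling
and the conventions of Mathlib's Fourier transform. -/
noncomputable def siteFreq {J : ℕ} (a : Fin J → E) (ζ : E) (j : Fin J) : ℝ :=
  -(2 * π / √J * ⟪a j, ζ⟫)

/-- The characteristic function, at the frequency `ζ`, of the normalized sum
`(1 / √J) ∑ (X j - E X j) • a j`, where the `X j` are independent one-site variables with
fields `⟪a j, η⟫`. -/
noncomputable def blockChar (ψ : ℝ → ℝ) {J : ℕ} (a : Fin J → E) (ζ η : E) : ℂ :=
  ∏ j, siteChar ψ ⟪a j, η⟫ (siteFreq a ζ j)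

theorem siteFreq_sq {J : ℕ} (a : Fin J → E) (ζ : E) (j : Fin J) :
    siteFreq a ζ j ^ 2 = 4 * π ^ 2 / J * ⟪a j, ζ⟫ ^ 2 := by
  rw [siteFreq, neg_sq, mul_pow, div_pow, sq_sqrt (Nat.cast_nonneg J)]
  ring

theorem IsBlockFrame.inner_sq_le {K c : ℝ} {J : ℕ} {a : Fin J → E} (ha : IsBlockFrame K c a)
    (ζ : E) (j : Fin J) : ⟪a j, ζ⟫ ^ 2 ≤ K ^ 2 * ‖ζ‖ ^ 2 := by
  rw [← sq_abs, ← mul_pow]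
  have h1 := abs_real_inner_le_norm (a j) ζ
  have h2 : ‖a j‖ * ‖ζ‖ ≤ K * ‖ζ‖ := by gcongr; exact ha.1 j
  exact pow_le_pow_left₀ (abs_nonneg _) (h1.trans h2) 2

theorem IsBlockFrame.siteFreq_sq_le {K c : ℝ} {J : ℕ} {a : Fin J → E} (ha : IsBlockFrame K c a)
    (ζ : E) (j : Fin J) : siteFreq a ζ j ^ 2 ≤ 4 * π ^ 2 * K ^ 2 * ‖ζ‖ ^ 2 / J := by
  rw [siteFreq_sq]
  calc 4 * π ^ 2 / J * ⟪a j, ζ⟫ ^ 2 ≤ 4 * π ^ 2 / J * (K ^ 2 * ‖ζ‖ ^ 2) := by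
        gcongr
        exact ha.inner_sq_le ζ j
    _ = _ := by ring

theorem IsBlockFrame.sum_siteFreq_sq_le {K c : ℝ} {J : ℕ} {a : Fin J → E}
    (ha : IsBlockFrame K c a) (ζ : E) (hJ : 0 < J) :
    ∑ j, siteFreq a ζ j ^ 2 ≤ 4 * π ^ 2 * K ^ 2 * ‖ζ‖ ^ 2 := by
  refine (Finset.sum_le_sum fun j _ => ha.siteFreq_sq_le ζ j).trans (le_of_eq ?_)
  rw [Finset.sum_const, Finset.card_univ, Fintype.card_fin, nsmul_eq_mul]
  field_simp

theorem IsBlockFrame.le_sum_siteFreq_sq {K c : ℝ} {J : ℕ} {a : Fin J → E}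
    (ha : IsBlockFrame K c a) (ζ : E) :
    4 * π ^ 2 * c * ‖ζ‖ ^ 2 ≤ ∑ j, siteFreq a ζ j ^ 2 := by
  simp_rw [siteFreq_sq]
  rw [← Finset.mul_sum]
  have h1 := ha.2 ζ
  calc 4 * π ^ 2 * c * ‖ζ‖ ^ 2 = 4 * π ^ 2 * (c * ‖ζ‖ ^ 2) := by ring
    _ ≤ 4 * π ^ 2 * ((1 / (J : ℝ)) * ∑ j, ⟪a j, ζ⟫ ^ 2) := by gcongr
    _ = _ := by ring

theorem IsPerturbedQuadratic.contDiff_blockChar (h : IsPerturbedQuadratic B ψ) {J : ℕ}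
    (a : Fin J → E) : ContDiff ℝ ∞ fun p : E × E => blockChar ψ a p.1 p.2 := by
  have h1 : ∀ j, ContDiff ℝ ∞ fun p : E × E => ⟪a j, p.2⟫ := fun j =>
    contDiff_const.inner ℝ contDiff_snd
  have h2 : ∀ j, ContDiff ℝ ∞ fun p : E × E => siteFreq a p.1 j := fun j =>
    (contDiff_const.mul (contDiff_const.inner ℝ contDiff_fst)).neg
  have h3 : ∀ j, ContDiff ℝ ∞ fun p : E × E => siteChar ψ ⟪a j, p.2⟫ (siteFreq a p.1 j) :=
    fun j => ContDiff.comp (g := fun p : ℝ × ℝ => siteChar ψ p.1 p.2)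
      (f := fun p : E × E => (⟪a j, p.2⟫, siteFreq a p.1 j)) h.contDiff_siteChar
      ((h1 j).prodMk (h2 j))
  exact contDiff_prod fun j _ => h3 j

/-- The powers `(1 + α w / J) ^ (-2 r J)` are dominated, uniformly in large `J`, by any prescribed
power of `1 + w`. -/
theorem exists_rpow_domination {α b r N : ℝ} (hα : 0 < α) (hb : 0 < b) (hr : 0 < r) (hN : 0 < N) :
    ∃ C : ℝ, ∃ J₁ : ℕ, 0 < C ∧ 0 < J₁ ∧ ∀ J : ℕ, J₁ ≤ J → ∀ w : ℝ, 0 ≤ w →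
      (1 + b * w) ^ 2 * (1 + α * w / J) ^ (1 / 2 - 2 * r * J) ≤ C * (1 + w) ^ (2 - N) := by
  obtain ⟨n, hn⟩ := exists_nat_ge (max (N / r) (max (1 / (2 * r)) 1))
  have hn1 : (1 : ℝ) ≤ n := (le_max_right _ _).trans ((le_max_right _ _).trans hn)
  have hnN : N ≤ r * n := by
    have := (le_max_left _ _).trans hn
    rwa [div_le_iff₀ hr, mul_comm] at this
  have hnr : 1 / 2 ≤ r * n := by
    have := (le_max_left _ _).trans ((le_max_right _ _).trans hn)
    rw [div_le_iff₀ (by positivity)] at this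
    linarith
  have hn0 : (0 : ℝ) < n := by linarith
  set m := min 1 (α / n) with hm
  have hm0 : 0 < m := lt_min one_pos (by positivity)
  refine ⟨(1 + b) ^ 2 * m ^ (-N), n, by positivity, by exact_mod_cast hn0, fun J hJ w hw => ?_⟩
  have hJn : (n : ℝ) ≤ J := by exact_mod_cast hJ
  have hJ0 : (0 : ℝ) < J := by linarith
  set y := α * w / J with hy
  have hy0 : 0 ≤ y := by positivity
  have h1 : (1 + y) ^ (1 / 2 - 2 * r * J) ≤ (1 + y) ^ (-(r * J)) := by
    refine rpow_le_rpow_of_exponent_le (by linarith) ?_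
    have : r * n ≤ r * J := by gcongr
    linarith
  have h2 : (m * (1 + w)) ^ N ≤ (1 + y) ^ (r * J) := by
    have h3 : 1 + α * w / n ≤ (1 + y) ^ ((J : ℝ) / n) := by
      have := one_add_mul_self_le_rpow_one_add (s := y) (p := (J : ℝ) / n) (by linarith)
        ((one_le_div hn0).2 hJn)
      refine le_trans (le_of_eq ?_) this
      rw [hy]
      field_simp
    have h4 : m * (1 + w) ≤ 1 + α * w / n := by
      have h5 : m ≤ 1 := min_le_left _ _
      have h6 : m * w ≤ α / n * w := by gcongr; exact min_le_right _ _
      have h7 : α / n * w = α * w / n := by ring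
      linarith
    have h5 : 1 ≤ 1 + α * w / n := by
      have : 0 ≤ α * w / n := by positivity
      linarith
    calc (m * (1 + w)) ^ N ≤ (1 + α * w / n) ^ N := by gcongr
      _ ≤ (1 + α * w / n) ^ (r * n) := rpow_le_rpow_of_exponent_le h5 hnN
      _ ≤ ((1 + y) ^ ((J : ℝ) / n)) ^ (r * n) := by gcongr
      _ = (1 + y) ^ (r * J) := by
        rw [← rpow_mul (by linarith)]
        congr 1
        field_simp
  have h3 : (1 + y) ^ (-(r * J)) ≤ m ^ (-N) * (1 + w) ^ (-N) := by
    rw [← mul_rpow hm0.le (by linarith), rpow_neg (by linarith), rpow_neg (by positivity)]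
    exact inv_anti₀ (by positivity) h2
  have h4 : (1 + b * w) ^ 2 ≤ (1 + b) ^ 2 * (1 + w) ^ 2 := by
    rw [← mul_pow]
    gcongr
    nlinarith
  calc (1 + b * w) ^ 2 * (1 + y) ^ (1 / 2 - 2 * r * J)
      ≤ ((1 + b) ^ 2 * (1 + w) ^ 2) * (m ^ (-N) * (1 + w) ^ (-N)) := by
        gcongr
        exact h1.trans h3
    _ = (1 + b) ^ 2 * m ^ (-N) * ((1 + w) ^ (2 : ℝ) * (1 + w) ^ (-N)) := by
        rw [rpow_two]
        ring
    _ = _ := by rw [← rpow_add (by linarith)]; rfl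

theorem norm_iteratedFDeriv_siteChar_le (h : IsPerturbedQuadratic B ψ) {J : ℕ} (a : Fin J → E)
    {K M : ℝ} (hK : 1 ≤ K) (haK : ∀ j, ‖a j‖ ≤ K) (hM : 0 ≤ M) (j : Fin J) (η : E) (t : ℝ) {i : ℕ}
    (hi : i ≤ 2) (hb : ∀ σ, ‖iteratedDeriv i (fun σ => siteChar ψ σ t) σ‖ ≤ M * t ^ 2) :
    ‖iteratedFDeriv ℝ i (fun η => siteChar ψ ⟪a j, η⟫ t) η‖ ≤ M * K ^ 2 * t ^ 2 := by
  have h1 : ContDiff ℝ 2 fun σ => siteChar ψ σ t :=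
    (h.contDiff_siteChar.comp (contDiff_id.prodMk contDiff_const)).of_le (by norm_cast)
  have h2 := norm_iteratedFDeriv_comp_clm_le (innerSL ℝ (a j)) h1 η hi
  simp only [innerSL_apply_apply] at h2
  refine h2.trans ?_
  rw [innerSL_apply_norm]
  have h3 : ‖a j‖ ^ i ≤ K ^ 2 := by
    calc ‖a j‖ ^ i ≤ K ^ i := pow_le_pow_left₀ (norm_nonneg _) (haK j) i
      _ ≤ K ^ 2 := pow_le_pow_right₀ hK hi
  calc _ ≤ M * t ^ 2 * K ^ 2 := by
        gcongr
        exact hb _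
    _ = _ := by ring

/-- The characteristic function of a block and its first two derivatives in the field are dominated
by an integrable function of the frequency which does not depend on the size of the block. -/
theorem exists_norm_iteratedFDeriv_blockChar_le (E : Type*) [NormedAddCommGroup E]
    [InnerProductSpace ℝ E] (B : ℝ) {K c : ℝ} (hK : 1 ≤ K) (hc : 0 < c) :
    ∃ C : ℝ, ∃ J₁ : ℕ, 0 < C ∧ 0 < J₁ ∧ ∀ ψ, IsPerturbedQuadratic B ψ → ∀ J : ℕ, J₁ ≤ J →
      ∀ a : Fin J → E, IsBlockFrame K c a → ∀ ζ η : E, ∀ i ≤ 2,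
        ‖iteratedFDeriv ℝ i (blockChar ψ a ζ) η‖ ≤
          C * (1 + ‖ζ‖ ^ 2) ^ (-((Module.finrank ℝ E : ℝ) + 1) / 2) := by
  obtain ⟨c₁, M, hc₁, hM1, hψb⟩ := exists_siteChar_bounds B
  have hM0 : 0 < M := by linarith
  have hK0 : 0 < K := by linarith
  set α := c₁ * (4 * π ^ 2 * K ^ 2) with hα
  set b := M * K ^ 2 * (4 * π ^ 2 * K ^ 2) with hb
  set r := c / K ^ 2 / 8 with hr
  have hα0 : 0 < α := by positivity
  have hb0 : 0 < b := by positivity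
  have hr0 : 0 < r := by positivity
  obtain ⟨C, J₁, hC, hJ₁, hdom⟩ := exists_rpow_domination (N := (Module.finrank ℝ E + 1) / 2 + 2)
    hα0 hb0 hr0 (by positivity)
  refine ⟨C, J₁, hC, hJ₁, fun ψ h J hJ a ha ζ η i hi => ?_⟩
  have hJ0 : 0 < J := by omega
  have hJ0' : (0 : ℝ) < J := by exact_mod_cast hJ0
  set w := ‖ζ‖ ^ 2 with hw
  have hw0 : 0 ≤ w := by positivity
  have hd := hdom J hJ w hw0
  rw [show (2 : ℝ) - ((Module.finrank ℝ E + 1) / 2 + 2) = -((Module.finrank ℝ E : ℝ) + 1) / 2 by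
    ring] at hd
  refine le_trans ?_ hd
  set t := siteFreq a ζ with ht
  set y := α * w / J with hy
  have hy0 : 0 ≤ y := by positivity
  -- `u j` bounds the `j`-th factor, and `R` the cost of leaving out one factor
  set u : Fin J → ℝ := fun j => (1 + c₁ * t j ^ 2) ^ (-(1 / 4) : ℝ) with hu
  set R := (1 + y) ^ (1 / 4 : ℝ) with hR
  have hx0 : ∀ j, 0 ≤ c₁ * t j ^ 2 := fun j => by positivity
  have hxy : ∀ j, c₁ * t j ^ 2 ≤ y := fun j => by
    have := ha.siteFreq_sq_le ζ j
    calc c₁ * t j ^ 2 ≤ c₁ * (4 * π ^ 2 * K ^ 2 * ‖ζ‖ ^ 2 / J) := by gcongr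
      _ = y := by rw [hy, hα, hw]; ring
  have hu0 : ∀ j, 0 < u j := fun j => rpow_pos_of_pos (by linarith [hx0 j]) _
  have hRu : ∀ j, 1 ≤ R * u j := fun j => by
    have h1 : (1 + c₁ * t j ^ 2) ^ (1 / 4 : ℝ) ≤ R :=
      rpow_le_rpow (by linarith [hx0 j]) (by linarith [hxy j]) (by norm_num)
    have h2 : (1 + c₁ * t j ^ 2) ^ (1 / 4 : ℝ) * u j = 1 := by
      rw [hu, ← rpow_add (by linarith [hx0 j])]
      simp
    rw [← h2]
    exact mul_le_mul_of_nonneg_right h1 (hu0 j).le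
  have hR1 : 1 ≤ R := one_le_rpow (by linarith) (by norm_num)
  have hh0 : ∀ j, ‖siteChar ψ ⟪a j, η⟫ (t j)‖ ≤ u j := fun j => by
    have h1 := (hψb ψ h ⟪a j, η⟫).1 (t j)
    set f := ‖siteChar ψ ⟪a j, η⟫ (t j)‖
    have hf : 0 ≤ f := norm_nonneg _
    have h2 : f ^ 4 ≤ (1 + c₁ * t j ^ 2)⁻¹ := by
      rw [← one_div, le_div_iff₀ (by linarith [hx0 j])]
      exact h1
    calc f = (f ^ 4) ^ (1 / 4 : ℝ) := by
          rw [← rpow_natCast, ← rpow_mul hf]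
          norm_num
      _ ≤ ((1 + c₁ * t j ^ 2)⁻¹) ^ (1 / 4 : ℝ) := by gcongr
      _ = u j := by
          simp only [hu]
          rw [inv_rpow (by linarith [hx0 j]), rpow_neg (by linarith [hx0 j])]
  have hh1 : ∀ j, ‖iteratedFDeriv ℝ 1 (fun η => siteChar ψ ⟪a j, η⟫ (t j)) η‖ ≤
      M * K ^ 2 * t j ^ 2 := fun j =>
    norm_iteratedFDeriv_siteChar_le h a hK ha.1 hM0.le j η (t j) (by norm_num) fun σ => by
      rw [iteratedDeriv_one]
      exact (hψb ψ h σ).2.1 _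
  have hh2 : ∀ j, ‖iteratedFDeriv ℝ 2 (fun η => siteChar ψ ⟪a j, η⟫ (t j)) η‖ ≤
      M * K ^ 2 * t j ^ 2 := fun j =>
    norm_iteratedFDeriv_siteChar_le h a hK ha.1 hM0.le j η (t j) le_rfl fun σ => by
      rw [iteratedDeriv_succ, iteratedDeriv_one]
      exact (hψb ψ h σ).2.2.1 _
  have hcd : ∀ j, ContDiff ℝ 2 fun η : E => siteChar ψ ⟪a j, η⟫ (t j) := fun j =>
    (h.contDiff_siteChar.comp ((contDiff_const.inner ℝ contDiff_id).prodMk contDiff_const)).of_le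
      (by norm_cast)
  obtain ⟨p0, p1, p2⟩ := norm_iteratedFDeriv_prod_le_of_bounds Finset.univ hcd
    (b := fun j => M * K ^ 2 * t j ^ 2) (fun j => by positivity) hu0 hRu hh0 hh1 hh2
  -- the frame condition keeps the sum of the squares of the frequencies of order `w`, while each of
  -- them is at most of order `w / J`; so a number of factors proportional to `J` is small
  have hU : ∏ j, u j ≤ (1 + y) ^ (-(2 * r * J)) := by
    have h1 : ∏ j, u j = (∏ j, (1 + c₁ * t j ^ 2)) ^ (-(1 / 4) : ℝ) :=
      (finsetProd_rpow _ _ (fun j _ => by linarith [hx0 j]) _)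
    have h2 : (1 + y) ^ (8 * r * J) ≤ ∏ j, (1 + c₁ * t j ^ 2) := by
      refine rpow_le_prod_one_add hx0 hxy ?_ hy0
      rw [← Finset.mul_sum]
      calc y * (8 * r * J) = c₁ * (4 * π ^ 2 * c * ‖ζ‖ ^ 2) := by
            rw [hy, hα, hr, hw]; field_simp
        _ ≤ _ := by
            gcongr
            exact ha.le_sum_siteFreq_sq ζ
    rw [h1, show -(2 * r * J) = 8 * r * J * (-(1 / 4)) by ring, rpow_mul (by linarith)]
    exact rpow_le_rpow_of_nonpos (by positivity) h2 (by norm_num)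
  have hS : R * ∑ j, M * K ^ 2 * t j ^ 2 ≤ R * (b * w) := by
    rw [← Finset.mul_sum]
    have := ha.sum_siteFreq_sq_le ζ hJ0
    calc R * (M * K ^ 2 * ∑ j, t j ^ 2) ≤ R * (M * K ^ 2 * (4 * π ^ 2 * K ^ 2 * ‖ζ‖ ^ 2)) := by
          gcongr
      _ = _ := by rw [hb, hw]; ring
  set S := R * ∑ j, M * K ^ 2 * t j ^ 2 with hSdef
  have hS0 : 0 ≤ S := mul_nonneg (by linarith) (Finset.sum_nonneg fun j _ => by positivity)
  have hU0 : 0 ≤ ∏ j, u j := Finset.prod_nonneg fun j _ => (hu0 j).le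
  have key : ‖iteratedFDeriv ℝ i (blockChar ψ a ζ) η‖ ≤ (1 + S) ^ 2 * ∏ j, u j := by
    have e : blockChar ψ a ζ = fun η => ∏ j, siteChar ψ ⟪a j, η⟫ (t j) := rfl
    rw [e]
    interval_cases i
    · rw [norm_iteratedFDeriv_zero]
      refine p0.trans (le_mul_of_one_le_left hU0 ?_)
      nlinarith
    · refine p1.trans ?_
      gcongr
      nlinarith
    · refine p2.trans ?_
      gcongr
      nlinarith
  refine key.trans ?_
  have hS1 : 1 + S ≤ R * (1 + b * w) := by linarith
  calc (1 + S) ^ 2 * ∏ j, u j ≤ (R * (1 + b * w)) ^ 2 * (1 + y) ^ (-(2 * r * J)) := by gcongr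
    _ = (1 + b * w) ^ 2 * ((1 + y) ^ (1 / 2 : ℝ) * (1 + y) ^ (-(2 * r * J))) := by
      rw [mul_pow, hR, ← rpow_natCast (_ ^ (1 / 4 : ℝ)), ← rpow_mul (by linarith)]
      norm_num
      ring
    _ = _ := by rw [← rpow_add (by linarith)]; rfl

end Block

/-! ### Differentiation of parametric integrals -/

section Parametric

variable {E F H : Type*} [NormedAddCommGroup E] [NormedSpace ℝ E] [NormedAddCommGroup F]
  [NormedSpace ℝ F] [NormedAddCommGroup H] [NormedSpace ℝ H]

theorem contDiff_fderiv_snd {P : E → F → H} (hP : ContDiff ℝ ∞ fun p : E × F => P p.1 p.2) :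
    ContDiff ℝ ∞ fun p : E × F => fderiv ℝ (P p.1) p.2 :=
  ContDiff.fderiv (f := fun p : E × F => P p.1) (g := fun p : E × F => p.2)
    (hP.comp ((contDiff_fst.comp contDiff_fst).prodMk contDiff_snd)) contDiff_snd (by simp)

theorem hasFDerivAt_integral_of_bound [SecondCountableTopology E] [MeasurableSpace E]
    [BorelSpace E] {P : E → F → H} {μ : Measure E}
    (hP : ContDiff ℝ ∞ fun p : E × F => P p.1 p.2) {g : E → ℝ} (hg : Integrable g μ)
    (h0 : ∀ x y, ‖P x y‖ ≤ g x) (h1 : ∀ x y, ‖fderiv ℝ (P x) y‖ ≤ g x) (y : F) :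
    HasFDerivAt (fun y => ∫ x, P x y ∂μ) (∫ x, fderiv ℝ (P x) y ∂μ) y := by
  have hm : ∀ y, AEStronglyMeasurable (fun x => P x y) μ := fun y =>
    (hP.continuous.comp (continuous_id.prodMk continuous_const)).aestronglyMeasurable
  refine hasFDerivAt_integral_of_dominated_of_fderiv_le (𝕜 := ℝ) (s := univ)
    (F := fun y x => P x y) (F' := fun y x => fderiv ℝ (P x) y) (bound := g)
    Filter.univ_mem (Filter.Eventually.of_forall hm)
    (hg.mono' (hm y) (ae_of_all _ fun x => h0 x y)) ?_
    (ae_of_all _ fun x y _ => h1 x y) hg (ae_of_all _ fun x y _ => ?_)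
  · exact ((contDiff_fderiv_snd hP).continuous.comp
      (continuous_id.prodMk continuous_const)).aestronglyMeasurable
  · have : ContDiff ℝ ∞ (P x) := hP.comp (contDiff_const.prodMk contDiff_id)
    exact ((this.differentiable (by simp)) y).hasFDerivAt

/-- An integral of functions which are dominated, together with their first two derivatives, by a
fixed integrable function is of class `C²`, and its derivatives are bounded by the integral of that
function. -/
theorem contDiff_two_integral [SecondCountableTopology E] [MeasurableSpace E]
    [BorelSpace E] {P : E → F → H} {μ : Measure E}
    (hP : ContDiff ℝ ∞ fun p : E × F => P p.1 p.2) {g : E → ℝ} (hg : Integrable g μ)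
    (hb : ∀ x y, ∀ i ≤ 2, ‖iteratedFDeriv ℝ i (P x) y‖ ≤ g x) :
    ContDiff ℝ 2 (fun y => ∫ x, P x y ∂μ) ∧
      ∀ y, ∀ i ≤ 2, ‖iteratedFDeriv ℝ i (fun y => ∫ x, P x y ∂μ) y‖ ≤ ∫ x, g x ∂μ := by
  have hP1 := contDiff_fderiv_snd hP
  have hP2 := contDiff_fderiv_snd (P := fun x y => fderiv ℝ (P x) y) hP1
  have b0 : ∀ x y, ‖P x y‖ ≤ g x := fun x y => by
    simpa [norm_iteratedFDeriv_zero] using hb x y 0 (by norm_num)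
  have b1 : ∀ x y, ‖fderiv ℝ (P x) y‖ ≤ g x := fun x y => by
    rw [← norm_iteratedFDeriv_one]; exact hb x y 1 (by norm_num)
  have b2 : ∀ x y, ‖fderiv ℝ (fun y => fderiv ℝ (P x) y) y‖ ≤ g x := fun x y => by
    rw [← norm_iteratedFDeriv_two]; exact hb x y 2 le_rfl
  have d1 := hasFDerivAt_integral_of_bound hP hg b0 b1
  have d2 := hasFDerivAt_integral_of_bound (P := fun x y => fderiv ℝ (P x) y) hP1 hg b1 b2
  have e1 : fderiv ℝ (fun y => ∫ x, P x y ∂μ) = fun y => ∫ x, fderiv ℝ (P x) y ∂μ :=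
    funext fun y => (d1 y).fderiv
  have e2 : fderiv ℝ (fun y => ∫ x, fderiv ℝ (P x) y ∂μ) =
      fun y => ∫ x, fderiv ℝ (fun y => fderiv ℝ (P x) y) y ∂μ := funext fun y => (d2 y).fderiv
  refine ⟨?_, fun y i hi => ?_⟩
  · rw [show (2 : WithTop ℕ∞) = 1 + 1 by norm_num, contDiff_succ_iff_fderiv]
    refine ⟨fun y => (d1 y).differentiableAt, by simp, ?_⟩
    rw [e1, contDiff_one_iff_fderiv]
    refine ⟨fun y => (d2 y).differentiableAt, ?_⟩
    rw [e2]
    refine continuous_of_dominated (bound := g) (fun y => ?_) (fun y => ae_of_all _ fun x => b2 x y)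
      hg (ae_of_all _ fun x => ?_)
    · exact (hP2.continuous.comp (continuous_id.prodMk continuous_const)).aestronglyMeasurable
    · exact hP2.continuous.comp (continuous_const.prodMk continuous_id)
  · interval_cases i
    · rw [norm_iteratedFDeriv_zero]
      exact norm_integral_le_of_norm_le hg (ae_of_all _ fun x => b0 x y)
    · rw [norm_iteratedFDeriv_one, e1]
      exact norm_integral_le_of_norm_le hg (ae_of_all _ fun x => b1 x y)
    · rw [norm_iteratedFDeriv_two, e1, e2]
      exact norm_integral_le_of_norm_le hg (ae_of_all _ fun x => b2 x y)

end Parametric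

/-! ### Lower bound for the integrated characteristic function -/

section LowerBound

theorem norm_prod_sub_prod_le_sum {ι : Type*} (s : Finset ι) {f g : ι → ℂ} (hf : ∀ i, ‖f i‖ ≤ 1)
    (hg : ∀ i, ‖g i‖ ≤ 1) : ‖∏ i ∈ s, f i - ∏ i ∈ s, g i‖ ≤ ∑ i ∈ s, ‖f i - g i‖ := by
  classical
  induction s using Finset.induction_on with
  | empty => simp
  | insert i s hi ih =>
    rw [Finset.prod_insert hi, Finset.prod_insert hi, Finset.sum_insert hi]
    have hs : ‖∏ i ∈ s, g i‖ ≤ 1 := by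
      rw [norm_prod]
      exact Finset.prod_le_one (fun i _ => norm_nonneg _) fun i _ => hg i
    calc ‖f i * ∏ i ∈ s, f i - g i * ∏ i ∈ s, g i‖
        = ‖f i * (∏ i ∈ s, f i - ∏ i ∈ s, g i) + (f i - g i) * ∏ i ∈ s, g i‖ := by
          congr 1; ring
      _ ≤ ‖f i‖ * ‖∏ i ∈ s, f i - ∏ i ∈ s, g i‖ + ‖f i - g i‖ * ‖∏ i ∈ s, g i‖ := by
          refine (norm_add_le _ _).trans ?_
          rw [norm_mul, norm_mul]
      _ ≤ 1 * ‖∏ i ∈ s, f i - ∏ i ∈ s, g i‖ + ‖f i - g i‖ * 1 := by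
          gcongr
          exact hf i
      _ ≤ _ := by linarith

variable {E : Type*} [NormedAddCommGroup E] [InnerProductSpace ℝ E]

/-- On bounded sets of frequencies the characteristic function of a block is bounded below by a
Gaussian, up to an error of order `1 / √J`. -/
theorem exists_le_re_blockChar (B : ℝ) {K c : ℝ} (hK : 1 ≤ K) : ∃ A C : ℝ, 0 < A ∧ 0 < C ∧
    ∀ ψ, IsPerturbedQuadratic B ψ → ∀ J : ℕ, 0 < J → ∀ a : Fin J → E, IsBlockFrame K c a →
      ∀ ζ η : E, exp (-(A * ‖ζ‖ ^ 2)) - C * (‖ζ‖ ^ 3 / √J + ‖ζ‖ ^ 4 / J) ≤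
        (blockChar ψ a ζ η).re := by
  obtain ⟨c₁, M, hc₁, hM1, hψb⟩ := exists_siteChar_bounds B
  have hM0 : 0 < M := by linarith
  set b := 2 * π * K with hb
  have hb0 : 0 < b := by positivity
  refine ⟨M * b ^ 2 / 2, M * (b ^ 3 + b ^ 4), by positivity, by positivity,
    fun ψ h J hJ a ha ζ η => ?_⟩
  have hJ0 : (0 : ℝ) < J := by exact_mod_cast hJ
  set t := siteFreq a ζ with ht
  have htb : ∀ j, |t j| ≤ b * ‖ζ‖ / √J := fun j => by
    refine abs_le_of_sq_le_sq ?_ (by positivity)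
    rw [div_pow, sq_sqrt hJ0.le, hb]
    refine (ha.siteFreq_sq_le ζ j).trans (le_of_eq ?_)
    ring
  set k : Fin J → ℝ := fun j => tiltMoment ψ 2 ⟪a j, η⟫ with hk
  have hk0 : ∀ j, 0 ≤ k j := fun j => (exp_pos _).le.trans (h.exp_le_tiltMoment_two _)
  set g : Fin J → ℂ := fun j => ((exp (-(k j * t j ^ 2 / 2)) : ℝ) : ℂ) with hg
  have hg1 : ∀ j, ‖g j‖ ≤ 1 := fun j => by
    rw [hg, Complex.norm_real, norm_of_nonneg (exp_pos _).le]
    refine exp_le_one_iff.2 ?_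
    have := hk0 j
    have : 0 ≤ k j * t j ^ 2 / 2 := by positivity
    linarith
  have hf1 : ∀ j, ‖siteChar ψ ⟪a j, η⟫ (t j)‖ ≤ 1 := fun j => by
    have := h.norm_siteChar_le ⟪a j, η⟫ (t j)
    have h1 : exp (-(t j ^ 2 / 2)) ≤ 1 := exp_le_one_iff.2 (by
      have : 0 ≤ t j ^ 2 / 2 := by positivity
      linarith)
    have h2 := exp_pos (-(2 * B))
    nlinarith
  have hdiff : ‖blockChar ψ a ζ η - ∏ j, g j‖ ≤
      M * (b ^ 3 + b ^ 4) * (‖ζ‖ ^ 3 / √J + ‖ζ‖ ^ 4 / J) := by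
    refine (norm_prod_sub_prod_le_sum Finset.univ hf1 hg1).trans ?_
    have h1 : ∀ j, ‖siteChar ψ ⟪a j, η⟫ (t j) - g j‖ ≤
        M * ((b * ‖ζ‖ / √J) ^ 3 + (b * ‖ζ‖ / √J) ^ 4) := fun j => by
      refine ((hψb ψ h _).2.2.2.1 (t j)).trans ?_
      have h4 : t j ^ 4 = |t j| ^ 4 := by
        rw [show (4 : ℕ) = 2 * 2 from rfl, pow_mul, pow_mul, sq_abs]
      rw [h4]
      have := htb j
      gcongr
    refine (Finset.sum_le_sum fun j _ => h1 j).trans ?_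
    rw [Finset.sum_const, Finset.card_univ, Fintype.card_fin, nsmul_eq_mul]
    have hs : √(J : ℝ) ^ 2 = J := sq_sqrt hJ0.le
    have hs0 : 0 < √(J : ℝ) := sqrt_pos.2 hJ0
    have e3 : (J : ℝ) * (b * ‖ζ‖ / √J) ^ 3 = b ^ 3 * (‖ζ‖ ^ 3 / √J) := by
      rw [div_pow]
      nth_rewrite 1 [← hs]
      field_simp
    have e4 : (J : ℝ) * (b * ‖ζ‖ / √J) ^ 4 = b ^ 4 * (‖ζ‖ ^ 4 / J) := by
      rw [div_pow, show √(J : ℝ) ^ 4 = (√(J : ℝ) ^ 2) ^ 2 by ring, hs]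
      field_simp
    calc (J : ℝ) * (M * ((b * ‖ζ‖ / √J) ^ 3 + (b * ‖ζ‖ / √J) ^ 4)) =
          M * (b ^ 3 * (‖ζ‖ ^ 3 / √J) + b ^ 4 * (‖ζ‖ ^ 4 / J)) := by
          rw [← e3, ← e4]; ring
      _ ≤ M * ((b ^ 3 + b ^ 4) * (‖ζ‖ ^ 3 / √J) + (b ^ 3 + b ^ 4) * (‖ζ‖ ^ 4 / J)) := by
          have h3 : 0 ≤ b ^ 3 := by positivity
          have h4 : 0 ≤ b ^ 4 := by positivity
          gcongr <;> linarith
      _ = _ := by ring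
  have hG : ∏ j, g j = ((exp (-∑ j, k j * t j ^ 2 / 2) : ℝ) : ℂ) := by
    rw [hg, ← Complex.ofReal_prod, ← exp_sum, Finset.sum_neg_distrib]
  have hGl : exp (-(M * b ^ 2 / 2 * ‖ζ‖ ^ 2)) ≤ exp (-∑ j, k j * t j ^ 2 / 2) := by
    refine exp_le_exp.2 (neg_le_neg ?_)
    calc ∑ j, k j * t j ^ 2 / 2 ≤ ∑ j, M * t j ^ 2 / 2 := by
          refine Finset.sum_le_sum fun j _ => ?_
          have := (hψb ψ h ⟪a j, η⟫).2.2.2.2.1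
          gcongr
      _ = M / 2 * ∑ j, t j ^ 2 := by
          rw [Finset.mul_sum]
          exact Finset.sum_congr rfl fun j _ => by ring
      _ ≤ M / 2 * (4 * π ^ 2 * K ^ 2 * ‖ζ‖ ^ 2) := by
          gcongr
          exact ha.sum_siteFreq_sq_le ζ hJ
      _ = _ := by rw [hb]; ring
  have h1 := (Complex.abs_re_le_norm (blockChar ψ a ζ η - ∏ j, g j)).trans hdiff
  rw [Complex.sub_re, hG, Complex.ofReal_re] at h1
  have h2 := (abs_le.1 h1).1
  linarith

end LowerBound

/-! ### The local central limit theorem -/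

section BlockIntegral

variable {E : Type*} [NormedAddCommGroup E] [InnerProductSpace ℝ E] [FiniteDimensional ℝ E]
  [MeasurableSpace E] [BorelSpace E]

/-- The integral of the characteristic function of a block over all frequencies, that is, up to a
constant, the density at the origin of the normalized sum of the one-site variables. -/
noncomputable def blockDensity (ψ : ℝ → ℝ) {J : ℕ} (a : Fin J → E) (η : E) : ℝ :=
  (∫ ζ, blockChar ψ a ζ η).re

theorem exists_setIntegral_compl_ball_le {g : E → ℝ} (hg : Integrable g) {ε : ℝ} (hε : 0 < ε) :
    ∃ R : ℝ, 1 ≤ R ∧ ∫ ζ in (Metric.ball (0 : E) R)ᶜ, g ζ ≤ ε := by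
  have h1 : Filter.Tendsto (fun n : ℕ => ∫ ζ in Metric.ball (0 : E) n, g ζ) Filter.atTop
      (nhds (∫ ζ in ⋃ n : ℕ, Metric.ball (0 : E) n, g ζ)) :=
    tendsto_setIntegral_of_monotone (fun n => Metric.isOpen_ball.measurableSet)
      (fun m n hmn => Metric.ball_subset_ball (by exact_mod_cast hmn)) hg.integrableOn
  rw [Metric.iUnion_ball_nat, setIntegral_univ] at h1
  have h2 := h1.eventually (lt_mem_nhds (show (∫ ζ, g ζ) - ε < ∫ ζ, g ζ by linarith))
  obtain ⟨n, hn1, hn2⟩ := (h2.and (Filter.eventually_ge_atTop 1)).exists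
  refine ⟨n, by exact_mod_cast hn2, ?_⟩
  have h3 := integral_add_compl (μ := (volume : Measure E))
    (Metric.isOpen_ball (x := (0 : E)) (ε := n)).measurableSet hg
  linarith

/-- The local central limit theorem in the form that is used: for large blocks, `blockDensity` is of
class `C²` with bounded derivatives, and is bounded below, uniformly in the field. -/
theorem exists_blockDensity_bounds (E : Type*) [NormedAddCommGroup E] [InnerProductSpace ℝ E]
    [FiniteDimensional ℝ E] [MeasurableSpace E] [BorelSpace E] (B : ℝ) {K c : ℝ} (hK : 1 ≤ K)
    (hc : 0 < c) :
    ∃ m M : ℝ, ∃ J₁ : ℕ, 0 < m ∧ 0 < M ∧ 0 < J₁ ∧ ∀ ψ, IsPerturbedQuadratic B ψ →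
      ∀ J : ℕ, J₁ ≤ J → ∀ a : Fin J → E, IsBlockFrame K c a →
        (∀ η, Integrable fun ζ => blockChar ψ a ζ η) ∧
        ContDiff ℝ 2 (blockDensity ψ a) ∧ (∀ η, m ≤ blockDensity ψ a η) ∧
        ∀ η, ∀ i ≤ 2, ‖iteratedFDeriv ℝ i (blockDensity ψ a) η‖ ≤ M := by
  obtain ⟨C, J₁, hC, hJ₁, hdom⟩ := exists_norm_iteratedFDeriv_blockChar_le E B hK hc
  obtain ⟨A, C', hA, hC', hlow⟩ := exists_le_re_blockChar (E := E) B (c := c) hK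
  set g : E → ℝ := fun ζ => C * (1 + ‖ζ‖ ^ 2) ^ (-((Module.finrank ℝ E : ℝ) + 1) / 2) with hgdef
  have hg0 : ∀ ζ, 0 < g ζ := fun ζ => by positivity
  have hg : Integrable g :=
    (integrable_rpow_neg_one_add_norm_sq (lt_add_one (Module.finrank ℝ E : ℝ))).const_mul C
  have hexpc : Continuous fun ζ : E => exp (-(A * ‖ζ‖ ^ 2)) := by fun_prop
  have hexpi : ∀ R, IntegrableOn (fun ζ : E => exp (-(A * ‖ζ‖ ^ 2))) (Metric.ball 0 R) := fun R =>
    (hexpc.continuousOn.integrableOn_compact (isCompact_closedBall 0 R)).mono_set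
      Metric.ball_subset_closedBall
  set α := ∫ ζ in Metric.ball (0 : E) 1, exp (-(A * ‖ζ‖ ^ 2)) with hα
  have hα0 : 0 < α := by
    refine (setIntegral_pos_iff_support_of_nonneg_ae (ae_of_all _ fun ζ => (exp_pos _).le)
      (hexpi 1)).2 ?_
    have : Function.support (fun ζ : E => exp (-(A * ‖ζ‖ ^ 2))) = univ :=
      Function.support_eq_univ fun ζ => (exp_pos _).ne'
    rw [this, univ_inter]
    exact Metric.measure_ball_pos _ _ one_pos
  -- outside of the ball of radius `R` the dominating function has little mass; inside, for large
  -- `J`, the real part is bounded below by a Gaussian up to a small error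
  obtain ⟨R, hR1, hR⟩ := exists_setIntegral_compl_ball_le hg (ε := α / 4) (by positivity)
  set V := volume.real (Metric.ball (0 : E) R) with hV
  have hJ : ∀ᶠ J : ℕ in Filter.atTop, V * (C' * (R ^ 3 / √J + R ^ 4 / J)) ≤ α / 4 := by
    have h1 : Filter.Tendsto (fun J : ℕ => V * (C' * (R ^ 3 / √J + R ^ 4 / J))) Filter.atTop
        (nhds (V * (C' * (0 + 0)))) := by
      refine ((Filter.Tendsto.add ?_ ?_).const_mul C').const_mul V
      · exact ((tendsto_sqrt_atTop.comp tendsto_natCast_atTop_atTop).const_div_atTop _)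
      · exact (tendsto_natCast_atTop_atTop.const_div_atTop _)
    simp only [add_zero, mul_zero] at h1
    exact (h1.eventually (gt_mem_nhds (show (0 : ℝ) < α / 4 by positivity))).mono fun _ h => h.le
  obtain ⟨J₂, hJ₂⟩ := Filter.eventually_atTop.1 hJ
  refine ⟨α / 2, (∫ ζ, g ζ) + 1, max J₁ J₂, by positivity,
    by linarith [integral_nonneg (μ := (volume : Measure E)) (f := g) fun ζ => (hg0 ζ).le],
    lt_of_lt_of_le hJ₁ (le_max_left _ _), fun ψ h J hJ a ha => ?_⟩
  have hJ0 : 0 < J := lt_of_lt_of_le hJ₁ ((le_max_left _ _).trans hJ)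
  have hdom' := hdom ψ h J ((le_max_left _ _).trans hJ) a ha
  have hP := h.contDiff_blockChar a
  have hdom0 : ∀ ζ η, ‖blockChar ψ a ζ η‖ ≤ g ζ := fun ζ η => by
    rw [← norm_iteratedFDeriv_zero (𝕜 := ℝ)]
    exact hdom' ζ η 0 (by norm_num)
  have hint : ∀ η, Integrable fun ζ => blockChar ψ a ζ η := fun η =>
    hg.mono' (hP.continuous.comp (continuous_id.prodMk continuous_const)).aestronglyMeasurable
      (ae_of_all _ fun ζ => hdom0 ζ η)
  obtain ⟨hcd, hbd⟩ := contDiff_two_integral hP hg hdom'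
  have hre : blockDensity ψ a = Complex.reCLM ∘ fun η => ∫ ζ, blockChar ψ a ζ η := rfl
  refine ⟨hint, ?_, fun η => ?_, fun η i hi => ?_⟩
  · rw [hre]
    exact Complex.reCLM.contDiff.comp hcd
  · have e : blockDensity ψ a η = ∫ ζ, (blockChar ψ a ζ η).re :=
      (Complex.reCLM.integral_comp_comm (hint η)).symm
    have hrei : Integrable fun ζ => (blockChar ψ a ζ η).re := (hint η).re
    have hms := (Metric.isOpen_ball (x := (0 : E)) (ε := R)).measurableSet
    rw [e, ← integral_add_compl hms hrei]
    have h1 : -(α / 4) ≤ ∫ ζ in (Metric.ball (0 : E) R)ᶜ, (blockChar ψ a ζ η).re := by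
      have h2 : ∫ ζ in (Metric.ball (0 : E) R)ᶜ, -g ζ ≤
          ∫ ζ in (Metric.ball (0 : E) R)ᶜ, (blockChar ψ a ζ η).re := by
        refine integral_mono hg.neg.integrableOn hrei.integrableOn fun ζ => ?_
        have h3 := (Complex.abs_re_le_norm (blockChar ψ a ζ η)).trans (hdom0 ζ η)
        exact (abs_le.1 h3).1
      rw [integral_neg] at h2
      linarith
    have h2 : α - α / 4 ≤ ∫ ζ in Metric.ball (0 : E) R, (blockChar ψ a ζ η).re := by
      set D := C' * (R ^ 3 / √J + R ^ 4 / J) with hD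
      have hDV := hJ₂ J ((le_max_right _ _).trans hJ)
      have hci : IntegrableOn (fun _ : E => D) (Metric.ball 0 R) :=
        integrableOn_const (measure_ball_lt_top).ne
      have h3 : ∫ ζ in Metric.ball (0 : E) R, (exp (-(A * ‖ζ‖ ^ 2)) - D) ≤
          ∫ ζ in Metric.ball (0 : E) R, (blockChar ψ a ζ η).re := by
        refine setIntegral_mono_on ((hexpi R).sub hci) hrei.integrableOn hms fun ζ hζ => ?_
        refine le_trans ?_ (hlow ψ h J hJ0 a ha ζ η)
        have hζR : ‖ζ‖ ≤ R := (mem_ball_zero_iff.1 hζ).le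
        rw [hD]
        gcongr
      rw [integral_sub (hexpi R) hci, setIntegral_const, smul_eq_mul] at h3
      have h4 : α ≤ ∫ ζ in Metric.ball (0 : E) R, exp (-(A * ‖ζ‖ ^ 2)) :=
        setIntegral_mono_set (hexpi R) (ae_of_all _ fun ζ => (exp_pos _).le)
          (Metric.ball_subset_ball hR1).eventuallyLE
      linarith
    linarith
  · rw [hre]
    refine (Complex.reCLM.norm_iteratedFDeriv_comp_left hcd.contDiffAt
      (by exact_mod_cast hi)).trans ?_
    rw [Complex.reCLM_norm, one_mul]
    linarith [hbd η i hi]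

end BlockIntegral

/-! ### Integration along the fibres of a linear map -/

section Fibre

variable {E V : Type*} [NormedAddCommGroup E] [InnerProductSpace ℝ E]
  [NormedAddCommGroup V] [InnerProductSpace ℝ V]

/-- The kernel of `T`. -/
abbrev kerOf (T : V →L[ℝ] E) : Submodule ℝ V := LinearMap.ker T.toLinearMap

theorem isometry_add_const (T : V →L[ℝ] E) (v : V) :
    Isometry fun y : kerOf T => (y : V) + v :=
  Isometry.of_dist_eq fun x y => by simp [Subtype.dist_eq]

section SliceMeasure

variable [FiniteDimensional ℝ V] [MeasurableSpace V] [BorelSpace V]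

/-- The Hausdorff measure on the fibre of `T` over `β`, normalized to agree with Lebesgue
measure. -/
noncomputable def sliceMeasure (T : V →L[ℝ] E) (β : E) : Measure V :=
  (Measure.euclideanHausdorffMeasure (Module.finrank ℝ (kerOf T))).restrict {x | T x = β}

theorem sliceMeasure_eq_map (T : V →L[ℝ] E) (v : V) :
    sliceMeasure T (T v) = Measure.map (fun y : kerOf T => (y : V) + v) volume := by
  rw [← InnerProductSpace.euclideanHausdorffMeasure_eq_volume,
    (isometry_add_const T v).map_euclideanHausdorffMeasure, sliceMeasure]
  congr 1
  ext x
  simp only [mem_ofPred_eq, mem_range, Subtype.exists, exists_prop]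
  constructor
  · intro h
    refine ⟨x - v, ?_, by simp⟩
    change T (x - v) = 0
    rw [map_sub, h, sub_self]
  · rintro ⟨y, hy, rfl⟩
    have : T y = 0 := hy
    rw [map_add, this, zero_add]

theorem measurableEmbedding_add_const (T : V →L[ℝ] E) (v : V) :
    MeasurableEmbedding fun y : kerOf T => (y : V) + v :=
  (isometry_add_const T v).isClosedEmbedding.measurableEmbedding

theorem integral_sliceMeasure {F : Type*} [NormedAddCommGroup F] [NormedSpace ℝ F]
    (T : V →L[ℝ] E) (v : V) (f : V → F) :
    ∫ x, f x ∂(sliceMeasure T (T v)) = ∫ y : kerOf T, f (y + v) := by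
  rw [sliceMeasure_eq_map]
  exact (measurableEmbedding_add_const T v).integral_map _

theorem integrable_sliceMeasure_iff {F : Type*} [NormedAddCommGroup F]
    (T : V →L[ℝ] E) (v : V) (f : V → F) :
    Integrable f (sliceMeasure T (T v)) ↔ Integrable fun y : kerOf T => f (y + v) := by
  rw [sliceMeasure_eq_map]
  exact (measurableEmbedding_add_const T v).integrable_map_iff

end SliceMeasure

variable [FiniteDimensional ℝ E] [FiniteDimensional ℝ V]

theorem injective_comp_adjoint {T : V →L[ℝ] E} {k : ℝ} (hk : 0 < k)
    (hT : ∀ ζ, k * ‖ζ‖ ^ 2 ≤ ‖ContinuousLinearMap.adjoint T ζ‖ ^ 2) :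
    Function.Injective (T.toLinearMap ∘ₗ (ContinuousLinearMap.adjoint T).toLinearMap) := by
  refine (injective_iff_map_eq_zero _).2 fun ζ hζ => ?_
  have h1 : ‖ContinuousLinearMap.adjoint T ζ‖ ^ 2 = 0 := by
    rw [← real_inner_self_eq_norm_sq, ContinuousLinearMap.adjoint_inner_left]
    have : T (ContinuousLinearMap.adjoint T ζ) = 0 := hζ
    rw [this, inner_zero_right]
  have h2 := hT ζ
  rw [h1] at h2
  have h3 : ‖ζ‖ ^ 2 ≤ 0 := by
    by_contra hneg
    push Not at hneg
    nlinarith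
  exact norm_eq_zero.1 (pow_eq_zero_iff (two_ne_zero) |>.1 (le_antisymm h3 (sq_nonneg _)))

/-- A linear map whose adjoint is bounded below has a right inverse with values in the orthogonal
complement of the kernel, with the corresponding bounds. -/
theorem exists_orthogonal_rightInverse {T : V →L[ℝ] E} {k k' : ℝ} (hk : 0 < k) (hk' : 0 < k')
    (hT : ∀ ζ, k * ‖ζ‖ ^ 2 ≤ ‖ContinuousLinearMap.adjoint T ζ‖ ^ 2)
    (hT' : ∀ ζ, ‖ContinuousLinearMap.adjoint T ζ‖ ^ 2 ≤ k' * ‖ζ‖ ^ 2) :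
    ∃ s : E →L[ℝ] V, (∀ β, T (s β) = β) ∧ (∀ β, ∀ y ∈ kerOf T, ⟪y, s β⟫ = 0) ∧
      (∀ β, k * ‖s β‖ ^ 2 ≤ ‖β‖ ^ 2) ∧ ∀ β, ‖β‖ ^ 2 ≤ k' * ‖s β‖ ^ 2 := by
  set A := ContinuousLinearMap.adjoint T with hA
  set e := LinearEquiv.ofInjectiveEndo _ (injective_comp_adjoint hk hT) with he
  have heA : ∀ ζ, e ζ = T (A ζ) := fun ζ => rfl
  set s : E →L[ℝ] V := A ∘L LinearMap.toContinuousLinearMap e.symm.toLinearMap with hs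
  have hsβ : ∀ β, s β = A (e.symm β) := fun β => rfl
  have hTs : ∀ β, T (s β) = β := fun β => by
    rw [hsβ, ← heA, LinearEquiv.apply_symm_apply]
  refine ⟨s, hTs, fun β y hy => ?_, fun β => ?_, fun β => ?_⟩
  · rw [hsβ, hA, ContinuousLinearMap.adjoint_inner_right]
    have : T y = 0 := hy
    rw [this, inner_zero_left]
  · have h1 : ‖s β‖ ^ 2 ≤ ‖e.symm β‖ * ‖β‖ := by
      rw [← real_inner_self_eq_norm_sq]
      nth_rewrite 1 [hsβ]
      rw [hA, ContinuousLinearMap.adjoint_inner_left, hTs]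
      exact real_inner_le_norm _ _
    have h2 := hT (e.symm β)
    rw [← hsβ] at h2
    have h0 := norm_nonneg (e.symm β)
    rcases h0.eq_or_lt with h0 | h0
    · rw [← h0, zero_mul] at h1
      nlinarith [sq_nonneg ‖β‖]
    have h3 : k * ‖e.symm β‖ ≤ ‖β‖ := by
      by_contra hneg
      push Not at hneg
      nlinarith
    calc k * ‖s β‖ ^ 2 ≤ k * (‖e.symm β‖ * ‖β‖) := by gcongr
      _ = (k * ‖e.symm β‖) * ‖β‖ := by ring
      _ ≤ ‖β‖ * ‖β‖ := by gcongr
      _ = ‖β‖ ^ 2 := by ring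
  · have h1 : ‖β‖ ^ 2 ≤ ‖s β‖ * ‖A β‖ := by
      rw [← real_inner_self_eq_norm_sq]
      nth_rewrite 1 [← hTs β]
      rw [← ContinuousLinearMap.adjoint_inner_right, ← hA]
      exact real_inner_le_norm _ _
    have h2 := hT' β
    have h3 : (‖β‖ ^ 2) ^ 2 ≤ (k' * ‖s β‖ ^ 2) * ‖β‖ ^ 2 := by
      calc (‖β‖ ^ 2) ^ 2 ≤ (‖s β‖ * ‖A β‖) ^ 2 := by gcongr
        _ = ‖s β‖ ^ 2 * ‖A β‖ ^ 2 := by ring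
        _ ≤ ‖s β‖ ^ 2 * (k' * ‖β‖ ^ 2) := by gcongr
        _ = _ := by ring
    rcases (sq_nonneg ‖β‖).eq_or_lt with h0 | h0
    · rw [← h0]; positivity
    · rw [sq (‖β‖ ^ 2)] at h3
      exact le_of_mul_le_mul_right h3 h0

variable [MeasurableSpace E] [BorelSpace E] [MeasurableSpace V] [BorelSpace V]

/-- The linear isomorphism `(β, y) ↦ y + s β` associated to a right inverse `s` of `T`. -/
noncomputable def sliceEquiv (T : V →L[ℝ] E) (s : E →L[ℝ] V) (hs : ∀ β, T (s β) = β) :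
    (E × kerOf T) ≃L[ℝ] V :=
  LinearEquiv.toContinuousLinearEquiv
    { toFun := fun p => (p.2 : V) + s p.1
      map_add' := fun p q => by simp; abel
      map_smul' := fun r p => by simp
      invFun := fun x => (T x, ⟨x - s (T x), by
        change T (x - s (T x)) = 0
        rw [map_sub, hs, sub_self]⟩)
      left_inv := fun p => by
        have h1 : T (p.2 : V) = 0 := p.2.2
        have h2 : T ((p.2 : V) + s p.1) = p.1 := by rw [map_add, h1, hs, zero_add]
        ext
        · exact h2
        · simp [h2]
      right_inv := fun x => by simp }

/-- The coarea formula for a linear map: integrating over the fibres, and then over the base, gives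
a multiple `κ` of the integral over the whole space. -/
theorem exists_integral_integral_slice_eq (T : V →L[ℝ] E) (s : E →L[ℝ] V)
    (hs : ∀ β, T (s β) = β) :
    ∃ κ : ℝ, 0 < κ ∧ (∀ f : V → ℂ, Integrable f →
        Integrable (fun β => ∫ y : kerOf T, f (y + s β)) ∧
        ∫ β, ∫ y : kerOf T, f (y + s β) = κ * ∫ x, f x) := by
  set e := sliceEquiv T s hs
  have hadd : (Measure.map e
      ((volume : Measure E).prod (volume : Measure (kerOf T)))).IsAddHaarMeasure :=
    e.isAddHaarMeasure_map _
  have hc := Measure.isAddLeftInvariant_eq_smul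
    (Measure.map e ((volume : Measure E).prod (volume : Measure (kerOf T)))) (volume : Measure V)
  set c := Measure.addHaarScalarFactor
    (Measure.map e ((volume : Measure E).prod (volume : Measure (kerOf T)))) (volume : Measure V)
  have hc0 : 0 < c := Measure.addHaarScalarFactor_pos_of_isAddHaarMeasure _ _
  have hme : MeasurableEmbedding e := e.toHomeomorph.measurableEmbedding
  refine ⟨c, hc0, fun f hf => ?_⟩
  have h1 : Integrable (fun p : E × kerOf T => f (e p)) ((volume : Measure E).prod volume) := by
    have h2 := hf.smul_measure_nnreal (c := c)
    rw [← hc] at h2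
    exact hme.integrable_map_iff.1 h2
  have h2 : ∫ p : E × kerOf T, f (e p) ∂((volume : Measure E).prod volume) =
      (c : ℝ) * ∫ x, f x := by
    rw [← hme.integral_map, hc, integral_smul_nnreal_measure, NNReal.smul_def, Complex.real_smul]
  refine ⟨h1.integral_prod_left, ?_⟩
  rw [← h2]
  exact (integral_prod _ h1).symm

end Fibre

/-! ### The normalization of the coarea formula -/

section GaussianFactor

variable {E V : Type*} [NormedAddCommGroup E] [InnerProductSpace ℝ E]
  [NormedAddCommGroup V] [InnerProductSpace ℝ V]

theorem norm_add_sq_of_mem_kerOf {T : V →L[ℝ] E} {s : E →L[ℝ] V}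
    (hs : ∀ β, ∀ y ∈ kerOf T, ⟪y, s β⟫ = 0) (β : E) (y : kerOf T) :
    ‖(y : V) + s β‖ ^ 2 = ‖y‖ ^ 2 + ‖s β‖ ^ 2 := by
  rw [norm_add_sq_real, hs β y y.2, Submodule.coe_norm]
  ring

variable [FiniteDimensional ℝ V] [MeasurableSpace V] [BorelSpace V]

theorem integrable_exp_neg_mul_norm_sq {b : ℝ} (hb : 0 < b) :
    Integrable fun v : V => rexp (-b * ‖v‖ ^ 2) := by
  refine Integrable.of_integral_ne_zero ?_
  rw [GaussianFourier.integral_rexp_neg_mul_sq_norm hb]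
  positivity

theorem integral_exp_neg_pi_div_mul_norm_sq {k : ℝ} (hk : 0 < k) :
    ∫ v : V, rexp (-(π / k) * ‖v‖ ^ 2) = √k ^ Module.finrank ℝ V := by
  rw [GaussianFourier.integral_rexp_neg_mul_sq_norm (by positivity),
    show π / (π / k) = k by field_simp, sqrt_eq_rpow, ← rpow_natCast, ← rpow_mul hk.le]
  congr 1
  ring

theorem integral_exp_neg_pi_mul_norm_sq : ∫ v : V, rexp (-π * ‖v‖ ^ 2) = 1 := by
  simpa using integral_exp_neg_pi_div_mul_norm_sq (V := V) one_pos

variable [FiniteDimensional ℝ E] [MeasurableSpace E] [BorelSpace E]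

/-- Testing the coarea formula with a Gaussian bounds its factor. -/
theorem coarea_factor_bounds {T : V →L[ℝ] E} {s : E →L[ℝ] V} {k k' κ : ℝ} (hk : 0 < k)
    (hk' : 0 < k') (horth : ∀ β, ∀ y ∈ kerOf T, ⟪y, s β⟫ = 0)
    (hsk : ∀ β, k * ‖s β‖ ^ 2 ≤ ‖β‖ ^ 2) (hsk' : ∀ β, ‖β‖ ^ 2 ≤ k' * ‖s β‖ ^ 2)
    (hκ : ∀ f : V → ℂ, Integrable f → Integrable (fun β => ∫ y : kerOf T, f (y + s β)) ∧
        ∫ β, ∫ y : kerOf T, f (y + s β) = κ * ∫ x, f x) :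
    √k ^ Module.finrank ℝ E ≤ κ ∧ κ ≤ √k' ^ Module.finrank ℝ E := by
  have h2 := hκ (fun x => ((rexp (-π * ‖x‖ ^ 2) : ℝ) : ℂ))
    (integrable_exp_neg_mul_norm_sq pi_pos).ofReal
  have h3 : ∀ β : E, ∫ y : kerOf T, ((rexp (-π * ‖(y : V) + s β‖ ^ 2) : ℝ) : ℂ) =
      ((rexp (-π * ‖s β‖ ^ 2) : ℝ) : ℂ) := fun β => by
    rw [integral_complex_ofReal]
    congr 1
    simp_rw [norm_add_sq_of_mem_kerOf horth, mul_add, Real.exp_add]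
    rw [integral_mul_const, integral_exp_neg_pi_mul_norm_sq, one_mul]
  simp_rw [h3, integral_complex_ofReal, integral_exp_neg_pi_mul_norm_sq] at h2
  obtain ⟨hint, heq⟩ := h2
  have hint' : Integrable fun β => rexp (-π * ‖s β‖ ^ 2) := hint.re
  have heq' : ∫ β, rexp (-π * ‖s β‖ ^ 2) = κ := by
    rw [Complex.ofReal_one, mul_one] at heq
    exact_mod_cast heq
  rw [← heq', ← integral_exp_neg_pi_div_mul_norm_sq hk, ← integral_exp_neg_pi_div_mul_norm_sq hk']
  constructor
  · refine integral_mono (integrable_exp_neg_mul_norm_sq (by positivity)) hint' fun β => ?_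
    refine Real.exp_le_exp.2 ?_
    have := hsk β
    have h4 : ‖s β‖ ^ 2 ≤ ‖β‖ ^ 2 / k := by rw [le_div_iff₀ hk]; linarith
    have := mul_le_mul_of_nonneg_left h4 pi_pos.le
    rw [neg_mul, neg_mul, div_mul_eq_mul_div, ← mul_div_assoc'] 
    linarith
  · refine integral_mono hint' (integrable_exp_neg_mul_norm_sq (by positivity)) fun β => ?_
    refine Real.exp_le_exp.2 ?_
    have := hsk' β
    have h4 : ‖β‖ ^ 2 / k' ≤ ‖s β‖ ^ 2 := by rw [div_le_iff₀ hk']; linarith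
    have := mul_le_mul_of_nonneg_left h4 pi_pos.le
    rw [neg_mul, neg_mul, div_mul_eq_mul_div, ← mul_div_assoc']
    linarith

end GaussianFactor

/-! ### The product of the tilted densities -/

/-- The density of the product of the tilted measures with fields `σ j`. -/
noncomputable def productDensity (ψ : ℝ → ℝ) {J : ℕ} (σ : Fin J → ℝ)
    (x : EuclideanSpace ℝ (Fin J)) : ℝ :=
  ∏ j, tiltDensity ψ (σ j) (x j)

theorem IsPerturbedQuadratic.exists_tiltDensity_le (h : IsPerturbedQuadratic B ψ) (σ : ℝ) :
    ∃ C : ℝ, 0 < C ∧ ∀ z, tiltDensity ψ σ z ≤ C * rexp (-(1 / 4) * z ^ 2) := by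
  obtain ⟨a, -, ha⟩ := h.tiltDensity_bounds
  refine ⟨rexp (2 * B) * rexp ((σ - a) ^ 2 / 2), by positivity, fun z => ?_⟩
  refine (ha σ z).2.trans ?_
  rw [mul_assoc]
  gcongr
  rw [← Real.exp_add, gaussianPDFReal]
  have h1 : (√(2 * π * (1 : NNReal)))⁻¹ ≤ 1 := by
    refine inv_le_one_of_one_le₀ ?_
    rw [one_le_sqrt]
    have := pi_gt_three
    simp
    linarith
  refine (mul_le_of_le_one_left (exp_nonneg _) h1).trans (Real.exp_le_exp.2 ?_)
  rw [NNReal.coe_one, mul_one]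
  nlinarith [sq_nonneg (z - 2 * (σ - a))]

theorem IsPerturbedQuadratic.exists_productDensity_le (h : IsPerturbedQuadratic B ψ) {J : ℕ}
    (σ : Fin J → ℝ) :
    ∃ C : ℝ, 0 < C ∧ ∀ x, productDensity ψ σ x ≤ C * rexp (-(1 / 4) * ‖x‖ ^ 2) := by
  choose C hC hle using fun j => h.exists_tiltDensity_le (σ j)
  refine ⟨∏ j, C j, Finset.prod_pos fun j _ => hC j, fun x => ?_⟩
  rw [EuclideanSpace.real_norm_sq_eq, Finset.mul_sum, Real.exp_sum, ← Finset.prod_mul_distrib]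
  exact Finset.prod_le_prod (fun _ _ => (tiltDensity_pos _ _).le) fun j _ => hle j _

theorem productDensity_pos {J : ℕ} (σ : Fin J → ℝ) (x : EuclideanSpace ℝ (Fin J)) :
    0 < productDensity ψ σ x :=
  Finset.prod_pos fun _ _ => tiltDensity_pos _ _

theorem IsPerturbedQuadratic.continuous_productDensity (h : IsPerturbedQuadratic B ψ) {J : ℕ}
    (σ : Fin J → ℝ) : Continuous (productDensity ψ σ) :=
  continuous_finsetProd _ fun _ _ => (h.continuous_tiltDensity _).comp (by fun_prop)

theorem IsPerturbedQuadratic.integrable_productDensity (h : IsPerturbedQuadratic B ψ) {J : ℕ}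
    (σ : Fin J → ℝ) : Integrable (productDensity ψ σ) := by
  obtain ⟨C, hC, hle⟩ := h.exists_productDensity_le σ
  refine ((integrable_exp_neg_mul_norm_sq (by norm_num : (0 : ℝ) < 1 / 4)).const_mul C).mono'
    (h.continuous_productDensity σ).aestronglyMeasurable (Filter.Eventually.of_forall fun x => ?_)
  rw [norm_of_nonneg (productDensity_pos σ x).le]
  exact hle x

theorem integral_euclideanSpace_prod {J : ℕ} (g : Fin J → ℝ → ℂ) :
    ∫ x : EuclideanSpace ℝ (Fin J), ∏ j, g j (x j) = ∏ j, ∫ z, g j z := by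
  rw [← integral_fintype_prod_volume_eq_prod]
  exact (EuclideanSpace.volume_preserving_symm_measurableEquiv_toLp (Fin J)).integral_comp'
    (fun x : Fin J → ℝ => ∏ j, g j (x j))

theorem IsPerturbedQuadratic.integral_cexp_mul_tiltDensity (h : IsPerturbedQuadratic B ψ)
    (σ t : ℝ) : ∫ z : ℝ, Complex.exp (t * z * Complex.I) * tiltDensity ψ σ z =
      Complex.exp (t * tiltMean ψ σ * Complex.I) * siteChar ψ σ t := by
  rw [siteChar, integral_tilt h, ← integral_const_mul]
  refine integral_congr_ae (Filter.Eventually.of_forall fun z => ?_)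
  simp only [Complex.real_smul]
  rw [mul_left_comm, ← Complex.exp_add, mul_comm]
  congr 2
  push_cast
  ring

/-- Multiplying by a slowly varying exponential reduces the characteristic function of the product
measure to the centred ones of the factors. -/
theorem IsPerturbedQuadratic.integral_cexp_mul_productDensity (h : IsPerturbedQuadratic B ψ)
    {J : ℕ} (σ t : Fin J → ℝ) :
    ∫ x : EuclideanSpace ℝ (Fin J),
      Complex.exp ((∑ j, t j * x j : ℝ) * Complex.I) * productDensity ψ σ x =
      Complex.exp ((∑ j, t j * tiltMean ψ (σ j) : ℝ) * Complex.I) *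
        ∏ j, siteChar ψ (σ j) (t j) := by
  have h1 : ∀ x : EuclideanSpace ℝ (Fin J),
      Complex.exp ((∑ j, t j * x j : ℝ) * Complex.I) * productDensity ψ σ x =
      ∏ j, Complex.exp (t j * x j * Complex.I) * tiltDensity ψ (σ j) (x j) := fun x => by
    rw [Finset.prod_mul_distrib, ← Complex.exp_sum, productDensity]
    push_cast
    rw [Finset.sum_mul]
  simp_rw [h1]
  rw [integral_euclideanSpace_prod fun j z =>
    Complex.exp (t j * z * Complex.I) * tiltDensity ψ (σ j) z]
  simp_rw [h.integral_cexp_mul_tiltDensity]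
  rw [Finset.prod_mul_distrib, ← Complex.exp_sum]
  push_cast
  rw [Finset.sum_mul]

open scoped ContDiff FourierTransform

/-! ### The partition function on a fibre -/

section BlockVec

variable {E : Type*} [NormedAddCommGroup E] [InnerProductSpace ℝ E]

/-- The vectors `J T e_j`, so that `J Tᵗ η` has the coordinates `⟪J T e_j, η⟫`. -/
noncomputable def blockVec {J : ℕ} (T : EuclideanSpace ℝ (Fin J) →L[ℝ] E) (j : Fin J) : E :=
  (J : ℝ) • T (EuclideanSpace.single j 1)

/-- The mean of `T x` under the product of the tilted measures with fields `⟪a j, η⟫`. -/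
noncomputable def blockMean (ψ : ℝ → ℝ) {J : ℕ} (a : Fin J → E) (η : E) : E :=
  (1 / (J : ℝ)) • ∑ j, tiltMean ψ ⟪a j, η⟫ • a j

/-- The log moment generating function per site with fields `⟪a j, η⟫`. -/
noncomputable def blockLogMGF (ψ : ℝ → ℝ) {J : ℕ} (a : Fin J → E) (η : E) : ℝ :=
  (1 / (J : ℝ)) * ∑ j, logMGF ψ ⟪a j, η⟫

theorem natCast_mul_inner_apply {J : ℕ} (T : EuclideanSpace ℝ (Fin J) →L[ℝ] E)
    (x : EuclideanSpace ℝ (Fin J)) (ζ : E) :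
    (J : ℝ) * ⟪T x, ζ⟫ = ∑ j, ⟪blockVec T j, ζ⟫ * x j := by
  have h1 : x = ∑ j, x j • EuclideanSpace.single j (1 : ℝ) := by
    ext i
    simp [Finset.sum_apply, Pi.single_apply]
  conv_lhs => rw [h1]
  rw [map_sum, sum_inner, Finset.mul_sum]
  refine Finset.sum_congr rfl fun j _ => ?_
  rw [blockVec, map_smul, real_inner_smul_left, real_inner_smul_left]
  ring

theorem productDensity_eq {J : ℕ} (hJ : 0 < J) (T : EuclideanSpace ℝ (Fin J) →L[ℝ] E) (η : E)
    (x : EuclideanSpace ℝ (Fin J)) :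
    productDensity ψ (fun j => ⟪blockVec T j, η⟫) x =
      rexp (J * (⟪T x, η⟫ - blockLogMGF ψ (blockVec T) η)) * rexp (-hamiltonian ψ x) := by
  have hJ' : (0 : ℝ) < J := by exact_mod_cast hJ
  have h1 : (J : ℝ) * blockLogMGF ψ (blockVec T) η = ∑ j, logMGF ψ ⟪blockVec T j, η⟫ := by
    rw [blockLogMGF]; field_simp
  rw [mul_sub, natCast_mul_inner_apply, h1, ← Real.exp_add, productDensity]
  simp_rw [tiltDensity]
  rw [← Real.exp_sum, hamiltonian, Finset.sum_sub_distrib, Finset.sum_sub_distrib]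
  congr 1
  ring

theorem sum_siteFreq_mul {J : ℕ} (hJ : 0 < J) (a : Fin J → E) (ξ : E) (x : Fin J → ℝ) :
    ∑ j, siteFreq a ((√J)⁻¹ • ξ) j * x j = -2 * π * (1 / (J : ℝ) * ∑ j, ⟪a j, ξ⟫ * x j) := by
  have hJ' : (0 : ℝ) < J := by exact_mod_cast hJ
  rw [Finset.mul_sum, Finset.mul_sum]
  refine Finset.sum_congr rfl fun j _ => ?_
  rw [siteFreq, real_inner_smul_right]
  have h1 : √(J : ℝ) * √J = J := mul_self_sqrt hJ'.le
  have h2 : 0 < √(J : ℝ) := sqrt_pos.2 hJ'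
  have h3 : (√(J : ℝ))⁻¹ / √J = 1 / J := by
    rw [inv_eq_one_div, div_div, h1]
  calc -(2 * π / √(J : ℝ) * ((√(J : ℝ))⁻¹ * ⟪a j, ξ⟫)) * x j
      = -(2 * π * ((√(J : ℝ))⁻¹ / √J) * ⟪a j, ξ⟫) * x j := by ring
    _ = _ := by rw [h3]; ring

variable [FiniteDimensional ℝ E]

theorem natCast_mul_adjoint_apply {J : ℕ} (T : EuclideanSpace ℝ (Fin J) →L[ℝ] E) (η : E)
    (j : Fin J) : (J : ℝ) * ContinuousLinearMap.adjoint T η j = ⟪blockVec T j, η⟫ := by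
  rw [blockVec, real_inner_smul_left, ← ContinuousLinearMap.adjoint_inner_right,
    EuclideanSpace.inner_single_left]
  simp

theorem norm_adjoint_sq_eq {J : ℕ} (hJ : 0 < J) (T : EuclideanSpace ℝ (Fin J) →L[ℝ] E) (ζ : E) :
    ‖ContinuousLinearMap.adjoint T ζ‖ ^ 2 =
      1 / (J : ℝ) * (1 / (J : ℝ) * ∑ j, ⟪blockVec T j, ζ⟫ ^ 2) := by
  have hJ' : (0 : ℝ) < J := by exact_mod_cast hJ
  simp_rw [← natCast_mul_adjoint_apply, mul_pow]
  rw [EuclideanSpace.real_norm_sq_eq, ← Finset.mul_sum]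
  field_simp

end BlockVec

section Fibre

variable {E : Type*} [NormedAddCommGroup E] [InnerProductSpace ℝ E] [FiniteDimensional ℝ E]
  [MeasurableSpace E] [BorelSpace E]

/-- The Fourier transform of the fibre integrals of the product density. -/
theorem IsPerturbedQuadratic.fourier_slice (h : IsPerturbedQuadratic B ψ) {J : ℕ} (hJ : 0 < J)
    {T : EuclideanSpace ℝ (Fin J) →L[ℝ] E} {s : E →L[ℝ] EuclideanSpace ℝ (Fin J)} {κ : ℝ}
    (hs : ∀ β, T (s β) = β)
    (hκ : ∀ f : EuclideanSpace ℝ (Fin J) → ℂ, Integrable f →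
      Integrable (fun β => ∫ y : kerOf T, f (y + s β)) ∧
        ∫ β, ∫ y : kerOf T, f (y + s β) = κ * ∫ x, f x) (η ξ : E) :
    𝓕 (fun β => ∫ y : kerOf T,
        (productDensity ψ (fun j => ⟪blockVec T j, η⟫)
          ((y : EuclideanSpace ℝ (Fin J)) + s β) : ℂ)) ξ =
      κ * (Complex.exp ((-2 * π * ⟪blockMean ψ (blockVec T) η, ξ⟫ : ℝ) * Complex.I) *
        blockChar ψ (blockVec T) ((√J)⁻¹ • ξ) η) := by
  have hJ' : (0 : ℝ) < J := by exact_mod_cast hJ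
  set σ : Fin J → ℝ := fun j => ⟪blockVec T j, η⟫ with hσ
  set t : Fin J → ℝ := siteFreq (blockVec T) ((√J)⁻¹ • ξ) with ht
  have h1 : ∀ x : EuclideanSpace ℝ (Fin J), ∑ j, t j * x j = -2 * π * ⟪T x, ξ⟫ := fun x => by
    rw [ht, sum_siteFreq_mul hJ, ← natCast_mul_inner_apply]
    field_simp
  have h2 : ∑ j, t j * tiltMean ψ (σ j) = -2 * π * ⟪blockMean ψ (blockVec T) η, ξ⟫ := by
    rw [ht, sum_siteFreq_mul hJ, blockMean, real_inner_smul_left, sum_inner]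
    simp_rw [real_inner_smul_left, mul_comm (tiltMean _ _), hσ]
  have hint : Integrable fun x : EuclideanSpace ℝ (Fin J) =>
      Complex.exp ((∑ j, t j * x j : ℝ) * Complex.I) * productDensity ψ σ x := by
    refine (h.integrable_productDensity σ).ofReal.bdd_mul (c := 1) ?_ ?_
    · exact (by fun_prop : Continuous fun x : EuclideanSpace ℝ (Fin J) =>
        Complex.exp ((∑ j, t j * x j : ℝ) * Complex.I)).aestronglyMeasurable
    · exact Filter.Eventually.of_forall fun x => (Complex.norm_exp_ofReal_mul_I _).le
  have h3 := (hκ _ hint).2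
  rw [h.integral_cexp_mul_productDensity, h2] at h3
  rw [Real.fourier_eq', blockChar, ← ht, ← h3]
  refine integral_congr_ae (Filter.Eventually.of_forall fun β => ?_)
  simp only [smul_eq_mul]
  rw [← integral_const_mul]
  refine integral_congr_ae (Filter.Eventually.of_forall fun y => ?_)
  have hy : T (y : EuclideanSpace ℝ (Fin J)) = 0 := y.2
  simp only [h1]
  rw [map_add, hy, hs, zero_add]

/-- Fourier inversion expresses the fibre integral over the mean as an integral of the centred
characteristic function. -/
theorem IsPerturbedQuadratic.integral_slice_productDensity (h : IsPerturbedQuadratic B ψ) {J : ℕ}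
    (hJ : 0 < J) {T : EuclideanSpace ℝ (Fin J) →L[ℝ] E} {s : E →L[ℝ] EuclideanSpace ℝ (Fin J)}
    {κ : ℝ} (hs : ∀ β, T (s β) = β) (horth : ∀ β, ∀ y ∈ kerOf T, ⟪y, s β⟫ = 0)
    (hκ : ∀ f : EuclideanSpace ℝ (Fin J) → ℂ, Integrable f →
      Integrable (fun β => ∫ y : kerOf T, f (y + s β)) ∧
        ∫ β, ∫ y : kerOf T, f (y + s β) = κ * ∫ x, f x) (η : E)
    (hchar : Integrable fun ζ => blockChar ψ (blockVec T) ζ η) (β₀ : E)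
    (hβ₀ : β₀ = blockMean ψ (blockVec T) η) :
    ∫ y : kerOf T,
        productDensity ψ (fun j => ⟪blockVec T j, η⟫) ((y : EuclideanSpace ℝ (Fin J)) + s β₀) =
      κ * √J ^ Module.finrank ℝ E * blockDensity ψ (blockVec T) η := by
  have hJ' : (0 : ℝ) < J := by exact_mod_cast hJ
  have hsJ : 0 < √(J : ℝ) := sqrt_pos.2 hJ'
  set σ : Fin J → ℝ := fun j => ⟪blockVec T j, η⟫ with hσ
  set F : E → ℂ := fun β => ∫ y : kerOf T,
    (productDensity ψ σ ((y : EuclideanSpace ℝ (Fin J)) + s β) : ℂ) with hF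
  have hFint : Integrable F := (hκ _ (h.integrable_productDensity σ).ofReal).1
  obtain ⟨C, hC, hle⟩ := h.exists_productDensity_le σ
  have hFcont : Continuous F := by
    refine continuous_of_dominated (bound := fun y => C * rexp (-(1 / 4) * ‖y‖ ^ 2))
      (fun β => ?_) (fun β => Filter.Eventually.of_forall fun y => ?_)
      ((integrable_exp_neg_mul_norm_sq (by norm_num)).const_mul C)
      (Filter.Eventually.of_forall fun y => ?_)
    · exact (Complex.continuous_ofReal.comp
        ((h.continuous_productDensity σ).comp (by fun_prop))).aestronglyMeasurable
    · rw [Complex.norm_real, norm_of_nonneg (productDensity_pos σ _).le]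
      refine (hle _).trans ?_
      rw [norm_add_sq_of_mem_kerOf horth]
      gcongr C * rexp ?_
      nlinarith [sq_nonneg ‖s β‖]
    · exact Complex.continuous_ofReal.comp ((h.continuous_productDensity σ).comp (by fun_prop))
  have hFour : 𝓕 F = fun ξ => κ * (Complex.exp
      ((-2 * π * ⟪blockMean ψ (blockVec T) η, ξ⟫ : ℝ) * Complex.I) *
        blockChar ψ (blockVec T) ((√J)⁻¹ • ξ) η) :=
    funext fun ξ => h.fourier_slice hJ hs hκ η ξ
  have hchar' : Integrable fun ξ => blockChar ψ (blockVec T) ((√J)⁻¹ • ξ) η :=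
    hchar.comp_smul (inv_ne_zero hsJ.ne')
  have hFourInt : Integrable (𝓕 F) := by
    rw [hFour]
    refine (hchar'.bdd_mul (c := 1) ?_ ?_).const_mul _
    · exact (by fun_prop : Continuous fun ξ : E => Complex.exp
        ((-2 * π * ⟪blockMean ψ (blockVec T) η, ξ⟫ : ℝ) * Complex.I)).aestronglyMeasurable
    · exact Filter.Eventually.of_forall fun x => (Complex.norm_exp_ofReal_mul_I _).le
  have hinv := congrFun (hFcont.fourierInv_fourier_eq hFint hFourInt) β₀
  rw [Real.fourierInv_eq', hFour] at hinv
  have h1 : ∀ ξ : E, Complex.exp (((2 * π * ⟪ξ, β₀⟫ : ℝ) : ℂ) * Complex.I) •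
      ((κ : ℂ) * (Complex.exp ((-2 * π * ⟪blockMean ψ (blockVec T) η, ξ⟫ : ℝ) * Complex.I) *
        blockChar ψ (blockVec T) ((√J)⁻¹ • ξ) η)) =
      κ * blockChar ψ (blockVec T) ((√J)⁻¹ • ξ) η := fun ξ => by
    rw [smul_eq_mul, mul_left_comm, ← mul_assoc (Complex.exp _), ← Complex.exp_add, ← add_mul,
      ← Complex.ofReal_add, hβ₀, real_inner_comm]
    simp
  simp_rw [h1] at hinv
  rw [integral_const_mul, Measure.integral_comp_inv_smul_of_nonneg volume
    (fun ζ => blockChar ψ (blockVec T) ζ η) hsJ.le, hF] at hinv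
  simp only at hinv
  rw [integral_complex_ofReal] at hinv
  have h2 := congrArg Complex.re hinv
  rw [Complex.ofReal_re, Complex.re_ofReal_mul, Complex.smul_re] at h2
  rw [← h2, blockDensity, smul_eq_mul]
  ring

/-- The partition function on a fibre: at the mean for the field `η` it is the product of the
exponential of the Legendre transform and of `blockDensity`, up to a factor of order one that
depends on neither the potential nor the fibre. -/
theorem exists_integral_slice_eq {J : ℕ} (hJ : 0 < J) {K c : ℝ} (hK : 0 < K) (hc : 0 < c)
    (T : EuclideanSpace ℝ (Fin J) →L[ℝ] E) (hT : IsBlockFrame K c (blockVec T)) :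
    ∃ θ : ℝ, √c ^ Module.finrank ℝ E ≤ θ ∧ θ ≤ K ^ Module.finrank ℝ E ∧
      ∀ (B : ℝ) (ψ : ℝ → ℝ), IsPerturbedQuadratic B ψ → ∀ η : E,
        (Integrable fun ζ => blockChar ψ (blockVec T) ζ η) →
        Integrable (fun x => rexp (-hamiltonian ψ x))
          (sliceMeasure T (blockMean ψ (blockVec T) η)) ∧
        ∫ x, rexp (-hamiltonian ψ x) ∂(sliceMeasure T (blockMean ψ (blockVec T) η)) =
          rexp (-(J * (⟪blockMean ψ (blockVec T) η, η⟫ - blockLogMGF ψ (blockVec T) η))) *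
            (θ * blockDensity ψ (blockVec T) η) := by
  have hJ' : (0 : ℝ) < J := by exact_mod_cast hJ
  have hsJ : 0 < √(J : ℝ) := sqrt_pos.2 hJ'
  obtain ⟨s, hs, horth, hsk, hsk'⟩ := exists_orthogonal_rightInverse (T := T) (k := c / J)
    (k' := K ^ 2 / J) (by positivity) (by positivity) (fun ζ => by
      rw [norm_adjoint_sq_eq hJ, show c / (J : ℝ) * ‖ζ‖ ^ 2 = 1 / J * (c * ‖ζ‖ ^ 2) by ring]
      exact mul_le_mul_of_nonneg_left (hT.2 ζ) (one_div_nonneg.2 hJ'.le)) (fun ζ => by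
      rw [norm_adjoint_sq_eq hJ, show K ^ 2 / (J : ℝ) * ‖ζ‖ ^ 2 = 1 / J * (K ^ 2 * ‖ζ‖ ^ 2) by ring]
      refine mul_le_mul_of_nonneg_left ?_ (one_div_nonneg.2 hJ'.le)
      calc 1 / (J : ℝ) * ∑ j, ⟪blockVec T j, ζ⟫ ^ 2
          ≤ 1 / (J : ℝ) * ∑ _j : Fin J, K ^ 2 * ‖ζ‖ ^ 2 := by
            gcongr with j _
            exact hT.inner_sq_le ζ j
        _ = K ^ 2 * ‖ζ‖ ^ 2 := by
            rw [Finset.sum_const, Finset.card_univ, Fintype.card_fin, nsmul_eq_mul]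
            field_simp)
  obtain ⟨κ, hκ0, hκ⟩ := exists_integral_integral_slice_eq T s hs
  obtain ⟨hκ1, hκ2⟩ := coarea_factor_bounds (k := c / J) (k' := K ^ 2 / J) (by positivity)
    (by positivity) horth hsk hsk' hκ
  refine ⟨κ * √J ^ Module.finrank ℝ E, ?_, ?_, fun B ψ h η hchar => ?_⟩
  · rw [sqrt_div hc.le, div_pow] at hκ1
    rwa [← div_le_iff₀ (by positivity)]
  · rw [sqrt_div (by positivity), sqrt_sq hK.le, div_pow] at hκ2
    rwa [← le_div_iff₀ (by positivity)]
  · have hTs := hs (blockMean ψ (blockVec T) η)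
    set β := blockMean ψ (blockVec T) η with hβ
    set σ : Fin J → ℝ := fun j => ⟪blockVec T j, η⟫ with hσ
    have hmain := h.integral_slice_productDensity hJ hs horth hκ η hchar β hβ
    have h1 : ∀ y : kerOf T, rexp (-hamiltonian ψ ((y : EuclideanSpace ℝ (Fin J)) + s β)) =
        rexp (-(J * (⟪β, η⟫ - blockLogMGF ψ (blockVec T) η))) *
          productDensity ψ σ ((y : EuclideanSpace ℝ (Fin J)) + s β) := fun y => by
      have hy : T (y : EuclideanSpace ℝ (Fin J)) = 0 := y.2
      rw [hσ, productDensity_eq hJ, map_add, hy, hTs, zero_add, ← mul_assoc, ← Real.exp_add,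
        neg_add_cancel, Real.exp_zero, one_mul]
    have hint : Integrable fun y : kerOf T =>
        productDensity ψ σ ((y : EuclideanSpace ℝ (Fin J)) + s β) := by
      obtain ⟨C, hC, hle⟩ := h.exists_productDensity_le σ
      refine ((integrable_exp_neg_mul_norm_sq
        (by norm_num : (0 : ℝ) < 1 / 4)).const_mul C).mono' ?_
        (Filter.Eventually.of_forall fun y => ?_)
      · exact ((h.continuous_productDensity σ).comp (by fun_prop)).aestronglyMeasurable
      · rw [norm_of_nonneg (productDensity_pos σ _).le]
        refine (hle _).trans ?_
        rw [norm_add_sq_of_mem_kerOf horth]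
        gcongr C * rexp ?_
        nlinarith [sq_nonneg ‖s β‖]
    rw [← hTs, integrable_sliceMeasure_iff, integral_sliceMeasure, hTs]
    simp_rw [h1]
    refine ⟨hint.const_mul _, ?_⟩
    rw [integral_const_mul, hmain]

end Fibre

/-! ### Legendre transforms of uniformly convex functions -/

section Legendre

variable {E : Type*} [NormedAddCommGroup E] [InnerProductSpace ℝ E]

/-- The map `b` is of class `C²`, its derivative is bounded below by `k` in the sense of quadratic
forms, and the norms of its first two derivatives are bounded by `k₁` and `k₂`. -/
structure IsMonotoneField (k k₁ k₂ : ℝ) (b : E → E) : Prop where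
  pos : 0 < k
  pos₁ : 0 < k₁
  nonneg₂ : 0 ≤ k₂
  contDiff : ContDiff ℝ 2 b
  le_inner : ∀ η v, k * ‖v‖ ^ 2 ≤ ⟪fderiv ℝ b η v, v⟫
  norm_fderiv_le : ∀ η, ‖fderiv ℝ b η‖ ≤ k₁
  norm_fderiv_fderiv_le : ∀ η, ‖fderiv ℝ (fderiv ℝ b) η‖ ≤ k₂

namespace IsMonotoneField

variable {k k₁ k₂ : ℝ} {b : E → E}

theorem differentiable (hb : IsMonotoneField k k₁ k₂ b) : Differentiable ℝ b :=
  hb.contDiff.differentiable (by norm_num)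

theorem mul_norm_le (hb : IsMonotoneField k k₁ k₂ b) (η v : E) :
    k * ‖v‖ ≤ ‖fderiv ℝ b η v‖ := by
  have h1 := (hb.le_inner η v).trans (real_inner_le_norm _ _)
  rcases (norm_nonneg v).eq_or_lt with h0 | h0
  · rw [← h0, mul_zero]; exact norm_nonneg _
  · rw [sq, ← mul_assoc] at h1
    exact le_of_mul_le_mul_right h1 h0

theorem hasDerivAt_inner_line (hb : IsMonotoneField k k₁ k₂ b) (y v : E) (t : ℝ) :
    HasDerivAt (fun t : ℝ => ⟪b (y + t • v), v⟫) ⟪fderiv ℝ b (y + t • v) v, v⟫ t := by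
  have h1 : HasDerivAt (fun t : ℝ => y + t • v) v t := by
    simpa using ((hasDerivAt_id t).smul_const v).const_add y
  have h2 := (hb.differentiable (y + t • v)).hasFDerivAt.comp_hasDerivAt t h1
  simpa using h2.inner ℝ (hasDerivAt_const t v)

theorem strongly_monotone (hb : IsMonotoneField k k₁ k₂ b) (x y : E) :
    k * ‖x - y‖ ^ 2 ≤ ⟪b x - b y, x - y⟫ := by
  have h1 : ∀ t, HasDerivAt (fun t : ℝ => ⟪b (y + t • (x - y)), x - y⟫) _ t :=
    hb.hasDerivAt_inner_line y (x - y)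
  have h2 := convex_univ.mul_sub_le_image_sub_of_le_deriv
    (f := fun t : ℝ => ⟪b (y + t • (x - y)), x - y⟫) (C := k * ‖x - y‖ ^ 2)
    (fun t _ => (h1 t).continuousAt.continuousWithinAt)
    (fun t _ => (h1 t).differentiableAt.differentiableWithinAt)
    (fun t _ => by rw [(h1 t).deriv]; exact hb.le_inner _ _) 0 (mem_univ _) 1 (mem_univ _)
    zero_le_one
  simpa [inner_sub_left] using h2

theorem antilipschitz (hb : IsMonotoneField k k₁ k₂ b) :
    AntilipschitzWith (Real.toNNReal k⁻¹) b := by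
  refine AntilipschitzWith.of_le_mul_dist fun x y => ?_
  have h1 := (hb.strongly_monotone x y).trans (real_inner_le_norm _ _)
  rw [Real.coe_toNNReal _ (inv_nonneg.2 hb.pos.le), dist_eq_norm, dist_eq_norm,
    inv_mul_eq_div, le_div_iff₀ hb.pos]
  rcases (norm_nonneg (x - y)).eq_or_lt with h0 | h0
  · rw [← h0, zero_mul]; exact norm_nonneg _
  · rw [sq, ← mul_assoc] at h1
    linarith [le_of_mul_le_mul_right h1 h0]

theorem add_inner_le (hb : IsMonotoneField k k₁ k₂ b) {S : E → ℝ}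
    (hS : ∀ η, HasFDerivAt S (innerSL ℝ (b η)) η) (x y : E) :
    S y + ⟪b y, x - y⟫ ≤ S x := by
  have h1 : ∀ t : ℝ, HasDerivAt (fun t : ℝ => S (y + t • (x - y)) - t * ⟪b y, x - y⟫)
      (⟪b (y + t • (x - y)), x - y⟫ - ⟪b y, x - y⟫) t := fun t => by
    have h2 : HasDerivAt (fun t : ℝ => y + t • (x - y)) (x - y) t := by
      simpa using ((hasDerivAt_id t).smul_const (x - y)).const_add y
    have h3 := (hS (y + t • (x - y))).comp_hasDerivAt t h2
    exact (h3.sub ((hasDerivAt_id t).mul_const ⟪b y, x - y⟫)).congr_deriv (by simp)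
  have h2 : MonotoneOn (fun t : ℝ => S (y + t • (x - y)) - t * ⟪b y, x - y⟫) (Icc 0 1) := by
    refine monotoneOn_of_deriv_nonneg (convex_Icc 0 1)
      (fun t _ => (h1 t).continuousAt.continuousWithinAt)
      (fun t _ => (h1 t).differentiableAt.differentiableWithinAt) fun t ht => ?_
    rw [interior_Icc] at ht
    rw [(h1 t).deriv, ← inner_sub_left]
    have h3 := hb.strongly_monotone (y + t • (x - y)) y
    rw [add_sub_cancel_left, real_inner_smul_right] at h3
    have h4 : 0 ≤ t * ⟪b (y + t • (x - y)) - b y, x - y⟫ :=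
      (mul_nonneg hb.pos.le (sq_nonneg _)).trans h3
    exact nonneg_of_mul_nonneg_right h4 ht.1
  have h3 := h2 (left_mem_Icc.2 zero_le_one) (right_mem_Icc.2 zero_le_one) zero_le_one
  simp only [zero_smul, add_zero, zero_mul, sub_zero, one_smul, one_mul,
    add_sub_cancel] at h3
  linarith

variable [FiniteDimensional ℝ E]

/-- The derivative of a monotone field as a continuous linear equivalence. -/
noncomputable def fderivEquiv (hb : IsMonotoneField k k₁ k₂ b) (η : E) : E ≃L[ℝ] E :=
  (LinearEquiv.ofInjectiveEndo (fderiv ℝ b η).toLinearMap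
    ((injective_iff_map_eq_zero _).2 fun v hv => by
      have h1 := hb.mul_norm_le η v
      have h2 : fderiv ℝ b η v = 0 := hv
      rw [h2, norm_zero] at h1
      exact norm_le_zero_iff.1 (nonpos_of_mul_nonpos_right h1 hb.pos))).toContinuousLinearEquiv

theorem coe_fderivEquiv (hb : IsMonotoneField k k₁ k₂ b) (η : E) :
    (hb.fderivEquiv η : E →L[ℝ] E) = fderiv ℝ b η := by
  ext v
  rfl

theorem hasFDerivAt_fderivEquiv (hb : IsMonotoneField k k₁ k₂ b) (η : E) :
    HasFDerivAt b (hb.fderivEquiv η : E →L[ℝ] E) η := by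
  rw [coe_fderivEquiv]
  exact (hb.differentiable η).hasFDerivAt

theorem isClosedEmbedding (hb : IsMonotoneField k k₁ k₂ b) : Topology.IsClosedEmbedding b := by
  refine hb.antilipschitz.isClosedEmbedding ?_
  refine (lipschitzWith_of_nnnorm_fderiv_le (C := Real.toNNReal k₁) hb.differentiable
    fun η => ?_).uniformContinuous
  rw [← NNReal.coe_le_coe, Real.coe_toNNReal _ hb.pos₁.le]
  exact hb.norm_fderiv_le η

/-- The range is closed as the field is antilipschitz, and open by the inverse function theorem. -/
theorem surjective (hb : IsMonotoneField k k₁ k₂ b) : Function.Surjective b := by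
  have h1 : IsOpen (range b) := by
    refine (isOpenMap_iff_nhds_le.2 fun η => ?_).isOpen_range
    have h2 : HasStrictFDerivAt b (hb.fderivEquiv η : E →L[ℝ] E) η := by
      rw [coe_fderivEquiv]
      exact hb.contDiff.contDiffAt.hasStrictFDerivAt (by norm_num)
    exact h2.map_nhds_eq_of_equiv.ge
  exact range_eq_univ.1 (IsClopen.eq_univ ⟨hb.isClosedEmbedding.isClosed_range, h1⟩
    (range_nonempty b))

/-- A monotone field as a homeomorphism. -/
noncomputable def homeomorph (hb : IsMonotoneField k k₁ k₂ b) : E ≃ₜ E :=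
  (Equiv.ofBijective b ⟨hb.isClosedEmbedding.injective, hb.surjective⟩).toHomeomorphOfIsInducing
    hb.isClosedEmbedding.isInducing

/-- The inverse of a monotone field. -/
noncomputable def inverse (hb : IsMonotoneField k k₁ k₂ b) : E → E := hb.homeomorph.symm

theorem apply_inverse (hb : IsMonotoneField k k₁ k₂ b) (β : E) : b (hb.inverse β) = β :=
  hb.homeomorph.apply_symm_apply β

theorem contDiff_inverse (hb : IsMonotoneField k k₁ k₂ b) : ContDiff ℝ 2 hb.inverse :=
  hb.homeomorph.contDiff_symm hb.hasFDerivAt_fderivEquiv hb.contDiff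

theorem differentiable_inverse (hb : IsMonotoneField k k₁ k₂ b) : Differentiable ℝ hb.inverse :=
  hb.contDiff_inverse.differentiable (by norm_num)

theorem fderiv_apply_fderiv_inverse (hb : IsMonotoneField k k₁ k₂ b) (β v : E) :
    fderiv ℝ b (hb.inverse β) (fderiv ℝ hb.inverse β v) = v := by
  have h1 := (hb.differentiable (hb.inverse β)).hasFDerivAt.comp β
    (hb.differentiable_inverse β).hasFDerivAt
  have h2 : b ∘ hb.inverse = id := funext hb.apply_inverse
  rw [h2] at h1
  exact congrArg (fun A : E →L[ℝ] E => A v) (h1.unique (hasFDerivAt_id β))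

theorem norm_fderiv_inverse_apply_le (hb : IsMonotoneField k k₁ k₂ b) (β v : E) :
    ‖fderiv ℝ hb.inverse β v‖ ≤ k⁻¹ * ‖v‖ := by
  have h1 := hb.mul_norm_le (hb.inverse β) (fderiv ℝ hb.inverse β v)
  rw [fderiv_apply_fderiv_inverse] at h1
  rw [inv_mul_eq_div, le_div_iff₀ hb.pos]
  linarith

theorem norm_fderiv_inverse_le (hb : IsMonotoneField k k₁ k₂ b) (β : E) :
    ‖fderiv ℝ hb.inverse β‖ ≤ k⁻¹ :=
  ContinuousLinearMap.opNorm_le_bound _ (inv_nonneg.2 hb.pos.le) (hb.norm_fderiv_inverse_apply_le β)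

/-- Differentiating `b'(g) g' = id` controls the second derivative of the inverse `g`. -/
theorem norm_fderiv_fderiv_inverse_le (hb : IsMonotoneField k k₁ k₂ b) (β : E) :
    ‖fderiv ℝ (fderiv ℝ hb.inverse) β‖ ≤ k⁻¹ ^ 3 * k₂ := by
  have hk := inv_nonneg.2 hb.pos.le
  have hk₂ := hb.nonneg₂
  refine ContinuousLinearMap.opNorm_le_bound _ (by positivity) fun w => ?_
  refine ContinuousLinearMap.opNorm_le_bound _ (by positivity) fun v => ?_
  have hd1 : Differentiable ℝ (fderiv ℝ hb.inverse) :=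
    (hb.contDiff_inverse.fderiv_right (m := 1) (by norm_num)).differentiable (by norm_num)
  have hd2 : Differentiable ℝ (fderiv ℝ b) :=
    (hb.contDiff.fderiv_right (m := 1) (by norm_num)).differentiable (by norm_num)
  have h1 := ((hd2 (hb.inverse β)).hasFDerivAt.comp β
    (hb.differentiable_inverse β).hasFDerivAt).clm_apply
      ((hd1 β).hasFDerivAt.clm_apply (hasFDerivAt_const v β))
  have h2 : (fun y => ((fderiv ℝ b ∘ hb.inverse) y) (fderiv ℝ hb.inverse y v)) = fun _ => v :=
    funext fun y => hb.fderiv_apply_fderiv_inverse y v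
  rw [h2] at h1
  have h3 := congrArg (fun A : E →L[ℝ] E => A w) (h1.unique (hasFDerivAt_const v β))
  simp at h3
  have h4 : ‖fderiv ℝ b (hb.inverse β) (fderiv ℝ (fderiv ℝ hb.inverse) β w v)‖ ≤
      k₂ * (k⁻¹ * ‖w‖) * (k⁻¹ * ‖v‖) := by
    rw [eq_neg_of_add_eq_zero_left h3, norm_neg]
    refine (ContinuousLinearMap.le_opNorm₂ _ _ _).trans ?_
    gcongr
    · exact hb.norm_fderiv_fderiv_le _
    · exact hb.norm_fderiv_inverse_apply_le β w
    · exact hb.norm_fderiv_inverse_apply_le β v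
  have h5 := (hb.mul_norm_le _ _).trans h4
  have h6 : ‖fderiv ℝ (fderiv ℝ hb.inverse) β w v‖ ≤
      k⁻¹ * (k₂ * (k⁻¹ * ‖w‖) * (k⁻¹ * ‖v‖)) := by
    rw [inv_mul_eq_div, le_div_iff₀ hb.pos]
    linarith
  refine h6.trans (le_of_eq ?_)
  ring

theorem le_inner_fderiv_inverse (hb : IsMonotoneField k k₁ k₂ b) (β v : E) :
    k / k₁ ^ 2 * ‖v‖ ^ 2 ≤ ⟪fderiv ℝ hb.inverse β v, v⟫ := by
  have h1 := hb.le_inner (hb.inverse β) (fderiv ℝ hb.inverse β v)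
  have h2 := (fderiv ℝ b (hb.inverse β)).le_of_opNorm_le (hb.norm_fderiv_le _)
    (fderiv ℝ hb.inverse β v)
  rw [fderiv_apply_fderiv_inverse] at h1 h2
  rw [real_inner_comm]
  refine le_trans ?_ h1
  have h3 : ‖v‖ ^ 2 ≤ k₁ ^ 2 * ‖fderiv ℝ hb.inverse β v‖ ^ 2 := by
    rw [← mul_pow]; gcongr
  have hk₁ := hb.pos₁
  have hk := hb.pos
  rw [div_mul_eq_mul_div, div_le_iff₀ (by positivity)]
  calc k * ‖v‖ ^ 2 ≤ k * (k₁ ^ 2 * ‖fderiv ℝ hb.inverse β v‖ ^ 2) := by gcongr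
    _ = _ := by ring

theorem inner_fderiv_inverse_le (hb : IsMonotoneField k k₁ k₂ b) (β v : E) :
    ⟪fderiv ℝ hb.inverse β v, v⟫ ≤ k⁻¹ * ‖v‖ ^ 2 := by
  refine (real_inner_le_norm _ _).trans ?_
  rw [sq, ← mul_assoc]
  gcongr
  exact hb.norm_fderiv_inverse_apply_le β v

variable {S : E → ℝ}

theorem inner_sub_le (hb : IsMonotoneField k k₁ k₂ b)
    (hS : ∀ η, HasFDerivAt S (innerSL ℝ (b η)) η) (β η : E) :
    ⟪β, η⟫ - S η ≤ ⟪β, hb.inverse β⟫ - S (hb.inverse β) := by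
  have h1 := hb.add_inner_le hS η (hb.inverse β)
  rw [hb.apply_inverse, inner_sub_right] at h1
  linarith

theorem bddAbove_legendre (hb : IsMonotoneField k k₁ k₂ b)
    (hS : ∀ η, HasFDerivAt S (innerSL ℝ (b η)) η) (β : E) :
    BddAbove (range fun η => ⟪β, η⟫ - S η) :=
  ⟨_, by rintro _ ⟨η, rfl⟩; exact hb.inner_sub_le hS β η⟩

theorem legendre_eq (hb : IsMonotoneField k k₁ k₂ b)
    (hS : ∀ η, HasFDerivAt S (innerSL ℝ (b η)) η) (β : E) :
    ⨆ η, (⟪β, η⟫ - S η) = ⟪β, hb.inverse β⟫ - S (hb.inverse β) :=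
  le_antisymm (ciSup_le (hb.inner_sub_le hS β))
    (le_ciSup (hb.bddAbove_legendre hS β) (hb.inverse β))

/-- The gradient of the Legendre transform is the inverse of the gradient. -/
theorem hasFDerivAt_legendre (hb : IsMonotoneField k k₁ k₂ b)
    (hS : ∀ η, HasFDerivAt S (innerSL ℝ (b η)) η) (β : E) :
    HasFDerivAt (fun β => ⨆ η, (⟪β, η⟫ - S η)) (innerSL ℝ (hb.inverse β)) β := by
  rw [funext (hb.legendre_eq hS)]
  have hg := (hb.differentiable_inverse β).hasFDerivAt
  have h1 := ((hasFDerivAt_id β).inner ℝ hg).sub ((hS (hb.inverse β)).comp β hg)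
  refine h1.congr_fderiv ?_
  ext v
  simp [apply_inverse, real_inner_comm]

theorem fderiv_legendre (hb : IsMonotoneField k k₁ k₂ b)
    (hS : ∀ η, HasFDerivAt S (innerSL ℝ (b η)) η) :
    fderiv ℝ (fun β => ⨆ η, (⟪β, η⟫ - S η)) = fun β => innerSL ℝ (hb.inverse β) :=
  funext fun β => (hb.hasFDerivAt_legendre hS β).fderiv

theorem contDiff_legendre (hb : IsMonotoneField k k₁ k₂ b)
    (hS : ∀ η, HasFDerivAt S (innerSL ℝ (b η)) η) :
    ContDiff ℝ 2 (fun β => ⨆ η, (⟪β, η⟫ - S η)) := by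
  rw [show (2 : WithTop ℕ∞) = 1 + 1 by norm_num, contDiff_succ_iff_fderiv]
  refine ⟨fun β => (hb.hasFDerivAt_legendre hS β).differentiableAt, by simp, ?_⟩
  rw [hb.fderiv_legendre hS]
  exact (innerSL ℝ (E := E)).contDiff.comp (hb.contDiff_inverse.of_le (by norm_num))

theorem fderiv_fderiv_legendre (hb : IsMonotoneField k k₁ k₂ b)
    (hS : ∀ η, HasFDerivAt S (innerSL ℝ (b η)) η) (β v w : E) :
    fderiv ℝ (fderiv ℝ (fun β => ⨆ η, (⟪β, η⟫ - S η))) β v w = ⟪fderiv ℝ hb.inverse β v, w⟫ := by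
  rw [hb.fderiv_legendre hS]
  have h1 := ((innerSL ℝ (E := E)).hasFDerivAt (x := hb.inverse β)).comp β
    (hb.differentiable_inverse β).hasFDerivAt
  have h2 : fderiv ℝ (fun β => innerSL ℝ (hb.inverse β)) β = _ := h1.fderiv
  rw [h2]
  rfl

theorem hessianBetween_legendre (hb : IsMonotoneField k k₁ k₂ b)
    (hS : ∀ η, HasFDerivAt S (innerSL ℝ (b η)) η) :
    HessianBetween (k / k₁ ^ 2) k⁻¹ (fun β => ⨆ η, (⟪β, η⟫ - S η)) := fun β v => by
  rw [hb.fderiv_fderiv_legendre hS]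
  exact ⟨hb.le_inner_fderiv_inverse β v, hb.inner_fderiv_inverse_le β v⟩

end IsMonotoneField

end Legendre

/-! ### The mean as a monotone function of the field -/

section BlockMean

variable {E : Type*} [NormedAddCommGroup E] [InnerProductSpace ℝ E]

theorem hasFDerivAt_comp_inner {F : Type*} [NormedAddCommGroup F] [NormedSpace ℝ F] {f : ℝ → ℝ}
    {f' : ℝ} {a η : E} (hf : HasDerivAt f f' ⟪a, η⟫) (v : F) :
    HasFDerivAt (fun η : E => f ⟪a, η⟫ • v) ((f' • innerSL ℝ a).smulRight v) η :=
  (hf.comp_hasFDerivAt η (innerSL ℝ a).hasFDerivAt).smul_const v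

theorem IsPerturbedQuadratic.hasFDerivAt_blockLogMGF (h : IsPerturbedQuadratic B ψ) {J : ℕ}
    (a : Fin J → E) (η : E) :
    HasFDerivAt (blockLogMGF ψ a) (innerSL ℝ (blockMean ψ a η)) η := by
  have h1 := (HasFDerivAt.fun_sum (u := Finset.univ) fun j _ =>
    (h.hasDerivAt_logMGF ⟪a j, η⟫).comp_hasFDerivAt η (innerSL ℝ (a j)).hasFDerivAt).const_mul
      (1 / (J : ℝ))
  refine HasFDerivAt.congr_fderiv h1 ?_
  rw [blockMean, map_smul, map_sum]
  simp_rw [map_smul]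

/-- The derivative of `blockMean`. -/
noncomputable def blockMeanDeriv (ψ : ℝ → ℝ) {J : ℕ} (a : Fin J → E) (η : E) : E →L[ℝ] E :=
  (1 / (J : ℝ)) • ∑ j, tiltMoment ψ 2 ⟪a j, η⟫ • (innerSL ℝ (a j)).smulRight (a j)

theorem IsPerturbedQuadratic.hasFDerivAt_blockMean (h : IsPerturbedQuadratic B ψ) {J : ℕ}
    (a : Fin J → E) (η : E) : HasFDerivAt (blockMean ψ a) (blockMeanDeriv ψ a η) η := by
  have h1 := (HasFDerivAt.fun_sum (u := Finset.univ) fun j _ =>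
    hasFDerivAt_comp_inner (h.hasDerivAt_tiltMean ⟪a j, η⟫) (a j)).const_smul (1 / (J : ℝ))
  refine HasFDerivAt.congr_fderiv h1 ?_
  rw [blockMeanDeriv]
  congr 1
  refine Finset.sum_congr rfl fun j _ => ?_
  ext v
  simp [mul_smul]

theorem IsPerturbedQuadratic.hasFDerivAt_blockMeanDeriv (h : IsPerturbedQuadratic B ψ) {J : ℕ}
    (a : Fin J → E) (η : E) : HasFDerivAt (blockMeanDeriv ψ a) ((1 / (J : ℝ)) • ∑ j,
      (tiltMoment ψ 3 ⟪a j, η⟫ • innerSL ℝ (a j)).smulRight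
        ((innerSL ℝ (a j)).smulRight (a j))) η :=
  (HasFDerivAt.fun_sum (u := Finset.univ) fun j _ =>
    hasFDerivAt_comp_inner (h.hasDerivAt_tiltMoment_two ⟪a j, η⟫)
      ((innerSL ℝ (a j)).smulRight (a j))).const_smul (1 / (J : ℝ))

theorem inner_blockMeanDeriv {J : ℕ} (a : Fin J → E) (η v : E) :
    ⟪blockMeanDeriv ψ a η v, v⟫ =
      1 / (J : ℝ) * ∑ j, tiltMoment ψ 2 ⟪a j, η⟫ * ⟪a j, v⟫ ^ 2 := by
  simp [blockMeanDeriv, sum_inner, real_inner_smul_left, sq]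

theorem norm_average_le {F : Type*} [NormedAddCommGroup F] [NormedSpace ℝ F] {J : ℕ} {C : ℝ}
    (hC : 0 ≤ C) {f : Fin J → F} (hf : ∀ j, ‖f j‖ ≤ C) :
    ‖(1 / (J : ℝ)) • ∑ j, f j‖ ≤ C := by
  rcases Nat.eq_zero_or_pos J with rfl | hJ
  · simpa using hC
  have hJ' : (0 : ℝ) < J := by exact_mod_cast hJ
  rw [norm_smul, norm_of_nonneg (by positivity), one_div, inv_mul_le_iff₀ hJ']
  refine (norm_sum_le _ _).trans ((Finset.sum_le_sum fun j _ => hf j).trans (le_of_eq ?_))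
  simp

theorem IsBlockFrame.isMonotoneField_blockMean {J : ℕ} {a : Fin J → E} {K c M : ℝ} (hK : 0 < K)
    (hc : 0 < c) (hM : 0 < M) (ha : IsBlockFrame K c a) (h : IsPerturbedQuadratic B ψ)
    (h2 : ∀ σ, tiltMoment ψ 2 σ ≤ M) (h3 : ∀ σ, |tiltMoment ψ 3 σ| ≤ M) :
    IsMonotoneField (rexp (-(2 * B)) * c) (M * K ^ 2) (M * K ^ 3) (blockMean ψ a) := by
  have hd : fderiv ℝ (blockMean ψ a) = blockMeanDeriv ψ a :=
    funext fun η => (h.hasFDerivAt_blockMean a η).fderiv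
  refine ⟨by positivity, by positivity, by positivity, ?_, fun η v => ?_, fun η => ?_, fun η => ?_⟩
  · have h4 := contDiff_infty.1 h.contDiff_tiltMean 2
    refine ContDiff.const_smul _ (ContDiff.sum fun j _ => ContDiff.smul ?_ contDiff_const)
    exact h4.comp (innerSL ℝ (a j)).contDiff
  · rw [hd, inner_blockMeanDeriv, mul_assoc]
    refine (mul_le_mul_of_nonneg_left (ha.2 v) (exp_nonneg _)).trans ?_
    rw [mul_left_comm, Finset.mul_sum]
    gcongr with j _
    exact h.exp_le_tiltMoment_two _
  · rw [hd]
    refine norm_average_le (by positivity) fun j => ?_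
    rw [norm_smul, ContinuousLinearMap.norm_smulRight_apply, innerSL_apply_norm, Real.norm_eq_abs,
      abs_of_nonneg ((exp_nonneg _).trans (h.exp_le_tiltMoment_two _)), sq]
    have := ha.1 j
    gcongr
    exact h2 _
  · rw [hd, (h.hasFDerivAt_blockMeanDeriv a η).fderiv]
    refine norm_average_le (F := E →L[ℝ] E →L[ℝ] E) (f := fun j =>
      (tiltMoment ψ 3 ⟪a j, η⟫ • innerSL ℝ (a j)).smulRight
        ((innerSL ℝ (a j)).smulRight (a j))) (by positivity) fun j => ?_
    rw [ContinuousLinearMap.norm_smulRight_apply, norm_smul,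
      ContinuousLinearMap.norm_smulRight_apply, innerSL_apply_norm, Real.norm_eq_abs]
    have := ha.1 j
    calc |tiltMoment ψ 3 ⟪a j, η⟫| * ‖a j‖ * (‖a j‖ * ‖a j‖) ≤ M * K * (K * K) := by
          gcongr
          exact h3 _
      _ = M * K ^ 3 := by ring

end BlockMean

/-! ### Calculus estimates -/

section Estimates

variable {E : Type*} [NormedAddCommGroup E] [NormedSpace ℝ E]

theorem abs_log_le {a b x : ℝ} (ha : 0 < a) (hax : a ≤ x) (hxb : x ≤ b) :
    |log x| ≤ |log a| + |log b| := by
  have h1 := log_le_log ha hax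
  have h2 := log_le_log (ha.trans_le hax) hxb
  rw [abs_le]
  constructor
  · linarith [neg_abs_le (log a), abs_nonneg (log b)]
  · linarith [le_abs_self (log b), abs_nonneg (log a)]

theorem norm_smul_add_le {F : Type*} [NormedAddCommGroup F] [NormedSpace ℝ F] {r : ℝ} (hr : 0 ≤ r)
    (p q : F) : ‖r • p + q‖ ≤ r * ‖p‖ + ‖q‖ := by
  refine (norm_add_le _ _).trans (le_of_eq ?_)
  rw [norm_smul, norm_of_nonneg hr]

theorem norm_fderiv_log_le {u : E → ℝ} {m M : ℝ} (hm : 0 < m) (hu : ContDiff ℝ 2 u)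
    (hmu : ∀ x, m ≤ u x) (h1 : ∀ x, ‖fderiv ℝ u x‖ ≤ M) (x : E) :
    ‖fderiv ℝ (fun x => log (u x)) x‖ ≤ m⁻¹ * M := by
  have hu0 : 0 < u x := hm.trans_le (hmu x)
  rw [fderiv.log (hu.differentiable (by norm_num) x) hu0.ne', norm_smul,
    norm_of_nonneg (inv_nonneg.2 hu0.le)]
  gcongr
  · exact hmu x
  · exact h1 x

theorem norm_fderiv_fderiv_log_le {u : E → ℝ} {m M M₂ : ℝ} (hm : 0 < m) (hM : 0 ≤ M)
    (hu : ContDiff ℝ 2 u) (hmu : ∀ x, m ≤ u x) (h1 : ∀ x, ‖fderiv ℝ u x‖ ≤ M)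
    (h2 : ∀ x, ‖fderiv ℝ (fderiv ℝ u) x‖ ≤ M₂) (x : E) :
    ‖fderiv ℝ (fderiv ℝ (fun x => log (u x))) x‖ ≤ m⁻¹ * M₂ + m⁻¹ ^ 2 * M ^ 2 := by
  have hu0 : ∀ x, 0 < u x := fun x => hm.trans_le (hmu x)
  have hud : Differentiable ℝ u := hu.differentiable (by norm_num)
  have hud' : Differentiable ℝ (fderiv ℝ u) :=
    (hu.fderiv_right (m := 1) (by norm_num)).differentiable (by norm_num)
  have e : fderiv ℝ (fun x => log (u x)) = fun x => (u x)⁻¹ • fderiv ℝ u x :=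
    funext fun x => fderiv.log (hud x) (hu0 x).ne'
  have hinv : HasFDerivAt (fun x => (u x)⁻¹) (-((u x ^ 2)⁻¹) • fderiv ℝ u x) x :=
    (hasDerivAt_inv (hu0 x).ne').comp_hasFDerivAt x (hud x).hasFDerivAt
  have hmain : HasFDerivAt (fun x => (u x)⁻¹ • fderiv ℝ u x) ((u x)⁻¹ • fderiv ℝ (fderiv ℝ u) x +
      (-((u x ^ 2)⁻¹) • fderiv ℝ u x).smulRight (fderiv ℝ u x)) x :=
    hinv.smul (hud' x).hasFDerivAt
  rw [e, hmain.fderiv]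
  have h0 : 0 ≤ (u x)⁻¹ := inv_nonneg.2 (hu0 x).le
  have hle : (u x)⁻¹ ≤ m⁻¹ := inv_anti₀ hm (hmu x)
  refine (norm_smul_add_le (F := E →L[ℝ] E →L[ℝ] ℝ) h0 _ _).trans ?_
  rw [ContinuousLinearMap.norm_smulRight_apply, norm_smul, norm_neg,
    norm_of_nonneg (inv_nonneg.2 (sq_nonneg (u x))), ← inv_pow]
  refine add_le_add (mul_le_mul hle (h2 x)
    (norm_nonneg (fderiv ℝ (fderiv ℝ u) x)) (inv_nonneg.2 hm.le)) ?_
  rw [mul_assoc, sq M]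
  have := h1 x
  gcongr

theorem norm_sub_smul_sub_le {ε C : ℝ} (hε : 0 ≤ ε) (p q : E) (hq : ‖q‖ ≤ C) :
    ‖p - ε • q - p‖ ≤ ε * C := by
  rw [sub_sub_cancel_left, norm_neg, norm_smul, norm_of_nonneg hε]
  exact mul_le_mul_of_nonneg_left hq hε

/-- Adding a small multiple of a function with bounded derivatives. -/
theorem uniformlyC2Close_of_eq {F G W : E → ℝ} {ε C : ℝ} (hε : 0 ≤ ε)
    (hF : ∀ x, F x = G x - ε * W x) (hG : ContDiff ℝ 2 G) (hW : ContDiff ℝ 2 W)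
    (h0 : ∀ x, |W x| ≤ C) (h1 : ∀ x, ‖fderiv ℝ W x‖ ≤ C)
    (h2 : ∀ x, ‖fderiv ℝ (fderiv ℝ W) x‖ ≤ C) : UniformlyC2Close (ε * C) F G := by
  have hGd : Differentiable ℝ G := hG.differentiable (by norm_num)
  have hWd : Differentiable ℝ W := hW.differentiable (by norm_num)
  have hGd' : Differentiable ℝ (fderiv ℝ G) :=
    (hG.fderiv_right (m := 1) (by norm_num)).differentiable (by norm_num)
  have hWd' : Differentiable ℝ (fderiv ℝ W) :=
    (hW.fderiv_right (m := 1) (by norm_num)).differentiable (by norm_num)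
  have e0 : F = fun x => G x - ε • W x := funext hF
  have e1 : fderiv ℝ F = fun x => fderiv ℝ G x - ε • fderiv ℝ W x := by
    rw [e0]
    exact funext fun x => ((hGd x).hasFDerivAt.sub ((hWd x).hasFDerivAt.const_smul ε)).fderiv
  have e2 : fderiv ℝ (fderiv ℝ F) =
      fun x => fderiv ℝ (fderiv ℝ G) x - ε • fderiv ℝ (fderiv ℝ W) x := by
    rw [e1]
    exact funext fun x => ((hGd' x).hasFDerivAt.sub ((hWd' x).hasFDerivAt.const_smul ε)).fderiv
  intro x
  rw [e2, e1, hF]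
  exact ⟨norm_sub_smul_sub_le hε (G x) (W x) (h0 x), norm_sub_smul_sub_le hε _ _ (h1 x),
    norm_sub_smul_sub_le (E := E →L[ℝ] E →L[ℝ] ℝ) hε (fderiv ℝ (fderiv ℝ G) x)
      (fderiv ℝ (fderiv ℝ W) x) (h2 x)⟩

theorem HessianBetween.of_uniformlyC2Close {F G : E → ℝ} {m M ε m' M' : ℝ}
    (hG : HessianBetween m M G) (hFG : UniformlyC2Close ε F G) (hm : m' ≤ m - ε) (hM : M + ε ≤ M') :
    HessianBetween m' M' F := fun x v => by
  have h1 := (fderiv ℝ (fderiv ℝ F) x - fderiv ℝ (fderiv ℝ G) x).le_opNorm₂ v v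
  have h2 := (hFG x).2.2
  have h3 : |fderiv ℝ (fderiv ℝ F) x v v - fderiv ℝ (fderiv ℝ G) x v v| ≤ ε * ‖v‖ ^ 2 := by
    refine (h1.trans ?_ : _)
    rw [mul_assoc, sq]
    gcongr
  have h4 := abs_le.1 h3
  have h5 := hG x v
  have h6 := mul_le_mul_of_nonneg_right hm (sq_nonneg ‖v‖)
  have h7 := mul_le_mul_of_nonneg_right hM (sq_nonneg ‖v‖)
  constructor <;> linarith [h4.1, h4.2, h5.1, h5.2]

end Estimates

/-! ### The free energy of a block -/

section BlockEstimates

variable {E : Type*} [NormedAddCommGroup E] [InnerProductSpace ℝ E] [FiniteDimensional ℝ E]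

theorem IsMonotoneField.norm_iteratedFDeriv_comp_inverse_le {k k₁ k₂ M D : ℝ} {b : E → E}
    (hb : IsMonotoneField k k₁ k₂ b) {R : E → ℝ} (hR : ContDiff ℝ 2 R)
    (hM : ∀ η, ∀ i ≤ 2, ‖iteratedFDeriv ℝ i R η‖ ≤ M) (hD1 : 1 ≤ D) (hkD : k⁻¹ ≤ D)
    (hkD' : k⁻¹ ^ 3 * k₂ ≤ D) (β : E) :
    ‖fderiv ℝ (R ∘ hb.inverse) β‖ ≤ M * D ∧
      ‖fderiv ℝ (fderiv ℝ (R ∘ hb.inverse)) β‖ ≤ 2 * M * D ^ 2 := by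
  have hD : ∀ i, 1 ≤ i → i ≤ 2 → ‖iteratedFDeriv ℝ i hb.inverse β‖ ≤ D ^ i := fun i h1 h2 => by
    interval_cases i
    · rw [norm_iteratedFDeriv_one, pow_one]
      exact (hb.norm_fderiv_inverse_le β).trans hkD
    · rw [norm_iteratedFDeriv_two]
      exact ((hb.norm_fderiv_fderiv_inverse_le β).trans hkD').trans (le_self_pow₀ hD1 two_ne_zero)
  have key : ∀ n : ℕ, n ≤ 2 → ‖iteratedFDeriv ℝ n (R ∘ hb.inverse) β‖ ≤ n.factorial * M * D ^ n :=
    fun n hn => norm_iteratedFDeriv_comp_le hR hb.contDiff_inverse (by exact_mod_cast hn) β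
      (fun i hi => hM _ i (hi.trans hn)) fun i h1 h2 => hD i h1 (h2.trans hn)
  constructor
  · rw [← norm_iteratedFDeriv_one]
    simpa using key 1 (by norm_num)
  · rw [← norm_iteratedFDeriv_two]
    simpa using key 2 le_rfl

/-- The free energy on the fibres of `T`, for a block whose vectors `J T e_j` form a frame, is close
in `C²` to the Legendre transform of `blockLogMGF`: the two differ by `1 / J` times the logarithm of
the local limit density, evaluated at the field that belongs to the fibre. -/
theorem exists_block_estimates (E : Type*) [NormedAddCommGroup E] [InnerProductSpace ℝ E]
    [FiniteDimensional ℝ E] [MeasurableSpace E] [BorelSpace E] (B : ℝ) {K c : ℝ} (hK : 1 ≤ K)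
    (hc : 0 < c) :
    ∃ lam Lam C : ℝ, ∃ Jstar : ℕ, 0 < lam ∧ 0 < Lam ∧ 0 < C ∧ 0 < Jstar ∧
      ∀ ψ : ℝ → ℝ, IsPerturbedQuadratic B ψ → ∀ J : ℕ, Jstar ≤ J →
      ∀ T : EuclideanSpace ℝ (Fin J) →L[ℝ] E, IsBlockFrame K c (blockVec T) →
      ∀ F G : E → ℝ,
        (∀ β, F β = -(1 / (J : ℝ)) * log (∫ x, rexp (-hamiltonian ψ x) ∂(sliceMeasure T β))) →
        (∀ β, G β = ⨆ η, (⟪β, η⟫ - blockLogMGF ψ (blockVec T) η)) →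
        (∀ β, Integrable (fun x => rexp (-hamiltonian ψ x)) (sliceMeasure T β) ∧
          0 < ∫ x, rexp (-hamiltonian ψ x) ∂(sliceMeasure T β)) ∧
        (∀ β, BddAbove (range fun η => ⟪β, η⟫ - blockLogMGF ψ (blockVec T) η)) ∧
        ContDiff ℝ 2 F ∧ ContDiff ℝ 2 G ∧
        HessianBetween (2 * lam) (2 * Lam) F ∧ UniformlyC2Close (C / J) F G := by
  obtain ⟨m, M, J₁, hm, hM, hJ₁, hdens⟩ := exists_blockDensity_bounds E B hK hc
  obtain ⟨_, M', _, hM'1, hsite⟩ := exists_siteChar_bounds B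
  have hK0 : 0 < K := one_pos.trans_le hK
  have hM' : 0 < M' := one_pos.trans_le hM'1
  set k : ℝ := rexp (-(2 * B)) * c with hk
  set k₁ : ℝ := M' * K ^ 2 with hk₁
  set k₂ : ℝ := M' * K ^ 3 with hk₂
  have hk0 : 0 < k := by positivity
  have hk₁0 : 0 < k₁ := by positivity
  have hk₂0 : 0 < k₂ := by positivity
  -- `D ^ i` bounds the `i`-th derivative of the inverse of the mean, for `i = 1, 2`
  set D : ℝ := 1 + k⁻¹ + k⁻¹ ^ 3 * k₂ with hD
  have hD0 : 0 < D := by positivity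
  have hki : 0 < k⁻¹ := by positivity
  have hki' : 0 < k⁻¹ ^ 3 * k₂ := by positivity
  have hD1 : 1 ≤ D := by rw [hD]; linarith
  have hkD : k⁻¹ ≤ D := by rw [hD]; linarith
  have hkD' : k⁻¹ ^ 3 * k₂ ≤ D := by rw [hD]; linarith
  set d := Module.finrank ℝ E
  set C₀ : ℝ := |log (√c ^ d)| + |log (K ^ d)| + (|log m| + |log M|) with hC₀
  set C₁ : ℝ := m⁻¹ * (M * D) with hC₁
  set C₂ : ℝ := m⁻¹ * (2 * M * D ^ 2) + m⁻¹ ^ 2 * (M * D) ^ 2 with hC₂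
  have hC₀0 : 0 ≤ C₀ := by positivity
  have hC₁0 : 0 < C₁ := by positivity
  have hC₂0 : 0 < C₂ := by positivity
  set C : ℝ := C₀ + C₁ + C₂ with hC
  have hC0 : 0 < C := by positivity
  set l : ℝ := k / k₁ ^ 2 with hl
  have hl0 : 0 < l := by positivity
  obtain ⟨J₂, hJ₂⟩ := exists_nat_gt (2 * C / l)
  refine ⟨l / 4, (k⁻¹ + C) / 2, C, max J₁ J₂, by positivity, by positivity, hC0,
    lt_of_lt_of_le hJ₁ (le_max_left _ _), fun ψ h J hJ T hT F G hF hG => ?_⟩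
  have hJJ₁ : J₁ ≤ J := (le_max_left _ _).trans hJ
  have hJ0 : 0 < J := hJ₁.trans_le hJJ₁
  have hJ1 : (1 : ℝ) ≤ J := by exact_mod_cast hJ0
  have hJ' : (0 : ℝ) < J := by linarith
  have hJl : 2 * C / l ≤ J := hJ₂.le.trans (by exact_mod_cast (le_max_right _ _).trans hJ)
  set a := blockVec T with ha
  obtain ⟨hchar, hRdiff, hRm, hRM⟩ := hdens ψ h J hJJ₁ a hT
  obtain ⟨θ, hθ1, hθ2, hθ⟩ := exists_integral_slice_eq hJ0 hK0 hc T hT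
  have hθ0 : 0 < θ := lt_of_lt_of_le (by positivity) hθ1
  have hb : IsMonotoneField k k₁ k₂ (blockMean ψ a) := hT.isMonotoneField_blockMean hK0 hc hM' h
    (fun σ => (hsite ψ h σ).2.2.2.2.1) fun σ => (hsite ψ h σ).2.2.2.2.2
  have hS := h.hasFDerivAt_blockLogMGF a
  have hGeq : G = fun β => ⨆ η, (⟪β, η⟫ - blockLogMGF ψ a η) := funext hG
  have hGdiff : ContDiff ℝ 2 G := by rw [hGeq]; exact hb.contDiff_legendre hS
  have hGhess : HessianBetween l k⁻¹ G := by rw [hGeq]; exact hb.hessianBetween_legendre hS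
  set u : E → ℝ := blockDensity ψ a ∘ hb.inverse with hu
  have hu0 : ∀ β, 0 < u β := fun β => hm.trans_le (hRm _)
  have hslice : ∀ β, Integrable (fun x => rexp (-hamiltonian ψ x)) (sliceMeasure T β) ∧
      ∫ x, rexp (-hamiltonian ψ x) ∂(sliceMeasure T β) =
        rexp (-(J * G β)) * (θ * u β) := fun β => by
    have h1 := hθ B ψ h (hb.inverse β) (hchar _)
    rw [← ha, hb.apply_inverse] at h1
    rw [hG, hb.legendre_eq hS]
    exact h1
  have hudiff : ContDiff ℝ 2 u := hRdiff.comp hb.contDiff_inverse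
  have hubound := hb.norm_iteratedFDeriv_comp_inverse_le hRdiff hRM hD1 hkD hkD'
  -- the correction: `F = G - W / J`
  set W : E → ℝ := fun β => log θ + log (u β) with hW
  have hWdiff : ContDiff ℝ 2 W := contDiff_const.add (hudiff.log fun β => (hu0 β).ne')
  have hWd : fderiv ℝ W = fderiv ℝ fun β => log (u β) :=
    funext fun β => fderiv_const_add _
  have hW0 : ∀ β, |W β| ≤ C := fun β => by
    have h1 := abs_log_le (by positivity) hθ1 hθ2
    have h2 : u β ≤ M := by
      have := hRM (hb.inverse β) 0 (by norm_num)
      rw [norm_iteratedFDeriv_zero] at this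
      exact (le_abs_self _).trans this
    have h3 := abs_log_le hm (hRm (hb.inverse β)) h2
    refine (abs_add_le _ _).trans ((add_le_add h1 h3).trans ?_)
    linarith
  have hW1 : ∀ β, ‖fderiv ℝ W β‖ ≤ C := fun β => by
    rw [hWd]
    refine (norm_fderiv_log_le hm hudiff (fun β => hRm _) (fun β => (hubound β).1) β).trans ?_
    linarith
  have hW2 : ∀ β, ‖fderiv ℝ (fderiv ℝ W) β‖ ≤ C := fun β => by
    rw [hWd]
    refine (norm_fderiv_fderiv_log_le hm (by positivity) hudiff (fun β => hRm _)
      (fun β => (hubound β).1) (fun β => (hubound β).2) β).trans ?_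
    linarith
  have hFeq : ∀ β, F β = G β - 1 / (J : ℝ) * W β := fun β => by
    rw [hF, (hslice β).2, log_mul (exp_pos _).ne' (mul_pos hθ0 (hu0 β)).ne',
      log_mul hθ0.ne' (hu0 β).ne', log_exp, hW]
    field_simp
    ring
  have hclose : UniformlyC2Close (C / J) F G := by
    have := uniformlyC2Close_of_eq (by positivity) hFeq hGdiff hWdiff hW0 hW1 hW2
    rwa [one_div_mul_eq_div] at this
  refine ⟨fun β => ⟨(hslice β).1, ?_⟩, hb.bddAbove_legendre hS, ?_, hGdiff, ?_, hclose⟩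
  · rw [(hslice β).2]
    exact mul_pos (exp_pos _) (mul_pos hθ0 (hu0 β))
  · rw [funext hFeq]
    exact hGdiff.sub (contDiff_const.mul hWdiff)
  · refine hGhess.of_uniformlyC2Close hclose ?_ ?_
    · rw [div_le_iff₀ hl0] at hJl
      have : C / J ≤ l / 2 := by rw [div_le_iff₀ hJ']; linarith
      linarith
    · have : C / J ≤ C := div_le_self hC0.le hJ1
      linarith

end BlockEstimates

/-! ### The space of polynomials -/

section DG

/-- On the finite-dimensional space of polynomials the supremum norms on `[0, 1]` of a polynomial
and of its derivative are controlled by the norm of `L²`. -/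
theorem exists_polynomial_bounds (L : ℕ) : ∃ K : ℝ, 1 ≤ K ∧ ∀ η : dgSpace L, ∃ p : ℝ[X],
    ((η : L2Torus) =ᵐ[torusMeasure] fun θ => p.eval θ) ∧
    (∀ θ ∈ Icc (0 : ℝ) 1, |p.eval θ| ≤ K * ‖η‖) ∧
    ∀ θ ∈ Icc (0 : ℝ) 1, ∀ t ∈ Icc (0 : ℝ) 1, |p.eval t - p.eval θ| ≤ K * ‖η‖ * |t - θ| := by
  have hmem : ∀ p : degreeLT ℝ (L + 1), polynomialToL2 p ∈ dgSpace L := fun p => by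
    refine ⟨p, ?_, (memLp_polynomial (p : ℝ[X])).coeFn_toLp⟩
    exact Order.le_of_lt_succ (mem_degreeLT.1 p.2)
  set f : degreeLT ℝ (L + 1) →ₗ[ℝ] dgSpace L :=
    (polynomialToL2 ∘ₗ (degreeLT ℝ (L + 1)).subtype).codRestrict (dgSpace L) hmem with hf
  have hsurj : Function.Surjective f := by
    rintro ⟨y, p, hp, hy⟩
    refine ⟨⟨p, mem_degreeLT.2 (lt_of_le_of_lt hp (by exact_mod_cast Nat.lt_succ_self L))⟩, ?_⟩
    refine Subtype.ext (Lp.ext ?_)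
    filter_upwards [hy, (memLp_polynomial p).coeFn_toLp] with θ h1 h2
    rw [h1]
    exact h2
  obtain ⟨g, hg⟩ := f.exists_rightInverse_of_surjective (LinearMap.range_eq_top.2 hsurj)
  set l : ℕ → dgSpace L →L[ℝ] ℝ := fun i =>
    LinearMap.toContinuousLinearMap (lcoeff ℝ i ∘ₗ (degreeLT ℝ (L + 1)).subtype ∘ₗ g) with hl
  refine ⟨1 + ∑ i ∈ Finset.range (L + 1), (1 + i) * ‖l i‖, ?_, fun η => ⟨g η, ?_, ?_, ?_⟩⟩
  · exact le_add_of_nonneg_right (Finset.sum_nonneg fun i _ => by positivity)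
  · have h1 : f (g η) = η := LinearMap.congr_fun hg η
    have h2 : (η : L2Torus) = polynomialToL2 (g η) := by
      conv_lhs => rw [← h1]
      rfl
    rw [h2]
    exact (memLp_polynomial (g η : ℝ[X])).coeFn_toLp
  all_goals
    have hdeg : (g η : ℝ[X]).natDegree < L + 1 := by
      by_cases h0 : (g η : ℝ[X]) = 0
      · rw [h0, natDegree_zero]; exact Nat.succ_pos L
      · exact (natDegree_lt_iff_degree_lt h0).2 (mem_degreeLT.1 (g η).2)
    have hcoeff : ∀ i, |(g η : ℝ[X]).coeff i| ≤ ‖l i‖ * ‖η‖ := fun i => (l i).le_opNorm η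
  · intro θ hθ
    rw [eval_eq_sum_range' hdeg, add_mul, Finset.sum_mul]
    refine (Finset.abs_sum_le_sum_abs _ _).trans ?_
    refine le_trans ?_ (le_add_of_nonneg_left (by positivity))
    refine Finset.sum_le_sum fun i _ => ?_
    rw [abs_mul, abs_of_nonneg (pow_nonneg hθ.1 i)]
    calc |(g η : ℝ[X]).coeff i| * θ ^ i ≤ (‖l i‖ * ‖η‖) * 1 := by
          gcongr
          · exact pow_nonneg hθ.1 i
          · exact hcoeff i
          · exact pow_le_one₀ hθ.1 hθ.2
      _ ≤ (1 + i) * ‖l i‖ * ‖η‖ := by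
          have : 0 ≤ (i : ℝ) * (‖l i‖ * ‖η‖) := by positivity
          linarith
  · intro θ hθ t ht
    refine (convex_Icc (0 : ℝ) 1).norm_image_sub_le_of_norm_deriv_le
      (f := fun s => (g η : ℝ[X]).eval s) (fun s _ => (g η : ℝ[X]).differentiableAt)
      (fun s hs => ?_) hθ ht
    rw [Polynomial.deriv, derivative_eval, sum_over_range' _ (by simp) _ hdeg, add_mul,
      Finset.sum_mul]
    refine (Finset.abs_sum_le_sum_abs _ _).trans ?_
    refine le_trans ?_ (le_add_of_nonneg_left (by positivity))
    refine Finset.sum_le_sum fun i _ => ?_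
    rw [abs_mul, abs_mul, abs_of_nonneg (pow_nonneg hs.1 _), Nat.abs_cast]
    calc |(g η : ℝ[X]).coeff i| * i * s ^ (i - 1) ≤ (‖l i‖ * ‖η‖) * i * 1 := by
          gcongr
          · exact pow_nonneg hs.1 _
          · exact hcoeff i
          · exact pow_le_one₀ hs.1 hs.2
      _ ≤ (1 + i) * ‖l i‖ * ‖η‖ := by
          have : 0 ≤ ‖l i‖ * ‖η‖ := by positivity
          linarith

/-- The `j`-th of the `J` subintervals of `[0, 1)`. -/
def cell {J : ℕ} (j : Fin J) : Set ℝ := Ico ((j : ℝ) / J) (((j : ℝ) + 1) / J)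

theorem cell_subset {J : ℕ} (j : Fin J) : cell j ⊆ Ico (0 : ℝ) 1 := by
  have hJ : (0 : ℝ) < J := by exact_mod_cast j.pos
  have hj : (j : ℝ) + 1 ≤ J := by exact_mod_cast j.2
  refine Ico_subset_Ico (by positivity) ?_
  rw [div_le_one hJ]
  exact hj

theorem measureReal_cell {J : ℕ} (j : Fin J) : volume.real (cell j) = 1 / J := by
  have hJ : (0 : ℝ) < J := by exact_mod_cast j.pos
  have h1 : ((j : ℝ) + 1) / J - (j : ℝ) / J = 1 / J := by rw [← sub_div, add_sub_cancel_left]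
  rw [cell, Real.volume_real_Ico_of_le, h1]
  gcongr
  linarith

theorem exists_mem_cell {J : ℕ} (hJ : 0 < J) {θ : ℝ} (hθ : θ ∈ Ico (0 : ℝ) 1) :
    ∃ j : Fin J, θ ∈ cell j := by
  have hJ' : (0 : ℝ) < J := by exact_mod_cast hJ
  have h0 : 0 ≤ θ * J := mul_nonneg hθ.1 hJ'.le
  refine ⟨⟨⌊θ * J⌋₊, ?_⟩, ?_, ?_⟩
  · rw [Nat.floor_lt h0]
    nlinarith [hθ.2]
  · rw [div_le_iff₀ hJ']
    exact Nat.floor_le h0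
  · rw [lt_div_iff₀ hJ']
    exact Nat.lt_floor_add_one _

theorem abs_sub_le_of_mem_cell {J : ℕ} {j : Fin J} {s t : ℝ} (hs : s ∈ cell j) (ht : t ∈ cell j) :
    |s - t| ≤ 1 / J := by
  have h1 : ((j : ℝ) + 1) / J = (j : ℝ) / J + 1 / J := add_div _ _ _
  rw [cell, h1] at hs ht
  rw [abs_le]
  constructor <;> linarith [hs.1, hs.2, ht.1, ht.2]

theorem stepFun_eq_of_mem_cell {J : ℕ} (x : EuclideanSpace ℝ (Fin J)) {j : Fin J} {θ : ℝ}
    (hθ : θ ∈ cell j) : stepFun x θ = x j := by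
  have hJ : (0 : ℝ) < J := by exact_mod_cast j.pos
  rw [stepFun, Finset.sum_eq_single j]
  · exact indicator_of_mem hθ _
  · intro i _ hij
    refine indicator_of_notMem (fun hi => hij ?_) _
    have h1 := hi.1; have h2 := hi.2; have h3 := hθ.1; have h4 := hθ.2
    rw [div_le_iff₀ hJ] at h1 h3
    rw [lt_div_iff₀ hJ] at h2 h4
    have h5 : (i : ℕ) < j + 1 := by exact_mod_cast h1.trans_lt h4
    have h6 : (j : ℕ) < i + 1 := by exact_mod_cast h3.trans_lt h2
    exact Fin.ext (by omega)
  · simp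

theorem inner_Q (L J : ℕ) (x : EuclideanSpace ℝ (Fin J)) (η : dgSpace L) :
    ⟪Q L J x, η⟫ = ⟪stepEmbedding J x, (η : L2Torus)⟫ :=
  Submodule.inner_orthogonalProjectionOnto_eq_of_mem_right η _

/-- The coordinates of `J Qᵗ η` are the averages of `η` over the cells. -/
theorem inner_blockVec_Q {L J : ℕ} (j : Fin J) {η : dgSpace L} {p : ℝ[X]}
    (hp : (η : L2Torus) =ᵐ[torusMeasure] fun θ => p.eval θ) :
    ⟪blockVec (Q L J) j, η⟫ = J * ∫ θ in cell j, p.eval θ := by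
  rw [blockVec, real_inner_smul_left, inner_Q, L2.inner_def]
  congr 1
  have h1 : ∀ᵐ θ ∂torusMeasure,
      ⟪(stepEmbedding J (EuclideanSpace.single j 1) : L2Torus) θ, (η : L2Torus) θ⟫ =
      (cell j).indicator (fun θ => p.eval θ) θ := by
    filter_upwards [hp, (memLp_stepFun (EuclideanSpace.single j (1 : ℝ))).coeFn_toLp,
      ae_restrict_mem measurableSet_Ico] with θ h1 h2 h3
    have h4 : (stepEmbedding J (EuclideanSpace.single j 1) : L2Torus) θ =
        stepFun (EuclideanSpace.single j (1 : ℝ)) θ := h2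
    rw [h4, h1]
    obtain ⟨i, hi⟩ := exists_mem_cell j.pos h3
    rw [stepFun_eq_of_mem_cell _ hi]
    by_cases hij : i = j
    · subst hij
      rw [indicator_of_mem hi]
      simp
    · rw [indicator_of_notMem]
      · simp [hij]
      · intro hj
        refine hij ?_
        have h5 := stepFun_eq_of_mem_cell (EuclideanSpace.single j (1 : ℝ)) hi
        have h6 := stepFun_eq_of_mem_cell (EuclideanSpace.single j (1 : ℝ)) hj
        rw [h5] at h6
        by_contra hne
        simp [hne] at h6
  rw [integral_congr_ae h1, integral_indicator (show MeasurableSet (cell j) from measurableSet_Ico),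
    torusMeasure, Measure.restrict_restrict (show MeasurableSet (cell j) from measurableSet_Ico),
    inter_eq_left.2 (cell_subset j)]

theorem abs_inner_blockVec_sub_le {L J : ℕ} (j : Fin J) {η : dgSpace L} {p : ℝ[X]}
    (hp : (η : L2Torus) =ᵐ[torusMeasure] fun θ => p.eval θ) {r C : ℝ}
    (hC : ∀ θ ∈ cell j, |p.eval θ - r| ≤ C) : |⟪blockVec (Q L J) j, η⟫ - r| ≤ C := by
  have hJ : (0 : ℝ) < J := by exact_mod_cast j.pos
  have hfin : volume (cell j) < ⊤ := measure_Ico_lt_top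
  have h1 : IntegrableOn (fun θ => p.eval θ) (cell j) :=
    (p.continuous.integrableOn_Icc).mono_set Ico_subset_Icc_self
  have h2 : ∫ θ in cell j, (p.eval θ - r) = (∫ θ in cell j, p.eval θ) - 1 / J * r := by
    rw [integral_sub h1 (integrableOn_const hfin.ne), setIntegral_const, measureReal_cell,
      smul_eq_mul]
  have h3 := norm_setIntegral_le_of_norm_le_const (f := fun θ => p.eval θ - r) hfin hC
  rw [h2, measureReal_cell, Real.norm_eq_abs, mul_one_div, le_div_iff₀ hJ] at h3
  rw [inner_blockVec_Q j hp]
  refine le_trans (le_of_eq ?_) h3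
  rw [← abs_of_pos hJ, ← abs_mul, abs_of_pos hJ]
  congr 1
  field_simp

theorem exists_isBlockFrame_Q (L : ℕ) : ∃ K : ℝ, ∃ J₀ : ℕ, 1 ≤ K ∧ 0 < J₀ ∧
    ∀ J : ℕ, J₀ ≤ J → IsBlockFrame K (1 / 2) (blockVec (Q L J)) := by
  obtain ⟨K, hK, hpoly⟩ := exists_polynomial_bounds L
  have hK0 : 0 < K := one_pos.trans_le hK
  obtain ⟨J₀, hJ₀⟩ := exists_nat_gt (2 * K)
  have hJ₀0 : 0 < J₀ := by
    have : (0 : ℝ) < J₀ := lt_trans (by positivity) hJ₀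
    exact_mod_cast this
  refine ⟨K, J₀, hK, hJ₀0, fun J hJ => ⟨fun j => ?_, fun η => ?_⟩⟩
  · obtain ⟨p, hp, hpK, -⟩ := hpoly (blockVec (Q L J) j)
    have h1 := abs_inner_blockVec_sub_le j hp (r := 0) (C := K * ‖blockVec (Q L J) j‖)
      fun θ hθ => by
        rw [sub_zero]
        exact hpK θ (Ico_subset_Icc_self (cell_subset j hθ))
    rw [sub_zero, real_inner_self_eq_norm_sq, abs_of_nonneg (sq_nonneg _), sq] at h1
    rcases (norm_nonneg (blockVec (Q L J) j)).eq_or_lt with h0 | h0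
    · rw [← h0]; exact hK0.le
    · exact le_of_mul_le_mul_right h1 h0
  · obtain ⟨p, hp, -, hpK⟩ := hpoly η
    have hJ0 : 0 < J := hJ₀0.trans_le hJ
    have hJ' : (0 : ℝ) < J := by exact_mod_cast hJ0
    have hJK : K / J ≤ 1 / 2 := by
      rw [div_le_iff₀ hJ']
      have : (J₀ : ℝ) ≤ J := by exact_mod_cast hJ
      linarith
    -- the step function of the averages of `η` is close to `η`
    set x : EuclideanSpace ℝ (Fin J) := WithLp.toLp 2 fun j => ⟪blockVec (Q L J) j, η⟫ with hx
    have hxj : ∀ j, x j = ⟪blockVec (Q L J) j, η⟫ := fun j => rfl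
    have h1 : 1 / (J : ℝ) * ∑ j, ⟪blockVec (Q L J) j, η⟫ ^ 2 =
        ⟪stepEmbedding J x, (η : L2Torus)⟫ := by
      rw [← inner_Q, one_div, inv_mul_eq_iff_eq_mul₀ hJ'.ne', natCast_mul_inner_apply]
      simp_rw [hxj, sq]
    have h2 : ‖stepEmbedding J x - (η : L2Torus)‖ ≤ K / J * ‖η‖ := by
      have h3 := Lp.norm_le_of_ae_bound (f := stepEmbedding J x - (η : L2Torus))
        (C := K / J * ‖η‖) (by positivity) (by
          filter_upwards [hp, (memLp_stepFun x).coeFn_toLp, ae_restrict_mem measurableSet_Ico,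
            Lp.coeFn_sub (stepEmbedding J x) (η : L2Torus)] with θ h4 h5 h6 h7
          have h8 : (stepEmbedding J x : L2Torus) θ = stepFun x θ := h5
          obtain ⟨j, hj⟩ := exists_mem_cell hJ0 h6
          rw [h7, Pi.sub_apply, h8, h4, stepFun_eq_of_mem_cell x hj]
          refine abs_inner_blockVec_sub_le j hp fun t ht => ?_
          refine (hpK θ (Ico_subset_Icc_self h6) t
            (Ico_subset_Icc_self (cell_subset j ht))).trans ?_
          rw [div_mul_eq_mul_div, div_eq_mul_one_div]
          gcongr
          exact abs_sub_le_of_mem_cell ht hj)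
      have h9 : measureUnivNNReal torusMeasure = 1 := by
        rw [measureUnivNNReal]
        simp
      rw [h9] at h3
      simpa using h3
    have h3 : ⟪stepEmbedding J x, (η : L2Torus)⟫ =
        ‖η‖ ^ 2 + ⟪stepEmbedding J x - (η : L2Torus), (η : L2Torus)⟫ := by
      rw [inner_sub_left, real_inner_self_eq_norm_sq, Submodule.coe_norm]
      ring
    have h4 := (abs_le.1 (abs_real_inner_le_norm
      (stepEmbedding J x - (η : L2Torus)) (η : L2Torus))).1
    have h5 : ‖stepEmbedding J x - (η : L2Torus)‖ * ‖(η : L2Torus)‖ ≤ 1 / 2 * ‖η‖ ^ 2 := by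
      calc ‖stepEmbedding J x - (η : L2Torus)‖ * ‖(η : L2Torus)‖
          ≤ (K / J * ‖η‖) * ‖η‖ := mul_le_mul_of_nonneg_right h2 (norm_nonneg _)
        _ = K / J * ‖η‖ ^ 2 := by ring
        _ ≤ _ := by gcongr
    rw [h1, h3]
    linarith

end DG

end SingleBlock

theorem mainTheorem5 (L : ℕ) (B : ℝ) :
    ∃ lam Lam C : ℝ, ∃ Jstar : ℕ, 0 < lam ∧ 0 < Lam ∧ 0 < C ∧ 0 < Jstar ∧
      ∀ ψ : ℝ → ℝ, SingleBlock.IsPerturbedQuadratic B ψ → ∀ J : ℕ, Jstar ≤ J →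
        -- the integrals over the fibres, the supremum and the derivatives are well defined
        (∀ β : SingleBlock.dgSpace L,
          Integrable (fun x => Real.exp (-SingleBlock.hamiltonian ψ x))
            (SingleBlock.fibreMeasure L J β) ∧
          0 < ∫ x, Real.exp (-SingleBlock.hamiltonian ψ x) ∂(SingleBlock.fibreMeasure L J β)) ∧
        (∀ β : SingleBlock.dgSpace L, BddAbove (Set.range fun η : SingleBlock.dgSpace L =>
          inner ℝ β η - SingleBlock.grandFreeEnergy ψ L J η)) ∧
        ContDiff ℝ 2 (SingleBlock.blockFreeEnergy ψ L J) ∧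
        ContDiff ℝ 2 (SingleBlock.legendreFreeEnergy ψ L J) ∧
        -- the bounds on the Hessian of `ψ_J` and the closeness of `ψ_J` to `ψ̄_J`
        SingleBlock.HessianBetween (2 * lam) (2 * Lam) (SingleBlock.blockFreeEnergy ψ L J) ∧
        SingleBlock.UniformlyC2Close (C / J) (SingleBlock.blockFreeEnergy ψ L J)
          (SingleBlock.legendreFreeEnergy ψ L J) := by
  let _ : MeasurableSpace (SingleBlock.dgSpace L) := borel _
  have : BorelSpace (SingleBlock.dgSpace L) := ⟨rfl⟩
  obtain ⟨K, J₀, hK, hJ₀, hframe⟩ := SingleBlock.exists_isBlockFrame_Q L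
  obtain ⟨lam, Lam, C, J₁, hlam, hLam, hC, hJ₁, hmain⟩ :=
    SingleBlock.exists_block_estimates (SingleBlock.dgSpace L) B hK one_half_pos
  refine ⟨lam, Lam, C, max J₀ J₁, hlam, hLam, hC, lt_of_lt_of_le hJ₀ (le_max_left _ _),
    fun ψ h J hJ => ?_⟩
  have hgrand : SingleBlock.grandFreeEnergy ψ L J =
      SingleBlock.blockLogMGF ψ (SingleBlock.blockVec (SingleBlock.Q L J)) := funext fun η => by
    rw [SingleBlock.grandFreeEnergy, SingleBlock.blockLogMGF]
    simp_rw [SingleBlock.natCast_mul_adjoint_apply]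
  rw [hgrand]
  exact hmain ψ h J ((le_max_right _ _).trans hJ) (SingleBlock.Q L J)
    (hframe J ((le_max_left _ _).trans hJ)) _ _ (fun β => rfl) fun β => by
      rw [SingleBlock.legendreFreeEnergy, hgrand]
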